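/- Let $n\ge 1$, $m\ge 0$, $r\ge 0$ be integers, $N=n+m$, and let $X$ be a smooth ($C^\infty$, Hausdorff, second countable) manifold of dimension $N$. **Notation.** For a smooth immersion $\gamma$ of a neighbourhood of $0\in\mathbb R^n$ into $X$, let $j^r_0\gamma$ be its $r$-jet at $0$: $j^r_0\gamma=j^r_0\delta$ iff there is a chart $\psi=(x^A)$ of $X$ around $\gamma(0)$ and $\delta(0)$ in which $\gamma$ and $\delta$ have the same partial derivatives up to order $r$ at $0$. Let $\mathrm{Imm}\,T^r_nX$ be the set of these jets (the regular $(r,n)$-velocities), with the smooth structure given by the associated charts $(V^r_n,\psi^r_n)$ of the charts $(V,\psi)$ of $X$: $V^r_n=\{j^r_0\gamma\mid\gamma(0)\in V\}$, $\psi^r_n=(x^A_J)_{1\le A\le N,\,|J|\le r}$, $x^A_J(j^r_0\gamma)=\partial_J(x^A\circ\gamma)(0)$, where $J=(j_1\le\dots\le j_k)$ are multi-indices with entries in $\{1,\dots,n\}$. Let $L^r_n$ be the differential group, i.e. the group of $r$-jets $j^r_0\alpha$ of local diffeomorphisms $\alpha$ of $\mathbb R^n$ with $\alpha(0)=0$,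 with product $j^r_0\alpha\cdot j^r_0\beta=j^r_0(\alpha\circ\beta)$ and with the smooth structure given by the global coordinates $a^i_J(j^r_0\alpha)=\partial_J\alpha^i(0)$, $1\le|J|\le r$. It acts on $\mathrm{Imm}\,T^r_nX$ from the right by $j^r_0\gamma\cdot j^r_0\alpha=j^r_0(\gamma\circ\alpha)$. Let $P^r_nX=\mathrm{Imm}\,T^r_nX/L^r_n$ be the set of orbits and $\rho^r_n:\mathrm{Imm}\,T^r_nX\to P^r_nX$ the canonical projection. Split $\{1,\dots,N\}$ into an $n$-tuple $\mathbf I=(i_1,\dots,i_n)$ of distinct indices and the $m$ remaining indices, numbered by $\sigma=1,\dots,m$, and write $x^k_J=x^{i_k}_J$ ($1\le k\le n$) and $x^\sigma_J$ for the corresponding coordinates. Let $d_i=\sum_{A}\sum_{|J|\le r-1}x^A_{iJ}\,\partial/\partial x^A_J$ be the formal derivatives and $(z^i_j)$ the inverse of the matrix $(x^k_j)$, and define functions $y^\sigma_J$, $|J|\le r$, where $\det(x^k_j)\neq0$, by $$y^\sigma=x^\sigma,\qquad y^\sigma_{i_1\dots i_k}=\sum_j z^j_{i_1}\,d_j\,y^\sigma_{i_2\dots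 i_k}.$$ **Theorem.** 1. $P^r_nX$ has a smooth manifold structure (Hausdorff, second countable, of dimension $n+m\binom{n+r}{n}$) such that $\rho^r_n$ is a submersion, and this smooth structure (topology and atlas) is the only one for which $\rho^r_n$ is a submersion. 2. $L^r_n$ is a Lie group, and the action makes $\rho^r_n:\mathrm{Imm}\,T^r_nX\to P^r_nX$ a smooth right principal $L^r_n$-bundle: the action is smooth and free, its orbits are the fibres of $\rho^r_n$, and around every point of $P^r_nX$ there is a smooth $L^r_n$-equivariant local trivialization. 3. For every chart $(V,\psi)$ of $X$ and every $\mathbf I$, the set $W^{\mathbf I,r}=\{j^r_0\gamma\mid \gamma(0)\in V,\ \det(\partial(x^{i_k}\circ\gamma)/\partial t^j(0))\neq 0\}$ (for $r=0$, where the determinant depends on the representative, the set of all $j^0_0\gamma$ for which some representative satisfies the condition) is a union of fibres of $\rho^r_n$ and the domain of a chart of $\mathrm{Imm}\,T^r_nX$ with coordinates $\Phi^{\mathbf I,r}=(x^k_J,y^\sigma_J)_{|J|\le r}$. The functions $(x^k,y^\sigma_J)_{|J|\le r}$ descend to a chart of $P^r_nX$ with domain $\rho^r_n(W^{\mathbf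 I,r})$, so that in these charts $\rho^r_n(x^k_J,y^\sigma_J)=(x^k,y^\sigma_J)$. The sets $W^{\mathbf I,r}$, even with $i_1<\dots<i_n$ only, cover $\mathrm{Imm}\,T^r_nX$, so the charts on $P^r_nX$ cover $P^r_nX$. -/

import Mathlib

open scoped Manifold ContDiff Topology

namespace Velocity

/-- Iterated partial derivatives: `pd [j₁, …, jₖ] f = ∂ᵏ f / ∂t^{j₁} ⋯ ∂t^{jₖ}`. -/
noncomputable def pd {n : ℕ} {F : Type*} [NormedAddCommGroup F] [NormedSpace ℝ F] :
    List (Fin n) → (EuclideanSpace ℝ (Fin n) → F) → EuclideanSpace ℝ (Fin n) → F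
  | [], f => f
  | j :: l, f => fun t => fderiv ℝ (pd l f) t (EuclideanSpace.single j (1 : ℝ))

/-- `f` and `g` have the same partial derivatives up to order `r` at `0`. -/
def JetAgree {n : ℕ} {F : Type*} [NormedAddCommGroup F] [NormedSpace ℝ F] (r : ℕ)
    (f g : EuclideanSpace ℝ (Fin n) → F) : Prop :=
  ∀ l : List (Fin n), l.length ≤ r → pd l f 0 = pd l g 0

section Calculus

variable {n : ℕ} {F G : Type*} [NormedAddCommGroup F] [NormedSpace ℝ F]
  [NormedAddCommGroup G] [NormedSpace ℝ G]

theorem pd_congr {f g : EuclideanSpace ℝ (Fin n) → F} (l : List (Fin n)) :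
    ∀ {t : EuclideanSpace ℝ (Fin n)}, f =ᶠ[𝓝 t] g → pd l f =ᶠ[𝓝 t] pd l g := by
  induction l with
  | nil => intro t h; exact h
  | cons j l ih =>
    intro t h
    filter_upwards [(ih h).fderiv (𝕜 := ℝ)] with s hs
    simp only [pd, hs]

theorem pd_ofFn_eventually {k : ℕ} (v : Fin k → Fin n) {f : EuclideanSpace ℝ (Fin n) → F}
    {t : EuclideanSpace ℝ (Fin n)} (h : ContDiffAt ℝ ∞ f t) :
    pd (List.ofFn v) f =ᶠ[𝓝 t] fun s => iteratedFDeriv ℝ k f s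
      (fun i => EuclideanSpace.single (v i) (1 : ℝ)) := by
  induction k with
  | zero =>
    refine Filter.Eventually.of_forall fun s => ?_
    simp [pd]
  | succ k ih =>
    have h1 : ContDiffAt ℝ (k + 1 : ℕ) f t := h.of_le (by exact_mod_cast le_top)
    filter_upwards [(ih (fun i => v i.succ)).fderiv (𝕜 := ℝ), h1.eventually (by simp)] with s hs hs1
    have hd : DifferentiableAt ℝ (iteratedFDeriv ℝ k f) s :=
      hs1.differentiableAt_iteratedFDeriv (by exact_mod_cast Nat.lt_succ_self _)
    rw [List.ofFn_succ, iteratedFDeriv_succ_apply_left]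
    simp only [pd, hs]
    rw [fderiv_continuousMultilinear_apply_const_apply hd]
    rfl

theorem pd_ofFn {k : ℕ} (v : Fin k → Fin n) {f : EuclideanSpace ℝ (Fin n) → F}
    {t : EuclideanSpace ℝ (Fin n)} (h : ContDiffAt ℝ ∞ f t) :
    pd (List.ofFn v) f t = iteratedFDeriv ℝ k f t
      (fun i => EuclideanSpace.single (v i) (1 : ℝ)) :=
  (pd_ofFn_eventually v h).self_of_nhds

theorem contDiffAt_pd (l : List (Fin n)) {f : EuclideanSpace ℝ (Fin n) → F}
    {t : EuclideanSpace ℝ (Fin n)} (h : ContDiffAt ℝ ∞ f t) : ContDiffAt ℝ ∞ (pd l f) t := by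
  induction l with
  | nil => exact h
  | cons j l ih =>
    have : ContDiffAt ℝ ∞ (fderiv ℝ (pd l f)) t := ih.fderiv_right (by simp)
    exact this.clm_apply contDiffAt_const

/-- Partial derivatives commute. -/
theorem pd_perm {l l' : List (Fin n)} (hl : l.Perm l') {f : EuclideanSpace ℝ (Fin n) → F}
    {s : Set (EuclideanSpace ℝ (Fin n))} (hs : IsOpen s) (h : ContDiffOn ℝ ∞ f s) :
    ∀ t ∈ s, pd l f t = pd l' f t := by
  induction hl with
  | nil => intros; rfl
  | @cons j l₁ l₂ _ ih =>
    intro t ht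
    have : pd l₁ f =ᶠ[𝓝 t] pd l₂ f := by
      filter_upwards [hs.mem_nhds ht] with u hu using ih u hu
    simp only [pd, this.fderiv_eq]
  | swap i j l =>
    intro t ht
    have h1 : ContDiffAt ℝ ∞ (pd l f) t := contDiffAt_pd l (h.contDiffAt (hs.mem_nhds ht))
    have hd : DifferentiableAt ℝ (fderiv ℝ (pd l f)) t :=
      (h1.fderiv_right (m := ∞) (by simp)).differentiableAt (by simp)
    have hsym : IsSymmSndFDerivAt ℝ (pd l f) t :=
      h1.isSymmSndFDerivAt (by simp only [minSmoothness_of_isRCLikeNormedField]; exact WithTop.coe_le_coe.2 le_top)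
    simp only [pd]
    have key : ∀ (v w : EuclideanSpace ℝ (Fin n)),
        fderiv ℝ (fun u => fderiv ℝ (pd l f) u v) t w = fderiv ℝ (fderiv ℝ (pd l f)) t w v := by
      intro v w
      rw [fderiv_clm_apply hd (differentiableAt_const v)]
      simp
    rw [key, key]
    exact hsym.eq _ _
  | trans _ _ ih1 ih2 => intro t ht; rw [ih1 t ht, ih2 t ht]

theorem pd_perm_at {l l' : List (Fin n)} (hl : l.Perm l') {f : EuclideanSpace ℝ (Fin n) → F}
    {s : Set (EuclideanSpace ℝ (Fin n))} (hs : s ∈ 𝓝 (0 : EuclideanSpace ℝ (Fin n)))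
    (h : ContDiffOn ℝ ∞ f s) : pd l f 0 = pd l' f 0 := by
  obtain ⟨u, hus, hu, h0⟩ := mem_nhds_iff.1 hs
  exact pd_perm hl hu (h.mono hus) 0 h0

theorem jetAgree_iff {r : ℕ} {f g : EuclideanSpace ℝ (Fin n) → F} (hf : ContDiffAt ℝ ∞ f 0)
    (hg : ContDiffAt ℝ ∞ g 0) :
    JetAgree r f g ↔ ∀ k ≤ r, iteratedFDeriv ℝ k f 0 = iteratedFDeriv ℝ k g 0 := by
  constructor
  · intro h k hk
    apply ContinuousMultilinearMap.toMultilinearMap_injective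
    refine Module.Basis.ext_multilinear
      (fun _ => (EuclideanSpace.basisFun (Fin n) ℝ).toBasis) fun v => ?_
    have := h (List.ofFn v) (by simpa using hk)
    rw [pd_ofFn v hf, pd_ofFn v hg] at this
    simpa using this
  · intro h l hl
    rw [← List.ofFn_get l, pd_ofFn _ hf, pd_ofFn _ hg, h _ hl]

theorem JetAgree.comp {m r : ℕ} {f f' : EuclideanSpace ℝ (Fin n) → EuclideanSpace ℝ (Fin m)}
    {g g' : EuclideanSpace ℝ (Fin m) → G} {x : EuclideanSpace ℝ (Fin m)}
    (hf : ContDiffAt ℝ ∞ f 0) (hf' : ContDiffAt ℝ ∞ f' 0)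
    (hfx : f 0 = x) (hg : ContDiffAt ℝ ∞ g x) (hg' : ContDiffAt ℝ ∞ g' x)
    (h : JetAgree r f f') (h' : ∀ k ≤ r, iteratedFDeriv ℝ k g x = iteratedFDeriv ℝ k g' x) :
    JetAgree r (g ∘ f) (g' ∘ f') := by
  have hfx' : f' 0 = x := by rw [← hfx]; exact (h [] (Nat.zero_le _)).symm
  subst hfx
  have hgf' : ContDiffAt ℝ ∞ g' (f' 0) := by rw [hfx']; exact hg'
  rw [jetAgree_iff (hg.comp 0 hf) (hgf'.comp 0 hf')]
  rw [jetAgree_iff hf hf'] at h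
  intro k hk
  have hk' : ((k : ℕ) : WithTop ℕ∞) ≤ ∞ := by exact_mod_cast le_top
  rw [iteratedFDeriv_comp hg hf hk', iteratedFDeriv_comp hgf' hf' hk']
  simp only [FormalMultilinearSeries.taylorComp]
  refine Finset.sum_congr rfl fun c _ => ?_
  simp only [FormalMultilinearSeries.compAlongOrderedFinpartition, ftaylorSeries]
  rw [hfx', h' _ (c.length_le.trans hk)]
  congr 1
  funext m
  exact h _ ((c.partSize_le m).trans hk)

/-- The monomial `t ↦ t^J / J!`. -/
noncomputable def mono (J : Multiset (Fin n)) (t : EuclideanSpace ℝ (Fin n)) : ℝ :=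
  ∏ i, (t i) ^ (J.count i) / ((J.count i).factorial : ℝ)

theorem contDiff_mono (J : Multiset (Fin n)) : ContDiff ℝ ∞ (mono J) := by
  unfold mono
  fun_prop

theorem fderiv_mono (J : Multiset (Fin n)) (t : EuclideanSpace ℝ (Fin n)) (j : Fin n) :
    fderiv ℝ (mono J) t (EuclideanSpace.single j (1 : ℝ)) =
      if j ∈ J then mono (J.erase j) t else 0 := by
  have h1 : ∀ i, HasFDerivAt (fun t : EuclideanSpace ℝ (Fin n) =>
      (t i) ^ (J.count i) / ((J.count i).factorial : ℝ))
      (((J.count i : ℝ) * (t i) ^ (J.count i - 1) / ((J.count i).factorial : ℝ)) •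
        (EuclideanSpace.proj i : EuclideanSpace ℝ (Fin n) →L[ℝ] ℝ)) t := by
    intro i
    have h2 : HasDerivAt (fun x : ℝ => x ^ (J.count i) / ((J.count i).factorial : ℝ))
      ((J.count i : ℝ) * (t i) ^ (J.count i - 1) / ((J.count i).factorial : ℝ)) (t i) :=
      (hasDerivAt_pow _ _).div_const _
    exact h2.comp_hasFDerivAt t (EuclideanSpace.proj i : EuclideanSpace ℝ (Fin n) →L[ℝ] ℝ).hasFDerivAt
  have h3 := HasFDerivAt.finsetProd (u := Finset.univ) (fun i _ => h1 i)
  unfold mono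
  rw [h3.fderiv]
  simp only [sum_apply, smul_apply, smul_eq_mul]
  rw [Finset.sum_eq_single j]
  · have e0 : (EuclideanSpace.proj j : EuclideanSpace ℝ (Fin n) →L[ℝ] ℝ)
        (EuclideanSpace.single j (1 : ℝ)) = 1 := by simp
    rw [e0, mul_one]
    split_ifs with hj
    · rw [← Finset.mul_prod_erase _ _ (Finset.mem_univ j), mul_comm, Multiset.count_erase_self]
      congr 1
      · obtain ⟨k, hk⟩ := Nat.exists_eq_succ_of_ne_zero (Multiset.count_pos.2 hj).ne'
        rw [hk]
        simp only [Nat.succ_eq_add_one, Nat.add_sub_cancel, Nat.factorial_succ]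
        push_cast
        field_simp
      · refine Finset.prod_congr rfl fun i hi => ?_
        rw [Multiset.count_erase_of_ne (Finset.ne_of_mem_erase hi)]
    · simp [Multiset.count_eq_zero.2 hj]
  · intro i _ hi
    simp [hi]
  · simp

/-- The finitely many multi-indices of length at most `s`. -/
theorem finite_multiset_card_le (n s : ℕ) : {J : Multiset (Fin n) | J.card ≤ s}.Finite := by
  refine (Set.finite_Iic (s • (Finset.univ : Finset (Fin n)).val)).subset fun J hJ => ?_
  refine Multiset.le_iff_count.2 fun i => ?_
  rw [Multiset.count_nsmul, Multiset.count_eq_one_of_mem Finset.univ.nodup (Finset.mem_univ i)]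
  simpa using (Multiset.count_le_card i J).trans hJ

/-- Partial derivatives at `0` up to a given order can be prescribed. -/
theorem exists_pd_eq (s : ℕ) (c : Multiset (Fin n) → F) :
    ∃ f : EuclideanSpace ℝ (Fin n) → F, ContDiff ℝ ∞ f ∧
      ∀ l : List (Fin n), l.length ≤ s → pd l f 0 = c l := by
  let S := (finite_multiset_card_le n s).toFinset
  let f : EuclideanSpace ℝ (Fin n) → F := fun t => ∑ J ∈ S, mono J t • c J
  have hpd : ∀ l : List (Fin n), pd l f = fun t => ∑ J ∈ S,
      (if (l : Multiset (Fin n)) ≤ J then mono (J - (l : Multiset (Fin n))) t else 0) • c J := by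
    intro l
    induction l with
    | nil => funext t; simp [pd, f]
    | cons j l ih =>
      funext t
      have hd : ∀ J, DifferentiableAt ℝ (fun t : EuclideanSpace ℝ (Fin n) =>
          (if (l : Multiset (Fin n)) ≤ J then mono (J - (l : Multiset (Fin n))) t else 0)) t := by
        intro J
        by_cases h : (l : Multiset (Fin n)) ≤ J
        · simpa [h] using ((contDiff_mono (J - (l : Multiset (Fin n)))).differentiable (by simp)).differentiableAt
        · simp [h]
      simp only [pd, ih]
      rw [fderiv_fun_sum (fun J _ => (hd J).smul_const _)]
      simp only [sum_apply]
      refine Finset.sum_congr rfl fun J _ => ?_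
      rw [fderiv_smul_const (hd J)]
      simp only [ContinuousLinearMap.smulRight_apply]
      congr 1
      by_cases h : (l : Multiset (Fin n)) ≤ J
      · simp only [h, if_true]
        rw [show (fun t => mono (J - (l : Multiset (Fin n))) t) = mono (J - (l : Multiset (Fin n))) from rfl,
          fderiv_mono]
        have e1 : (j ∈ J - (l : Multiset (Fin n))) ↔
            ((j :: l : List (Fin n)) : Multiset (Fin n)) ≤ J := by
          rw [← Multiset.cons_coe, ← Multiset.singleton_le, ← Multiset.singleton_add,
            ← le_tsub_iff_right h]
        have e2 : (J - (l : Multiset (Fin n))).erase j =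
            J - ((j :: l : List (Fin n)) : Multiset (Fin n)) := by
          rw [← Multiset.cons_coe, ← Multiset.sub_singleton, ← Multiset.singleton_add,
            add_comm, tsub_tsub]
        simp only [e1, e2]
      · have h' : ¬ ((j :: l : List (Fin n)) : Multiset (Fin n)) ≤ J := fun h' =>
          h ((by rw [← Multiset.cons_coe]; exact Multiset.le_cons_self _ _ : _ ≤ _).trans h')
        simp [h, h']
  refine ⟨f, ContDiff.sum fun J _ => (contDiff_mono J).smul contDiff_const, fun l hl => ?_⟩
  rw [hpd]
  have hmem : (l : Multiset (Fin n)) ∈ S := by simpa [S] using hl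
  beta_reduce
  rw [Finset.sum_eq_single_of_mem _ hmem]
  · simp [mono]
  · intro J _ hJ
    split_ifs with h
    · have : ∃ i, (J - (l : Multiset (Fin n))).count i ≠ 0 := by
        by_contra! hc
        have : J - (l : Multiset (Fin n)) = 0 := by
          ext i; simpa using hc i
        exact hJ (le_antisymm (tsub_eq_zero_iff_le.1 this) h)
      obtain ⟨i, hi⟩ := this
      have : mono (J - (l : Multiset (Fin n))) 0 = 0 := by
        unfold mono
        exact Finset.prod_eq_zero (Finset.mem_univ i) (by simp only [PiLp.zero_apply, zero_pow hi, zero_div])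
      simp [this]
    · simp

/-- The total derivatives depend continuously (linearly) on the partial derivatives. -/
theorem exists_continuous_iteratedFDeriv (F : Type*) [NormedAddCommGroup F] [NormedSpace ℝ F]
    [FiniteDimensional ℝ F] (n k : ℕ) :
    ∃ Λ : ((Fin k → Fin n) → F) → ContinuousMultilinearMap ℝ
        (fun _ : Fin k => EuclideanSpace ℝ (Fin n)) F,
      Continuous Λ ∧ ∀ f : EuclideanSpace ℝ (Fin n) → F, ContDiffAt ℝ ∞ f 0 →
        iteratedFDeriv ℝ k f 0 = Λ fun v => pd (List.ofFn v) f 0 := by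
  let ev : ContinuousMultilinearMap ℝ (fun _ : Fin k => EuclideanSpace ℝ (Fin n)) F →ₗ[ℝ]
      ((Fin k → Fin n) → F) :=
    { toFun := fun T v => T fun i => EuclideanSpace.single (v i) (1 : ℝ)
      map_add' := fun _ _ => rfl
      map_smul' := fun _ _ => rfl }
  have hinj : LinearMap.ker ev = ⊥ := by
    refine LinearMap.ker_eq_bot.2 fun T T' h => ?_
    apply ContinuousMultilinearMap.toMultilinearMap_injective
    refine Module.Basis.ext_multilinear
      (fun _ => (EuclideanSpace.basisFun (Fin n) ℝ).toBasis) fun v => ?_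
    simpa [ev] using congrFun h v
  obtain ⟨Λ, hΛ⟩ := ev.exists_leftInverse_of_injective hinj
  refine ⟨Λ, Λ.continuous_of_finiteDimensional, fun f hf => ?_⟩
  have := LinearMap.congr_fun hΛ (iteratedFDeriv ℝ k f 0)
  simp only [LinearMap.comp_apply, LinearMap.id_apply] at this
  rw [← this]
  congr 1
  funext v
  exact (pd_ofFn v hf).symm

end Calculus
/-- A smooth immersion `γ : U → X` of some open neighbourhood `U` of `0 ∈ ℝⁿ` into the
`N`-dimensional manifold `X` (the values of `toFun` outside `U` are irrelevant). -/
structure ImmersionGerm (n N : ℕ) (X : Type*) [TopologicalSpace X]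
    [ChartedSpace (EuclideanSpace ℝ (Fin N)) X] where
  toFun : EuclideanSpace ℝ (Fin n) → X
  exists_immersion : ∃ U : Set (EuclideanSpace ℝ (Fin n)), IsOpen U ∧ 0 ∈ U ∧
    ContMDiffOn (𝓡 n) (𝓡 N) ∞ toFun U ∧
    ∀ t ∈ U, Function.Injective (mfderiv (𝓡 n) (𝓡 N) toFun t)

theorem linearIndependent_congr {n N : ℕ} {v w : Fin n → EuclideanSpace ℝ (Fin N)}
    (h : LinearIndependent ℝ v) (e : ∀ j, w j = v j) : LinearIndependent ℝ w :=
  (funext e : w = v) ▸ h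

theorem injective_of_linearIndependent {n N : ℕ}
    {L : EuclideanSpace ℝ (Fin n) →L[ℝ] EuclideanSpace ℝ (Fin N)}
    (h : LinearIndependent ℝ fun j => L (EuclideanSpace.single j (1 : ℝ))) :
    Function.Injective L := by
  intro a b hab
  have hd : L (a - b) = 0 := by rw [map_sub, hab, sub_self]
  rw [← (EuclideanSpace.basisFun (Fin n) ℝ).toBasis.sum_repr (a - b), map_sum] at hd
  simp only [map_smul, OrthonormalBasis.coe_toBasis, EuclideanSpace.basisFun_apply] at hd
  have hz := Fintype.linearIndependent_iff.1 h _ hd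
  rw [← sub_eq_zero]
  apply (EuclideanSpace.basisFun (Fin n) ℝ).toBasis.repr.injective
  ext i
  simpa using hz i

section Germs

variable {n N : ℕ} {X : Type*} [TopologicalSpace X] [ChartedSpace (EuclideanSpace ℝ (Fin N)) X]

/-- The smooth charts of `X`. -/
abbrev SmoothChart (N : ℕ) (X : Type*) [TopologicalSpace X]
    [ChartedSpace (EuclideanSpace ℝ (Fin N)) X] :=
  {ψ : OpenPartialHomeomorph X (EuclideanSpace ℝ (Fin N)) //
    ψ ∈ IsManifold.maximalAtlas (𝓡 N) ∞ X}

theorem ImmersionGerm.exists_contDiffOn (γ : ImmersionGerm n N X) (ψ : SmoothChart N X)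
    (h : γ.toFun 0 ∈ ψ.1.source) :
    ∃ U : Set (EuclideanSpace ℝ (Fin n)), IsOpen U ∧ 0 ∈ U ∧ Set.MapsTo γ.toFun U ψ.1.source ∧
      ContDiffOn ℝ ∞ (ψ.1 ∘ γ.toFun) U ∧
      ∀ t ∈ U, Function.Injective (fderiv ℝ (ψ.1 ∘ γ.toFun) t) := by
  obtain ⟨U, hU, h0, hs, hi⟩ := γ.exists_immersion
  have hψ := contMDiffOn_of_mem_maximalAtlas ψ.2
  have hψ' := contMDiffOn_symm_of_mem_maximalAtlas ψ.2
  have hV : IsOpen (U ∩ γ.toFun ⁻¹' ψ.1.source) :=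
    hs.continuousOn.isOpen_inter_preimage hU ψ.1.open_source
  refine ⟨_, hV, ⟨h0, h⟩, fun t ht => ht.2, ?_, ?_⟩
  · rw [← contMDiffOn_iff_contDiffOn]
    exact hψ.comp (hs.mono Set.inter_subset_left) Set.inter_subset_right
  · rintro t ⟨htU, htψ⟩
    have h1 : MDifferentiableAt (𝓡 n) (𝓡 N) γ.toFun t :=
      (hs.contMDiffAt (hU.mem_nhds htU)).mdifferentiableAt (by simp)
    have h2 : MDifferentiableAt (𝓡 N) (𝓡 N) ψ.1 (γ.toFun t) :=
      (hψ.contMDiffAt (ψ.1.open_source.mem_nhds htψ)).mdifferentiableAt (by simp)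
    have h3 : MDifferentiableAt (𝓡 N) (𝓡 N) ψ.1.symm (ψ.1 (γ.toFun t)) :=
      (hψ'.contMDiffAt (ψ.1.open_target.mem_nhds (ψ.1.map_source htψ))).mdifferentiableAt (by simp)
    have h4 : mfderiv (𝓡 n) (𝓡 N) (ψ.1.symm ∘ (ψ.1 ∘ γ.toFun)) t = mfderiv (𝓡 n) (𝓡 N) γ.toFun t := by
      apply Filter.EventuallyEq.mfderiv_eq
      filter_upwards [hV.mem_nhds ⟨htU, htψ⟩] with s hs
      exact ψ.1.left_inv hs.2
    have h5 : MDifferentiableAt (𝓡 n) (𝓡 N) (ψ.1 ∘ γ.toFun) t := h2.comp t h1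
    rw [mfderiv_comp (I' := 𝓡 N) t h3 h5] at h4
    rw [← mfderiv_eq_fderiv]
    have h6 := hi t htU
    rw [← h4] at h6
    exact Function.Injective.of_comp h6

/-- `γ ∼ δ`: in some chart, `γ` and `δ` have the same partial derivatives up to order `r`
at `0`. -/
def JetEquiv (r : ℕ) (γ δ : ImmersionGerm n N X) : Prop :=
  ∃ ψ : SmoothChart N X, γ.toFun 0 ∈ ψ.1.source ∧ δ.toFun 0 ∈ ψ.1.source ∧
    JetAgree r (ψ.1 ∘ γ.toFun) (ψ.1 ∘ δ.toFun)

theorem JetEquiv.eq_zero {r : ℕ} {γ δ : ImmersionGerm n N X} (h : JetEquiv r γ δ) :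
    γ.toFun 0 = δ.toFun 0 := by
  obtain ⟨ψ, h1, h2, h3⟩ := h
  exact ψ.1.injOn h1 h2 (h3 [] (Nat.zero_le _))

theorem transition_contDiffAt (ψ ψ' : SmoothChart N X) {x : X} (h : x ∈ ψ.1.source)
    (h' : x ∈ ψ'.1.source) : ContDiffAt ℝ ∞ (ψ'.1 ∘ ψ.1.symm) (ψ.1 x) := by
  have h1 := (contMDiffOn_symm_of_mem_maximalAtlas ψ.2).contMDiffAt
    (ψ.1.open_target.mem_nhds (ψ.1.map_source h))
  have h2 := (contMDiffOn_of_mem_maximalAtlas ψ'.2).contMDiffAt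
    (ψ'.1.open_source.mem_nhds h')
  rw [← ψ.1.left_inv h] at h2
  exact contMDiffAt_iff_contDiffAt.1 (ContMDiffAt.comp (ψ.1 x) h2 h1)

theorem transition_eventuallyEq (γ : ImmersionGerm n N X) (ψ ψ' : SmoothChart N X)
    (h : γ.toFun 0 ∈ ψ.1.source) :
    ψ'.1 ∘ γ.toFun =ᶠ[𝓝 0] (ψ'.1 ∘ ψ.1.symm) ∘ (ψ.1 ∘ γ.toFun) := by
  obtain ⟨U, hU, h0, hm, -, -⟩ := γ.exists_contDiffOn ψ h
  filter_upwards [hU.mem_nhds h0] with t ht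
  simp [ψ.1.left_inv (hm ht)]

theorem ImmersionGerm.contDiffAt (γ : ImmersionGerm n N X) (ψ : SmoothChart N X)
    (h : γ.toFun 0 ∈ ψ.1.source) : ContDiffAt ℝ ∞ (ψ.1 ∘ γ.toFun) 0 := by
  obtain ⟨U, hU, h0, -, hs, -⟩ := γ.exists_contDiffOn ψ h
  exact hs.contDiffAt (hU.mem_nhds h0)

/-- The relation `∼` does not depend on the chart. -/
theorem JetEquiv.jetAgree {r : ℕ} {γ δ : ImmersionGerm n N X} (h : JetEquiv r γ δ)
    (ψ' : SmoothChart N X) (h' : γ.toFun 0 ∈ ψ'.1.source) :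
    JetAgree r (ψ'.1 ∘ γ.toFun) (ψ'.1 ∘ δ.toFun) := by
  have h0 := h.eq_zero
  obtain ⟨ψ, h1, h2, h3⟩ := h
  have hF := transition_contDiffAt ψ ψ' h1 h'
  have key := h3.comp (γ.contDiffAt ψ h1) (δ.contDiffAt ψ h2) rfl hF hF (fun _ _ => rfl)
  intro l hl
  rw [(pd_congr l (transition_eventuallyEq γ ψ ψ' h1)).self_of_nhds,
    (pd_congr l (transition_eventuallyEq δ ψ ψ' h2)).self_of_nhds]
  exact key l hl

theorem jetEquiv_equivalence (n N : ℕ) (X : Type*) [TopologicalSpace X]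
    [ChartedSpace (EuclideanSpace ℝ (Fin N)) X] [IsManifold (𝓡 N) ∞ X] (r : ℕ) :
    Equivalence (JetEquiv r : ImmersionGerm n N X → ImmersionGerm n N X → Prop) where
  refl γ := ⟨⟨_, IsManifold.chart_mem_maximalAtlas (γ.toFun 0)⟩, mem_chart_source _ _,
    mem_chart_source _ _, fun _ _ => rfl⟩
  symm := fun ⟨ψ, h1, h2, h3⟩ => ⟨ψ, h2, h1, fun l hl => (h3 l hl).symm⟩
  trans := fun {γ δ ε} h h' => by
    have e := h.eq_zero
    have e' := h'.eq_zero
    obtain ⟨ψ, h1, h2, h3⟩ := h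
    refine ⟨ψ, h1, by rwa [← e'], fun l hl => (h3 l hl).trans ?_⟩
    exact h'.jetAgree ψ h2 l hl

end Germs

/-- The set `Imm T^r_n X` of regular `(r,n)`-velocities: the `r`-jets `j^r_0 γ` of immersions
`γ` of neighbourhoods of `0 ∈ ℝⁿ` into `X`. -/
def RegularVelocity (r n N : ℕ) (X : Type*) [TopologicalSpace X]
    [ChartedSpace (EuclideanSpace ℝ (Fin N)) X] [IsManifold (𝓡 N) ∞ X] : Type _ :=
  Quotient (⟨JetEquiv r, jetEquiv_equivalence n N X r⟩ : Setoid (ImmersionGerm n N X))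

/-- Multi-indices `J` with entries in `{1, …, n}` and `|J| ≤ r`. -/
abbrev MultiIdx (n r : ℕ) := {J : Multiset (Fin n) // J.card ≤ r}

/-- Multi-indices `J` with entries in `{1, …, n}` and `1 ≤ |J| ≤ r`. -/
abbrev PosMultiIdx (n r : ℕ) := {J : Multiset (Fin n) // 1 ≤ J.card ∧ J.card ≤ r}

noncomputable instance (n r : ℕ) : Fintype (MultiIdx n r) :=
  (finite_multiset_card_le n r).fintype

noncomputable instance (n r : ℕ) : Fintype (PosMultiIdx n r) :=
  ((finite_multiset_card_le n r).subset fun _ hJ => hJ.2).fintype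

/-- The space of all families `(x^A_J)`, `1 ≤ A ≤ N`, `|J| ≤ r`. -/
abbrev JetSpace (r n N : ℕ) := Fin N × MultiIdx n r → ℝ

namespace RegularVelocity

section Basic

variable {r n N : ℕ} {X : Type*} [TopologicalSpace X] [ChartedSpace (EuclideanSpace ℝ (Fin N)) X]
  [IsManifold (𝓡 N) ∞ X]

/-- The velocity `j^r_0 γ`. -/
def mk (γ : ImmersionGerm n N X) : RegularVelocity r n N X := Quotient.mk _ γ

/-- The target `γ(0)` of `j^r_0 γ`. -/
def target (v : RegularVelocity r n N X) : X :=
  Quotient.lift (fun γ : ImmersionGerm n N X => γ.toFun 0) (fun _ _ h => JetEquiv.eq_zero h) v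

/-- The associated coordinates `x^A_J(j^r_0 γ) = ∂_J (x^A ∘ γ)(0)` in a chart `ψ = (x^A)`;
the entries `j₁ ≤ ⋯ ≤ jₖ` of `J` are taken in increasing order, and the choice of the
representative `γ` does not matter, see `coords_mk`. -/
noncomputable def coords (ψ : SmoothChart N X) (v : RegularVelocity r n N X) : JetSpace r n N :=
  fun p => pd (p.2.1.sort (· ≤ ·)) (ψ.1 ∘ (Quotient.out v).toFun) 0 p.1

theorem exists_rep (v : RegularVelocity r n N X) : ∃ γ, mk γ = v := Quotient.exists_rep v

theorem mk_eq_mk {γ δ : ImmersionGerm n N X} :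
    (mk γ : RegularVelocity r n N X) = mk δ ↔ JetEquiv r γ δ := Quotient.eq

theorem coords_mk (ψ : SmoothChart N X) (γ : ImmersionGerm n N X) (h : γ.toFun 0 ∈ ψ.1.source)
    (p : Fin N × MultiIdx n r) :
    coords ψ (mk γ : RegularVelocity r n N X) p =
      pd (p.2.1.sort (· ≤ ·)) (ψ.1 ∘ γ.toFun) 0 p.1 := by
  have h1 : JetEquiv r γ (Quotient.out (mk γ : RegularVelocity r n N X)) :=
    mk_eq_mk.1 (Quotient.out_eq (mk γ : RegularVelocity r n N X)).symm
  have := h1.jetAgree ψ h (p.2.1.sort (· ≤ ·)) (by simpa using p.2.2)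
  rw [coords, this]

/-- The vector `(c^A_J)_A`, or `0` if `|J| > r`. -/
noncomputable def vec (c : JetSpace r n N) (J : Multiset (Fin n)) : EuclideanSpace ℝ (Fin N) :=
  if h : J.card ≤ r then WithLp.toLp 2 fun A => c (A, ⟨J, h⟩) else 0

theorem continuous_vec (J : Multiset (Fin n)) :
    Continuous fun c : JetSpace r n N => vec c J := by
  unfold vec
  split_ifs
  · fun_prop
  · exact continuous_const

theorem vec_coords (ψ : SmoothChart N X) (γ : ImmersionGerm n N X) (h : γ.toFun 0 ∈ ψ.1.source)
    (l : List (Fin n)) (hl : l.length ≤ r) :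
    vec (coords ψ (mk γ : RegularVelocity r n N X)) l = pd l (ψ.1 ∘ γ.toFun) 0 := by
  obtain ⟨U, hU, h0, -, hs, -⟩ := γ.exists_contDiffOn ψ h
  have hl' : (l : Multiset (Fin n)).card ≤ r := by simpa using hl
  ext A
  have hp : ((l : Multiset (Fin n)).sort (· ≤ ·)).Perm l := by
    rw [← Multiset.coe_eq_coe, Multiset.sort_eq]
  simp only [vec, hl', dif_pos]
  rw [coords_mk ψ γ h, pd_perm hp hU hs 0 h0]

theorem coords_injOn (ψ : SmoothChart N X) :
    Set.InjOn (coords ψ) {v : RegularVelocity r n N X | v.target ∈ ψ.1.source} := by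
  intro v hv w hw hvw
  obtain ⟨γ, rfl⟩ := exists_rep v
  obtain ⟨δ, rfl⟩ := exists_rep w
  refine mk_eq_mk.2 ⟨ψ, hv, hw, fun l hl => ?_⟩
  rw [← vec_coords ψ γ hv l hl, ← vec_coords ψ δ hw l hl, hvw]

theorem image_coords (ψ : SmoothChart N X) (O : Set X) (hO : O ⊆ ψ.1.source) :
    coords ψ '' {v : RegularVelocity r n N X | v.target ∈ O} =
      {c | vec c 0 ∈ ψ.1 '' O ∧ ∃ C : Multiset (Fin n) → EuclideanSpace ℝ (Fin N),
        (∀ J, J.card ≤ r → C J = vec c J) ∧ LinearIndependent ℝ fun j => C {j}} := by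
  ext c
  constructor
  · rintro ⟨v, hv, rfl⟩
    obtain ⟨γ, rfl⟩ := exists_rep v
    have hv' : γ.toFun 0 ∈ ψ.1.source := hO hv
    refine ⟨⟨γ.toFun 0, hv, (vec_coords ψ γ hv' [] (Nat.zero_le _)).symm⟩,
      fun J => pd (J.sort (· ≤ ·)) (ψ.1 ∘ γ.toFun) 0, fun J hJ => ?_, ?_⟩
    · have := vec_coords ψ γ hv' (J.sort (· ≤ ·)) (by simpa using hJ)
      rw [Multiset.sort_eq] at this
      exact this.symm
    · obtain ⟨U, hU, h0, -, -, hi⟩ := γ.exists_contDiffOn ψ hv'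
      have h1 := (EuclideanSpace.basisFun (Fin n) ℝ).toBasis.linearIndependent.map'
        (fderiv ℝ (ψ.1 ∘ γ.toFun) 0).toLinearMap (LinearMap.ker_eq_bot.2 (hi 0 h0))
      refine linearIndependent_congr h1 fun j => ?_
      simp [pd]
  · rintro ⟨⟨x, hx, hxc⟩, C, hC, hli⟩
    obtain ⟨f, hf, hfC⟩ := exists_pd_eq (max r 1) C
    have hf0 : f 0 = ψ.1 x := by
      have := hfC [] (Nat.zero_le _)
      rw [hxc, ← hC 0 (Nat.zero_le _)]
      exact this
    have hinj : Function.Injective (fderiv ℝ f 0) :=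
      injective_of_linearIndependent (linearIndependent_congr hli fun j => hfC [j] (by simp))
    let U : Set (EuclideanSpace ℝ (Fin n)) :=
      f ⁻¹' ψ.1.target ∩ fderiv ℝ f ⁻¹' {L | Function.Injective L}
    have hU : IsOpen U := (ψ.1.open_target.preimage hf.continuous).inter
      (ContinuousLinearMap.isOpen_injective.preimage (hf.continuous_fderiv (by simp)))
    have h0U : (0 : EuclideanSpace ℝ (Fin n)) ∈ U :=
      ⟨by rw [Set.mem_preimage, hf0]; exact ψ.1.map_source (hO hx), hinj⟩
    have hs : ContMDiffOn (𝓡 n) (𝓡 N) ∞ (ψ.1.symm ∘ f) U :=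
      (contMDiffOn_symm_of_mem_maximalAtlas ψ.2).comp hf.contMDiff.contMDiffOn
        Set.inter_subset_left
    let γ : ImmersionGerm n N X :=
      { toFun := ψ.1.symm ∘ f
        exists_immersion := by
          refine ⟨U, hU, h0U, hs, fun t ht => ?_⟩
          have h1 : MDifferentiableAt (𝓡 n) (𝓡 N) (ψ.1.symm ∘ f) t :=
            (hs.contMDiffAt (hU.mem_nhds ht)).mdifferentiableAt (by simp)
          have h2 : MDifferentiableAt (𝓡 N) (𝓡 N) ψ.1 ((ψ.1.symm ∘ f) t) :=
            ((contMDiffOn_of_mem_maximalAtlas ψ.2).contMDiffAt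
              (ψ.1.open_source.mem_nhds (ψ.1.map_target ht.1))).mdifferentiableAt (by simp)
          have h4 : mfderiv (𝓡 n) (𝓡 N) (ψ.1 ∘ (ψ.1.symm ∘ f)) t =
              mfderiv (𝓡 n) (𝓡 N) f t := by
            apply Filter.EventuallyEq.mfderiv_eq
            filter_upwards [hU.mem_nhds ht] with s hs
            exact ψ.1.right_inv hs.1
          rw [mfderiv_comp (I' := 𝓡 N) t h2 h1] at h4
          have h6 : Function.Injective (mfderiv (𝓡 n) (𝓡 N) f t) := by
            rw [mfderiv_eq_fderiv]; exact ht.2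
          rw [← h4] at h6
          exact Function.Injective.of_comp h6 }
    have hγ0 : γ.toFun 0 = x := by
      change ψ.1.symm (f 0) = x
      rw [hf0, ψ.1.left_inv (hO hx)]
    have hγs : γ.toFun 0 ∈ ψ.1.source := by rw [hγ0]; exact hO hx
    refine ⟨mk γ, by change γ.toFun 0 ∈ O; rwa [hγ0], ?_⟩
    have hev : ψ.1 ∘ γ.toFun =ᶠ[𝓝 0] f := by
      filter_upwards [hU.mem_nhds h0U] with s hs using ψ.1.right_inv hs.1
    funext ⟨A, J, hJ⟩
    rw [coords_mk ψ γ hγs, (pd_congr _ hev).self_of_nhds,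
      hfC _ (by simpa using Or.inl hJ), Multiset.sort_eq, hC _ hJ]
    simp [vec, hJ]

theorem isOpen_image_coords (ψ : SmoothChart N X) (O : Set X) (hO : O ⊆ ψ.1.source)
    (hO' : IsOpen O) :
    IsOpen (coords ψ '' {v : RegularVelocity r n N X | v.target ∈ O}) := by
  rw [image_coords ψ O hO]
  refine IsOpen.inter ((ψ.1.isOpen_image_of_subset_source hO' hO).preimage (continuous_vec 0)) ?_
  by_cases hr : 1 ≤ r
  · have : {c : JetSpace r n N | ∃ C : Multiset (Fin n) → EuclideanSpace ℝ (Fin N),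
        (∀ J, J.card ≤ r → C J = vec c J) ∧ LinearIndependent ℝ fun j => C {j}} =
        (fun c : JetSpace r n N => fun j : Fin n => vec c {j}) ⁻¹'
          {w | LinearIndependent ℝ w} := by
      ext c
      constructor
      · rintro ⟨C, hC, hli⟩
        have : (fun j : Fin n => vec c {j}) = fun j => C {j} := by
          funext j; rw [hC _ (by simpa using hr)]
        change LinearIndependent ℝ (fun j : Fin n => vec c {j})
        rwa [this]
      · intro h
        exact ⟨vec c, fun _ _ => rfl, h⟩
    change IsOpen {c : JetSpace r n N | ∃ C : Multiset (Fin n) → EuclideanSpace ℝ (Fin N),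
        (∀ J, J.card ≤ r → C J = vec c J) ∧ LinearIndependent ℝ fun j => C {j}}
    rw [this]
    exact isOpen_setOfPred_linearIndependent.preimage
      (continuous_pi fun j => continuous_vec _)
  · obtain rfl : r = 0 := by omega
    change IsOpen {c : JetSpace 0 n N | ∃ C : Multiset (Fin n) → EuclideanSpace ℝ (Fin N),
        (∀ J, J.card ≤ 0 → C J = vec c J) ∧ LinearIndependent ℝ fun j => C {j}}
    by_cases hw : ∃ w : Fin n → EuclideanSpace ℝ (Fin N), LinearIndependent ℝ w
    · convert isOpen_univ
      refine Set.eq_univ_of_forall fun c => ?_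
      obtain ⟨w, hw⟩ := hw
      refine ⟨fun J => if h : J = 0 then vec c 0 else
        if h' : ∃ j, J = {j} then w h'.choose else 0, fun J hJ => ?_, ?_⟩
      · have : J = 0 := by simpa using hJ
        simp [this]
      · refine linearIndependent_congr hw fun j => ?_
        have h' : ∃ i, ({j} : Multiset (Fin n)) = {i} := ⟨j, rfl⟩
        have := h'.choose_spec
        rw [Multiset.singleton_inj] at this
        simp only [Multiset.singleton_ne_zero, dif_neg, not_false_eq_true, h', dif_pos]
        rw [← this]
    · convert isOpen_empty
      refine Set.eq_empty_of_forall_notMem fun c hc => ?_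
      obtain ⟨C, -, hli⟩ := hc
      exact hw ⟨_, hli⟩

theorem exists_continuousOn_transition (ψ ψ' : SmoothChart N X) :
    ∃ T : JetSpace r n N → JetSpace r n N,
      ContinuousOn T (coords ψ '' {v : RegularVelocity r n N X |
        v.target ∈ ψ.1.source ∩ ψ'.1.source}) ∧
      ∀ v : RegularVelocity r n N X, v.target ∈ ψ.1.source ∩ ψ'.1.source →
        coords ψ' v = T (coords ψ v) := by
  choose Λ hΛ hΛ' using exists_continuous_iteratedFDeriv (EuclideanSpace ℝ (Fin N)) n
  let F := ψ'.1 ∘ ψ.1.symm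
  let q : JetSpace r n N → FormalMultilinearSeries ℝ (EuclideanSpace ℝ (Fin n))
      (EuclideanSpace ℝ (Fin N)) := fun c k => Λ k fun v => vec c (List.ofFn v : List (Fin n))
  have hq : ∀ k, Continuous fun c => q c k := fun k =>
    (hΛ k).comp (continuous_pi fun v => continuous_vec _)
  refine ⟨fun c p => ((ftaylorSeries ℝ F (vec c 0)).taylorComp (q c)
    (p.2.1.sort (· ≤ ·)).length (fun i => EuclideanSpace.single
      ((p.2.1.sort (· ≤ ·)).get i) (1 : ℝ))) p.1, ?_, ?_⟩
  · rintro c ⟨v, hv, rfl⟩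
    obtain ⟨γ, rfl⟩ := exists_rep v
    have hv1 : γ.toFun 0 ∈ ψ.1.source := hv.1
    apply ContinuousAt.continuousWithinAt
    refine continuousAt_pi.2 fun p => ?_
    have hF : ContDiffAt ℝ ∞ F (vec (coords ψ (mk γ : RegularVelocity r n N X)) 0) := by
      rw [show (0 : Multiset (Fin n)) = (([] : List (Fin n)) : Multiset (Fin n)) from rfl,
        vec_coords ψ γ hv1 [] (Nat.zero_le _)]
      exact transition_contDiffAt ψ ψ' hv.1 hv.2
    have hT : ContinuousAt (fun c : JetSpace r n N =>
        (ftaylorSeries ℝ F (vec c 0)).taylorComp (q c) (p.2.1.sort (· ≤ ·)).length)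
        (coords ψ (mk γ : RegularVelocity r n N X)) := by
      refine tendsto_finsetSum _ fun P _ => ?_
      have hB := (P.compAlongOrderedFinpartitionL ℝ (EuclideanSpace ℝ (Fin n))
        (EuclideanSpace ℝ (Fin N))
        (EuclideanSpace ℝ (Fin N))).analyticOnNhd_uncurry_of_multilinear
        (s := Set.univ) |>.continuousOn
      rw [continuousOn_univ] at hB
      refine hB.continuousAt.comp (f := fun c : JetSpace r n N =>
        (ftaylorSeries ℝ F (vec c 0) P.length, fun m => q c (P.partSize m)))
        (ContinuousAt.prodMk ?_ ?_)
      · refine ContinuousAt.comp (f := fun c : JetSpace r n N => vec c 0)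
          (g := fun y => iteratedFDeriv ℝ P.length F y) ?_ (continuous_vec 0).continuousAt
        exact hF.continuousAt_iteratedFDeriv (by exact_mod_cast le_top)
      · exact continuousAt_pi.2 fun m => (hq _).continuousAt
    have := (ContinuousMultilinearMap.apply ℝ (fun _ => EuclideanSpace ℝ (Fin n))
      (EuclideanSpace ℝ (Fin N)) (fun i => EuclideanSpace.single
      ((p.2.1.sort (· ≤ ·)).get i) (1 : ℝ))).continuous.continuousAt.comp hT
    exact (EuclideanSpace.proj (𝕜 := ℝ) p.1).continuous.continuousAt.comp this
  · intro v hv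
    obtain ⟨γ, rfl⟩ := exists_rep v
    have hv1 : γ.toFun 0 ∈ ψ.1.source := hv.1
    have hγ := γ.contDiffAt ψ hv1
    have hF := transition_contDiffAt ψ ψ' hv.1 hv.2
    funext p
    have e0 : vec (coords ψ (mk γ : RegularVelocity r n N X)) 0 = (ψ.1 ∘ γ.toFun) 0 :=
      vec_coords ψ γ hv1 [] (Nat.zero_le _)
    have hlen : (p.2.1.sort (· ≤ ·)).length ≤ r := by simpa using p.2.2
    rw [coords_mk ψ' γ hv.2, (pd_congr _ (transition_eventuallyEq γ ψ ψ' hv1)).self_of_nhds]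
    conv_lhs => rw [← List.ofFn_get (p.2.1.sort (· ≤ ·))]
    rw [pd_ofFn _ (hF.comp 0 hγ), iteratedFDeriv_comp (f := ψ.1 ∘ γ.toFun) (x := 0) hF hγ
      (by exact_mod_cast le_top)]
    beta_reduce
    rw [e0]
    have key : (ftaylorSeries ℝ F ((ψ.1 ∘ γ.toFun) 0)).taylorComp
          (ftaylorSeries ℝ (ψ.1 ∘ γ.toFun) 0) (p.2.1.sort (· ≤ ·)).length =
        (ftaylorSeries ℝ F ((ψ.1 ∘ γ.toFun) 0)).taylorComp
          (q (coords ψ (mk γ : RegularVelocity r n N X))) (p.2.1.sort (· ≤ ·)).length := by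
      simp only [FormalMultilinearSeries.taylorComp]
      refine Finset.sum_congr rfl fun P _ => ?_
      simp only [FormalMultilinearSeries.compAlongOrderedFinpartition]
      congr 1
      funext m
      simp only [q, ftaylorSeries]
      rw [hΛ' _ _ hγ]
      congr 1
      funext v
      exact (vec_coords ψ γ hv1 _ (by simpa using (P.partSize_le m).trans hlen)).symm
    rw [← key]

theorem trans_source_eq {e e' : PartialEquiv (RegularVelocity r n N X) (JetSpace r n N)}
    {ψ ψ' : SmoothChart N X} (hs : e.source = {v | v.target ∈ ψ.1.source})
    (he : Set.EqOn e (coords ψ) e.source) (hs' : e'.source = {v | v.target ∈ ψ'.1.source}) :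
    (e.symm.trans e').source =
      coords ψ '' {v : RegularVelocity r n N X | v.target ∈ ψ.1.source ∩ ψ'.1.source} := by
  have h1 : (e.symm.trans e').source = e '' (e.source ∩ e'.source) := by
    rw [PartialEquiv.trans_source, PartialEquiv.symm_source, e.image_source_inter_eq']
  have h2 : e.source ∩ e'.source = {v : RegularVelocity r n N X |
      v.target ∈ ψ.1.source ∩ ψ'.1.source} := by
    rw [hs, hs']; rfl
  rw [h1, (he.mono Set.inter_subset_left).image_eq, h2]

end Basic

/-- The associated charts `(V^r_n, ψ^r_n)`, `V^r_n = {j^r_0 γ | γ(0) ∈ V}`, of the smooth charts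
`(V, ψ)` of `X`. -/
def associatedCharts (r n N : ℕ) (X : Type*) [TopologicalSpace X]
    [ChartedSpace (EuclideanSpace ℝ (Fin N)) X] [IsManifold (𝓡 N) ∞ X] :
    Set (PartialEquiv (RegularVelocity r n N X) (JetSpace r n N)) :=
  {e | ∃ ψ : SmoothChart N X, e.source = {v | v.target ∈ ψ.1.source} ∧
    Set.EqOn e (coords ψ) e.source}

/-- The smooth structure of `Imm T^r_n X`, given by the associated charts. -/
noncomputable def core (r n N : ℕ) (X : Type*) [TopologicalSpace X]
    [ChartedSpace (EuclideanSpace ℝ (Fin N)) X] [IsManifold (𝓡 N) ∞ X] :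
    ChartedSpaceCore (JetSpace r n N) (RegularVelocity r n N X) where
  atlas := associatedCharts r n N X
  chartAt v :=
    haveI : Nonempty (RegularVelocity r n N X) := ⟨v⟩
    (coords_injOn (r := r) (n := n)
      ⟨_, IsManifold.chart_mem_maximalAtlas (I := 𝓡 N) (n := ∞) v.target⟩).toPartialEquiv
  mem_chart_source v := mem_chart_source _ _
  chart_mem_atlas v := ⟨⟨_, IsManifold.chart_mem_maximalAtlas v.target⟩, rfl, fun _ _ => rfl⟩
  open_source := by
    rintro e e' ⟨ψ, hs, he⟩ ⟨ψ', hs', -⟩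
    rw [trans_source_eq hs he hs']
    exact isOpen_image_coords ψ _ Set.inter_subset_left (ψ.1.open_source.inter ψ'.1.open_source)
  continuousOn_toFun := by
    rintro e e' ⟨ψ, hs, he⟩ ⟨ψ', hs', he'⟩
    obtain ⟨T, hT, hT'⟩ := exists_continuousOn_transition (r := r) (n := n) ψ ψ'
    rw [trans_source_eq hs he hs']
    refine hT.congr ?_
    rintro _ ⟨v, hv, rfl⟩
    have hv1 : v ∈ e.source := hs ▸ hv.1
    have hv2 : v ∈ e'.source := hs' ▸ hv.2
    rw [← he hv1, PartialEquiv.coe_trans, Function.comp_apply, e.left_inv hv1, he' hv2,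
      hT' v hv, he hv1]

noncomputable instance (r n N : ℕ) (X : Type*) [TopologicalSpace X]
    [ChartedSpace (EuclideanSpace ℝ (Fin N)) X] [IsManifold (𝓡 N) ∞ X] :
    TopologicalSpace (RegularVelocity r n N X) := (core r n N X).toTopologicalSpace

noncomputable instance (r n N : ℕ) (X : Type*) [TopologicalSpace X]
    [ChartedSpace (EuclideanSpace ℝ (Fin N)) X] [IsManifold (𝓡 N) ∞ X] :
    ChartedSpace (JetSpace r n N) (RegularVelocity r n N X) := (core r n N X).toChartedSpace

end RegularVelocity

/-- A local diffeomorphism `α` of `ℝⁿ`, defined near `0`, with `α(0) = 0`. -/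
structure DiffGerm (n : ℕ) where
  toHomeo : OpenPartialHomeomorph (EuclideanSpace ℝ (Fin n)) (EuclideanSpace ℝ (Fin n))
  smooth : toHomeo ∈ contDiffGroupoid ∞ (𝓡 n)
  zero_mem : 0 ∈ toHomeo.source
  map_zero : toHomeo 0 = 0

namespace DiffGerm

variable {n : ℕ}

theorem mem_contDiffGroupoid_iff
    (e : OpenPartialHomeomorph (EuclideanSpace ℝ (Fin n)) (EuclideanSpace ℝ (Fin n))) :
    e ∈ contDiffGroupoid ∞ (𝓡 n) ↔
      ContDiffOn ℝ ∞ e e.source ∧ ContDiffOn ℝ ∞ e.symm e.target := by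
  rw [contDiffGroupoid, mem_groupoid_of_pregroupoid, contDiffPregroupoid]
  simp

theorem contDiffAt (α : DiffGerm n) : ContDiffAt ℝ ∞ α.toHomeo 0 :=
  ((mem_contDiffGroupoid_iff _).1 α.smooth).1.contDiffAt
    (α.toHomeo.open_source.mem_nhds α.zero_mem)

/-- The identity germ. -/
def id (n : ℕ) : DiffGerm n where
  toHomeo := OpenPartialHomeomorph.refl _
  smooth := StructureGroupoid.id_mem _
  zero_mem := Set.mem_univ _
  map_zero := rfl

/-- The composition `α ∘ β`. -/
noncomputable def comp (α β : DiffGerm n) : DiffGerm n where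
  toHomeo := β.toHomeo.trans α.toHomeo
  smooth := StructureGroupoid.trans _ β.smooth α.smooth
  zero_mem := by
    rw [OpenPartialHomeomorph.trans_source]
    exact ⟨β.zero_mem, by rw [Set.mem_preimage, β.map_zero]; exact α.zero_mem⟩
  map_zero := by
    rw [OpenPartialHomeomorph.coe_trans, Function.comp_apply, β.map_zero, α.map_zero]

/-- The inverse `α⁻¹`. -/
noncomputable def inv (α : DiffGerm n) : DiffGerm n where
  toHomeo := α.toHomeo.symm
  smooth := StructureGroupoid.symm _ α.smooth
  zero_mem := by
    have := α.toHomeo.map_source α.zero_mem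
    rwa [α.map_zero] at this
  map_zero := by
    have := α.toHomeo.left_inv α.zero_mem
    rwa [α.map_zero] at this

/-- Germs with the same `r`-jet at `0`. -/
def setoid (r n : ℕ) : Setoid (DiffGerm n) where
  r α β := JetAgree r α.toHomeo β.toHomeo
  iseqv := ⟨fun _ _ _ => rfl, fun h l hl => (h l hl).symm, fun h h' l hl => (h l hl).trans (h' l hl)⟩

theorem comp_agree {r : ℕ} {α α' β β' : DiffGerm n} (h : JetAgree r α.toHomeo α'.toHomeo)
    (h' : JetAgree r β.toHomeo β'.toHomeo) :
    JetAgree r (α.comp β).toHomeo (α'.comp β').toHomeo :=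
  JetAgree.comp (f := β.toHomeo) (f' := β'.toHomeo) (g := α.toHomeo) (g' := α'.toHomeo)
    β.contDiffAt β'.contDiffAt β.map_zero α.contDiffAt α'.contDiffAt h'
    ((jetAgree_iff α.contDiffAt α'.contDiffAt).1 h)

theorem agree_of_eventuallyEq {r : ℕ} {α β : DiffGerm n}
    (h : (α.toHomeo : EuclideanSpace ℝ (Fin n) → EuclideanSpace ℝ (Fin n)) =ᶠ[𝓝 0] β.toHomeo) :
    JetAgree r α.toHomeo β.toHomeo :=
  fun l _ => (pd_congr l h).self_of_nhds

theorem inv_comp_eventuallyEq (α : DiffGerm n) :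
    ((α.inv.comp α).toHomeo : EuclideanSpace ℝ (Fin n) → EuclideanSpace ℝ (Fin n))
      =ᶠ[𝓝 0] (id n).toHomeo := by
  filter_upwards [α.toHomeo.open_source.mem_nhds α.zero_mem] with t ht
  exact α.toHomeo.left_inv ht

theorem comp_inv_eventuallyEq (α : DiffGerm n) :
    ((α.comp α.inv).toHomeo : EuclideanSpace ℝ (Fin n) → EuclideanSpace ℝ (Fin n))
      =ᶠ[𝓝 0] (id n).toHomeo := by
  filter_upwards [α.inv.toHomeo.open_source.mem_nhds α.inv.zero_mem] with t ht
  exact α.toHomeo.right_inv ht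

theorem inv_agree {r : ℕ} {α α' : DiffGerm n} (h : JetAgree r α.toHomeo α'.toHomeo) :
    JetAgree r α.inv.toHomeo α'.inv.toHomeo := by
  have refl : ∀ β : DiffGerm n, JetAgree r β.toHomeo β.toHomeo := fun _ _ _ => rfl
  have h1 : JetAgree r (α.inv.comp (α.comp α'.inv)).toHomeo
      (α.inv.comp (α'.comp α'.inv)).toHomeo := comp_agree (refl _) (comp_agree h (refl _))
  have h2 : JetAgree r (α.inv.comp (α'.comp α'.inv)).toHomeo (α.inv.comp (id n)).toHomeo :=
    comp_agree (refl _) (agree_of_eventuallyEq α'.comp_inv_eventuallyEq)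
  have h3 : JetAgree r ((α.inv.comp α).comp α'.inv).toHomeo ((id n).comp α'.inv).toHomeo :=
    comp_agree (agree_of_eventuallyEq α.inv_comp_eventuallyEq) (refl _)
  intro l hl
  exact ((h1 l hl).symm.trans (h3 l hl) |>.symm.trans (h2 l hl) |>.symm)

end DiffGerm

/-- The differential group `L^r_n` of invertible `r`-jets with source and target `0 ∈ ℝⁿ`. -/
def DifferentialGroup (r n : ℕ) : Type := Quotient (DiffGerm.setoid r n)

namespace DifferentialGroup

variable {r n : ℕ}

/-- The jet `j^r_0 α`. -/
def mk (α : DiffGerm n) : DifferentialGroup r n := Quotient.mk _ α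

theorem exists_rep (a : DifferentialGroup r n) : ∃ α, mk α = a := Quotient.exists_rep a

theorem mk_eq_mk {α β : DiffGerm n} :
    (mk α : DifferentialGroup r n) = mk β ↔ JetAgree r α.toHomeo β.toHomeo := Quotient.eq

/-- `(j^r_0 α) · (j^r_0 β) = j^r_0 (α ∘ β)`. -/
noncomputable instance : Mul (DifferentialGroup r n) :=
  ⟨Quotient.map₂ DiffGerm.comp fun _ _ h _ _ h' => DiffGerm.comp_agree h h'⟩

noncomputable instance : One (DifferentialGroup r n) := ⟨mk (DiffGerm.id n)⟩

noncomputable instance : Inv (DifferentialGroup r n) :=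
  ⟨Quotient.map DiffGerm.inv fun _ _ h => DiffGerm.inv_agree h⟩

theorem mk_mul_mk (α β : DiffGerm n) :
    (mk α * mk β : DifferentialGroup r n) = mk (α.comp β) := rfl

noncomputable instance : Group (DifferentialGroup r n) :=
  Group.ofLeftAxioms
    (fun a b c => by
      obtain ⟨α, rfl⟩ := exists_rep a
      obtain ⟨β, rfl⟩ := exists_rep b
      obtain ⟨γ, rfl⟩ := exists_rep c
      exact mk_eq_mk.2 fun _ _ => rfl)
    (fun a => by
      obtain ⟨α, rfl⟩ := exists_rep a
      exact mk_eq_mk.2 fun _ _ => rfl)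
    (fun a => by
      obtain ⟨α, rfl⟩ := exists_rep a
      exact mk_eq_mk.2 (DiffGerm.agree_of_eventuallyEq α.inv_comp_eventuallyEq))

/-- The space of all families `(a^i_J)`, `1 ≤ i ≤ n`, `1 ≤ |J| ≤ r`. -/
abbrev CoordSpace (r n : ℕ) := Fin n × PosMultiIdx n r → ℝ

/-- The canonical coordinates `a^i_J(j^r_0 α) = ∂_J α^i(0)`, `1 ≤ |J| ≤ r`. -/
noncomputable def coords (a : DifferentialGroup r n) : CoordSpace r n :=
  Quotient.lift (fun α : DiffGerm n => fun p : Fin n × PosMultiIdx n r =>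
    pd (p.2.1.sort (· ≤ ·)) α.toHomeo 0 p.1)
    (fun _ _ h => funext fun p => by
      rw [(h : JetAgree r _ _) _ (by simpa using p.2.2.2)]) a

theorem coords_mk (α : DiffGerm n) (p : Fin n × PosMultiIdx n r) :
    coords (mk α : DifferentialGroup r n) p = pd (p.2.1.sort (· ≤ ·)) α.toHomeo 0 p.1 := rfl

theorem coords_injective : Function.Injective (coords : DifferentialGroup r n → CoordSpace r n) := by
  intro a b hab
  obtain ⟨α, rfl⟩ := exists_rep a
  obtain ⟨β, rfl⟩ := exists_rep b
  refine mk_eq_mk.2 fun l hl => ?_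
  rcases l.eq_nil_or_concat' with rfl | hne
  · exact α.map_zero.trans β.map_zero.symm
  have hp : ((l : Multiset (Fin n)).sort (· ≤ ·)).Perm l := by
    rw [← Multiset.coe_eq_coe, Multiset.sort_eq]
  have hpos : 1 ≤ (l : Multiset (Fin n)).card := by
    obtain ⟨L, b, rfl⟩ := hne
    simp
  have hα := ((DiffGerm.mem_contDiffGroupoid_iff _).1 α.smooth).1
  have hβ := ((DiffGerm.mem_contDiffGroupoid_iff _).1 β.smooth).1
  rw [← pd_perm hp α.toHomeo.open_source hα 0 α.zero_mem,
    ← pd_perm hp β.toHomeo.open_source hβ 0 β.zero_mem]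
  ext i
  exact congrFun hab (i, ⟨l, hpos, by simpa using hl⟩)

theorem exists_diffGerm (s : ℕ) (C : Multiset (Fin n) → EuclideanSpace ℝ (Fin n)) (h0 : C 0 = 0)
    (hli : LinearIndependent ℝ fun j => C {j}) :
    ∃ α : DiffGerm n, ∀ l : List (Fin n), l.length ≤ s → pd l α.toHomeo 0 = C l := by
  obtain ⟨f, hf, hfC⟩ := exists_pd_eq (max s 1) C
  have hf0 : f 0 = 0 := (hfC [] (Nat.zero_le _)).trans h0
  have hinj : Function.Injective (fderiv ℝ f 0) :=
    injective_of_linearIndependent (linearIndependent_congr hli fun j => hfC [j] (by simp))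
  have hequiv : ∀ L : EuclideanSpace ℝ (Fin n) →L[ℝ] EuclideanSpace ℝ (Fin n),
      Function.Injective L → ∃ L' : EuclideanSpace ℝ (Fin n) ≃L[ℝ] EuclideanSpace ℝ (Fin n),
        (L' : EuclideanSpace ℝ (Fin n) →L[ℝ] EuclideanSpace ℝ (Fin n)) = L := fun L hL =>
    ⟨(LinearEquiv.ofInjectiveEndo L.toLinearMap hL).toContinuousLinearEquiv, by ext; rfl⟩
  obtain ⟨L, hL⟩ := hequiv _ hinj
  have hd : ∀ t, HasFDerivAt f (fderiv ℝ f t) t := fun t =>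
    (hf.differentiable (by simp)).differentiableAt.hasFDerivAt
  have hd0 : HasFDerivAt f (L : EuclideanSpace ℝ (Fin n) →L[ℝ] EuclideanSpace ℝ (Fin n)) 0 :=
    hL ▸ hd 0
  let U : Set (EuclideanSpace ℝ (Fin n)) := fderiv ℝ f ⁻¹' {L | Function.Injective L}
  have hU : IsOpen U :=
    ContinuousLinearMap.isOpen_injective.preimage (hf.continuous_fderiv (by simp))
  let φ := (hf.contDiffAt.toOpenPartialHomeomorph f hd0 (by simp)).restrOpen U hU
  have hφ : (φ : EuclideanSpace ℝ (Fin n) → EuclideanSpace ℝ (Fin n)) = f := rfl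
  refine ⟨⟨φ, (DiffGerm.mem_contDiffGroupoid_iff _).2 ⟨hφ ▸ hf.contDiffOn, fun y hy => ?_⟩,
    ⟨hf.contDiffAt.mem_toOpenPartialHomeomorph_source hd0 (by simp), hinj⟩, hf0⟩, fun l hl =>
    hfC l (hl.trans (le_max_left _ _))⟩
  have hy' : φ.symm y ∈ φ.source := φ.map_target hy
  obtain ⟨L', hL'⟩ := hequiv _ (hy'.2 : Function.Injective (fderiv ℝ f (φ.symm y)))
  exact (φ.contDiffAt_symm (f₀' := L') hy (hL' ▸ hd _) hf.contDiffAt).contDiffWithinAt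

/-- The vector `(c^i_J)_i`, or `0` unless `1 ≤ |J| ≤ r`. -/
noncomputable def vec (c : CoordSpace r n) (J : Multiset (Fin n)) : EuclideanSpace ℝ (Fin n) :=
  if h : 1 ≤ J.card ∧ J.card ≤ r then WithLp.toLp 2 fun i => c (i, ⟨J, h⟩) else 0

theorem isOpen_range_coords :
    IsOpen (Set.range (coords : DifferentialGroup r n → CoordSpace r n)) := by
  by_cases hr : 1 ≤ r
  · have : Set.range (coords : DifferentialGroup r n → CoordSpace r n) =
        (fun c : CoordSpace r n => fun j : Fin n => vec c {j}) ⁻¹'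
          {w | LinearIndependent ℝ w} := by
      ext c
      constructor
      · rintro ⟨a, rfl⟩
        obtain ⟨α, rfl⟩ := exists_rep a
        have hinj : Function.Injective (fderiv ℝ α.toHomeo 0) := by
          have h1 : fderiv ℝ (α.inv.toHomeo ∘ α.toHomeo) 0 =
              ContinuousLinearMap.id ℝ (EuclideanSpace ℝ (Fin n)) := by
            exact (α.inv_comp_eventuallyEq.fderiv_eq (𝕜 := ℝ)).trans fderiv_id
          have h2 : DifferentiableAt ℝ α.inv.toHomeo (α.toHomeo 0) := by
            rw [α.map_zero]; exact α.inv.contDiffAt.differentiableAt (by simp)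
          rw [fderiv_comp 0 h2 (α.contDiffAt.differentiableAt (by simp))] at h1
          have h3 : Function.Injective ((fderiv ℝ α.inv.toHomeo (α.toHomeo 0)) ∘
              (fderiv ℝ α.toHomeo 0)) := by
            rw [← ContinuousLinearMap.coe_comp, h1]
            exact Function.injective_id
          exact Function.Injective.of_comp h3
        have h1 := (EuclideanSpace.basisFun (Fin n) ℝ).toBasis.linearIndependent.map'
          (fderiv ℝ α.toHomeo 0).toLinearMap (LinearMap.ker_eq_bot.2 hinj)
        refine linearIndependent_congr h1 fun j => ?_
        have hj : 1 ≤ ({j} : Multiset (Fin n)).card ∧ ({j} : Multiset (Fin n)).card ≤ r := by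
          simpa using hr
        ext i
        simp [vec, hr, coords_mk, pd]
      · intro h
        obtain ⟨α, hα⟩ := exists_diffGerm r (vec c) (by simp [vec]) h
        refine ⟨mk α, funext fun p => ?_⟩
        rw [coords_mk, hα _ (by simpa using p.2.2.2), Multiset.sort_eq]
        simp only [vec, dif_pos p.2.2]
    rw [this]
    refine isOpen_setOfPred_linearIndependent.preimage (continuous_pi fun j => ?_)
    unfold vec
    split_ifs
    · fun_prop
    · exact continuous_const
  · have : IsEmpty (PosMultiIdx n r) := ⟨fun J => hr (J.2.1.trans J.2.2)⟩
    exact isOpen_discrete _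

/-- The chart domain is all of `L^r_n`. -/
noncomputable def core (r n : ℕ) : ChartedSpaceCore (CoordSpace r n) (DifferentialGroup r n) where
  atlas := {e | e.source = Set.univ ∧ ∀ a, e a = coords a}
  chartAt _ := (coords_injective (r := r) (n := n)).injOn (s := Set.univ) |>.toPartialEquiv
  mem_chart_source _ := Set.mem_univ _
  chart_mem_atlas _ := ⟨rfl, fun _ => rfl⟩
  open_source := by
    rintro e e' ⟨hs, he⟩ ⟨hs', -⟩
    have : (e.symm.trans e').source = Set.range coords := by
      rw [PartialEquiv.trans_source, PartialEquiv.symm_source, hs', Set.preimage_univ,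
        Set.inter_univ, ← e.image_source_eq_target, hs, Set.image_univ]
      exact congrArg Set.range (funext he)
    rw [this]
    exact isOpen_range_coords
  continuousOn_toFun := by
    rintro e e' ⟨hs, he⟩ ⟨hs', he'⟩
    refine continuousOn_id.congr fun c hc => ?_
    rw [PartialEquiv.trans_source, PartialEquiv.symm_source] at hc
    rw [PartialEquiv.coe_trans, Function.comp_apply, he', ← he, e.right_inv hc.1, _root_.id]

noncomputable instance : TopologicalSpace (DifferentialGroup r n) := (core r n).toTopologicalSpace

/-- The smooth structure of `L^r_n`, given by the (global) canonical coordinates. -/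
noncomputable instance : ChartedSpace (CoordSpace r n) (DifferentialGroup r n) :=
  (core r n).toChartedSpace

end DifferentialGroup

section Action

variable {r n N : ℕ} {X : Type*} [TopologicalSpace X] [ChartedSpace (EuclideanSpace ℝ (Fin N)) X]

theorem DiffGerm.injective_fderiv (α : DiffGerm n) {t : EuclideanSpace ℝ (Fin n)}
    (ht : t ∈ α.toHomeo.source) : Function.Injective (fderiv ℝ α.toHomeo t) := by
  obtain ⟨h1, h2⟩ := (DiffGerm.mem_contDiffGroupoid_iff _).1 α.smooth
  have h : fderiv ℝ (α.toHomeo.symm ∘ α.toHomeo) t =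
      ContinuousLinearMap.id ℝ (EuclideanSpace ℝ (Fin n)) := by
    have : α.toHomeo.symm ∘ α.toHomeo =ᶠ[𝓝 t] _root_.id := by
      filter_upwards [α.toHomeo.open_source.mem_nhds ht] with s hs
      exact α.toHomeo.left_inv hs
    exact (this.fderiv_eq (𝕜 := ℝ)).trans fderiv_id
  rw [fderiv_comp t
    ((h2.contDiffAt (α.toHomeo.open_target.mem_nhds (α.toHomeo.map_source ht))).differentiableAt
      (by simp))
    ((h1.contDiffAt (α.toHomeo.open_source.mem_nhds ht)).differentiableAt (by simp))] at h
  have h3 : Function.Injective ((fderiv ℝ α.toHomeo.symm (α.toHomeo t)) ∘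
      (fderiv ℝ α.toHomeo t)) := by
    rw [← ContinuousLinearMap.coe_comp, h]
    exact Function.injective_id
  exact Function.Injective.of_comp h3

/-- The composition `γ ∘ α`. -/
noncomputable def ImmersionGerm.comp (γ : ImmersionGerm n N X) (α : DiffGerm n) :
    ImmersionGerm n N X where
  toFun := γ.toFun ∘ α.toHomeo
  exists_immersion := by
    obtain ⟨U, hU, h0, hs, hi⟩ := γ.exists_immersion
    have hα := ((DiffGerm.mem_contDiffGroupoid_iff _).1 α.smooth).1
    refine ⟨α.toHomeo.source ∩ α.toHomeo ⁻¹' U, α.toHomeo.isOpen_inter_preimage hU,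
      ⟨α.zero_mem, by rw [Set.mem_preimage, α.map_zero]; exact h0⟩,
      hs.comp (hα.contMDiffOn.mono Set.inter_subset_left) Set.inter_subset_right, ?_⟩
    rintro t ⟨ht, htU⟩
    have h1 : MDifferentiableAt (𝓡 n) (𝓡 N) γ.toFun (α.toHomeo t) :=
      (hs.contMDiffAt (hU.mem_nhds htU)).mdifferentiableAt (by simp)
    have h2 : MDifferentiableAt (𝓡 n) (𝓡 n) α.toHomeo t :=
      ((hα.contDiffAt (α.toHomeo.open_source.mem_nhds ht)).differentiableAt
        (by simp)).mdifferentiableAt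
    rw [mfderiv_comp (I' := 𝓡 n) t h1 h2]
    refine (hi _ htU).comp ?_
    rw [mfderiv_eq_fderiv]
    exact α.injective_fderiv ht

theorem JetEquiv.comp {γ γ' : ImmersionGerm n N X} {α α' : DiffGerm n} (h : JetEquiv r γ γ')
    (h' : JetAgree r α.toHomeo α'.toHomeo) : JetEquiv r (γ.comp α) (γ'.comp α') := by
  obtain ⟨ψ, h1, h2, h3⟩ := h
  have e : ∀ (γ : ImmersionGerm n N X) (α : DiffGerm n), (γ.comp α).toFun 0 = γ.toFun 0 := by
    intro γ α
    change γ.toFun (α.toHomeo 0) = _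
    rw [α.map_zero]
  refine ⟨ψ, by rwa [e], by rwa [e], ?_⟩
  exact JetAgree.comp (f := α.toHomeo) (f' := α'.toHomeo) (g := ψ.1 ∘ γ.toFun)
    (g' := ψ.1 ∘ γ'.toFun) α.contDiffAt α'.contDiffAt α.map_zero (γ.contDiffAt ψ h1)
    (γ'.contDiffAt ψ h2) h'
    ((jetAgree_iff (γ.contDiffAt ψ h1) (γ'.contDiffAt ψ h2)).1 h3)

variable [IsManifold (𝓡 N) ∞ X]

/-- The right action `(j^r_0 γ) · (j^r_0 α) = j^r_0 (γ ∘ α)`. -/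
noncomputable def RegularVelocity.act (v : RegularVelocity r n N X) (a : DifferentialGroup r n) :
    RegularVelocity r n N X :=
  Quotient.map₂ ImmersionGerm.comp (fun _ _ h _ _ h' => JetEquiv.comp h h') v a

theorem RegularVelocity.mk_act_mk (γ : ImmersionGerm n N X) (α : DiffGerm n) :
    (mk γ : RegularVelocity r n N X).act (DifferentialGroup.mk α) = mk (γ.comp α) := rfl

/-- The right action of `L^r_n` on `Imm T^r_n X`, as an action of the opposite group. -/
noncomputable instance : MulAction (DifferentialGroup r n)ᵐᵒᵖ (RegularVelocity r n N X) where
  smul a v := v.act a.unop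
  one_smul v := by
    obtain ⟨γ, rfl⟩ := RegularVelocity.exists_rep v
    rfl
  mul_smul a b v := by
    obtain ⟨γ, rfl⟩ := RegularVelocity.exists_rep v
    obtain ⟨α, hα⟩ := DifferentialGroup.exists_rep a.unop
    obtain ⟨β, hβ⟩ := DifferentialGroup.exists_rep b.unop
    change RegularVelocity.act _ (b.unop * a.unop) =
      RegularVelocity.act (RegularVelocity.act _ b.unop) a.unop
    rw [← hα, ← hβ]
    rfl

end Action

/-- The set `P^r_n X = Imm T^r_n X / L^r_n` of `(r,n)`-contact elements. -/
def ContactElement (r n N : ℕ) (X : Type*) [TopologicalSpace X]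
    [ChartedSpace (EuclideanSpace ℝ (Fin N)) X] [IsManifold (𝓡 N) ∞ X] : Type _ :=
  MulAction.orbitRel.Quotient (DifferentialGroup r n)ᵐᵒᵖ (RegularVelocity r n N X)

/-- The canonical projection `ρ^r_n : Imm T^r_n X → P^r_n X`. -/
noncomputable def proj {r n N : ℕ} {X : Type*} [TopologicalSpace X]
    [ChartedSpace (EuclideanSpace ℝ (Fin N)) X] [IsManifold (𝓡 N) ∞ X]
    (v : RegularVelocity r n N X) : ContactElement r n N X :=
  Quotient.mk (MulAction.orbitRel (DifferentialGroup r n)ᵐᵒᵖ (RegularVelocity r n N X)) v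

section AdaptedCharts

variable {r n m N : ℕ}

/-- The coordinate `x^A_J`, as a function on jet space (`0` if `|J| > r`). -/
def jetCoord (A : Fin N) (J : Multiset (Fin n)) (c : JetSpace r n N) : ℝ :=
  if h : J.card ≤ r then c (A, ⟨J, h⟩) else 0

/-- The formal derivative `d_i f = ∑_A ∑_{|J| ≤ r - 1} x^A_{iJ} ∂f/∂x^A_J` (the sum runs over
the independent coordinates `x^A_J`). -/
noncomputable def formalDeriv (i : Fin n) (f : JetSpace r n N → ℝ) (c : JetSpace r n N) : ℝ :=
  fderiv ℝ f c fun p => jetCoord p.1 (i ::ₘ p.2.1) c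

/-- The matrix `(x^{i_k}_j)_{k,j}`, where `i_k = S (inl k)`. -/
def jetMatrix (S : Fin n ⊕ Fin m ≃ Fin N) (c : JetSpace r n N) : Matrix (Fin n) (Fin n) ℝ :=
  Matrix.of fun k j => jetCoord (S (Sum.inl k)) {j} c

/-- The functions `y^σ_{i₁ … iₖ}`: `y^σ = x^σ`, and
`y^σ_{i₁ … iₖ} = ∑_j z^j_{i₁} d_j y^σ_{i₂ … iₖ}`, where `z` is the inverse of the matrix
`(x^{i_k}_j)`. The bijection `S` splits `{1, …, N}` into the indices `i_k = S (inl k)` and the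
remaining indices `S (inr σ)`. -/
noncomputable def invariantCoord (S : Fin n ⊕ Fin m ≃ Fin N) (σ : Fin m) :
    List (Fin n) → JetSpace r n N → ℝ
  | [] => jetCoord (S (Sum.inr σ)) 0
  | i :: I => fun c => ∑ j, (jetMatrix S c)⁻¹ j i * formalDeriv j (invariantCoord S σ I) c

/-- The coordinates `Φ^{𝐈,r} = (x^i_J, y^σ_J)`, `|J| ≤ r`; the entry at `(A, J)` is `x^k_J` if
`A = S (inl k)` and `y^σ_J` if `A = S (inr σ)`. -/
noncomputable def adaptedCoords (S : Fin n ⊕ Fin m ≃ Fin N) (c : JetSpace r n N) :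
    JetSpace r n N := fun p =>
  match S.symm p.1 with
  | Sum.inl _ => c p
  | Sum.inr σ => invariantCoord S σ (p.2.1.sort (· ≤ ·)) c

/-- The space of all families `(x^i, y^σ_J)`, `|J| ≤ r`. -/
abbrev ContactSpace (r n m : ℕ) := (Fin n → ℝ) × (Fin m × MultiIdx n r → ℝ)

/-- The map `(x^i_J, y^σ_J) ↦ (x^i, y^σ_J)`. -/
def coordProj (S : Fin n ⊕ Fin m ≃ Fin N) (c : JetSpace r n N) : ContactSpace r n m :=
  (fun k => c (S (Sum.inl k), ⟨0, Nat.zero_le r⟩), fun p => c (S (Sum.inr p.1), p.2))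

/-- The chart domain `W^{𝐈,r} = {j^r_0 γ | γ(0) ∈ V, det (∂(x^{i_k} ∘ γ)/∂t^j (0)) ≠ 0}`. For
`r ≥ 1` the determinant depends on `j^r_0 γ` only. -/
def adaptedDomain {X : Type*} [TopologicalSpace X]
    [ChartedSpace (EuclideanSpace ℝ (Fin N)) X] [IsManifold (𝓡 N) ∞ X]
    (r : ℕ) (ψ : SmoothChart N X) (S : Fin n ⊕ Fin m ≃ Fin N) : Set (RegularVelocity r n N X) :=
  {v | ∃ γ : ImmersionGerm n N X, RegularVelocity.mk γ = v ∧ γ.toFun 0 ∈ ψ.1.source ∧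
    (Matrix.of fun k j : Fin n => pd [j] (ψ.1 ∘ γ.toFun) 0 (S (Sum.inl k))).det ≠ 0}

end AdaptedCharts

/-- `π : T → B` is a smooth right principal `G`-bundle: `G` is a Lie group that acts smoothly and
freely on `T` from the right, the fibres of `π` are the orbits, and around every point of `B` there
is a smooth equivariant local trivialization `π⁻¹(U) ≅ U × G`. -/
structure IsRightPrincipalBundle {EG ET EB G T B : Type*}
    [NormedAddCommGroup EG] [NormedSpace ℝ EG] [NormedAddCommGroup ET] [NormedSpace ℝ ET]
    [NormedAddCommGroup EB] [NormedSpace ℝ EB] [Group G] [TopologicalSpace G] [ChartedSpace EG G]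
    [TopologicalSpace T] [ChartedSpace ET T] [TopologicalSpace B] [ChartedSpace EB B]
    [MulAction Gᵐᵒᵖ T] (π : T → B) : Prop where
  lieGroup : LieGroup 𝓘(ℝ, EG) ∞ G
  isManifold_total : IsManifold 𝓘(ℝ, ET) ∞ T
  isManifold_base : IsManifold 𝓘(ℝ, EB) ∞ B
  surjective : Function.Surjective π
  contMDiff_proj : ContMDiff 𝓘(ℝ, ET) 𝓘(ℝ, EB) ∞ π
  contMDiff_action : ContMDiff (𝓘(ℝ, ET).prod 𝓘(ℝ, EG)) 𝓘(ℝ, ET) ∞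
    fun p : T × G => MulOpposite.op p.2 • p.1
  free : ∀ (x : T) (a : G), MulOpposite.op a • x = x → a = 1
  fibre_eq_orbit : ∀ x y : T, π x = π y ↔ ∃ a : G, y = MulOpposite.op a • x
  locallyTrivial : ∀ b : B, ∃ e : Bundle.Trivialization G π, b ∈ e.baseSet ∧
    ContMDiffOn 𝓘(ℝ, ET) (𝓘(ℝ, EB).prod 𝓘(ℝ, EG)) ∞ e e.source ∧
    ContMDiffOn (𝓘(ℝ, EB).prod 𝓘(ℝ, EG)) 𝓘(ℝ, ET) ∞ e.toOpenPartialHomeomorph.symm e.target ∧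
    ∀ x ∈ e.source, ∀ a : G, (e (MulOpposite.op a • x)).2 = (e x).2 * a

/-- Two smooth structures (topology and atlas) on the set `M` coincide: the topologies are equal
and the identity is smooth in both directions. -/
def SameSmoothStructure {E E' M : Type*} [NormedAddCommGroup E] [NormedSpace ℝ E]
    [NormedAddCommGroup E'] [NormedSpace ℝ E'] (t : TopologicalSpace M) (c : ChartedSpace E M)
    (t' : TopologicalSpace M) (c' : ChartedSpace E' M) : Prop :=
  t = t' ∧
    @ContMDiff ℝ _ E _ _ E _ 𝓘(ℝ, E) M t c E' _ _ E' _ 𝓘(ℝ, E') M t' c' ∞ id ∧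
    @ContMDiff ℝ _ E' _ _ E' _ 𝓘(ℝ, E') M t' c' E _ _ E _ 𝓘(ℝ, E) M t c ∞ id

end Velocity

open Velocity

/-! Everything rests on a normal form. If the components `x^{i_k} ∘ γ` have an invertible Jacobian
at `0`, they form a local diffeomorphism `a`, and `γ` is the graph of some `h` reparametrized by
`a`: its `x`-part is `a` and its `y`-part is `h ∘ a` (`GraphForm`, `exists_graphForm`). The formal
derivative is the total derivative along jets, and contraction with `z` turns `∂/∂t` into `∂/∂x`.
Hence `y^σ_J` takes the value `∂_J h^σ (a 0)` on such a jet (`invariantCoord_jetAt`,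
`GraphForm.yPart_adaptedCoords`).

Three facts follow. Since the jet of `h ∘ a` is polynomial in the jets of `h` and `a`
(`exists_compJet`), the plain coordinates are recovered from the adapted ones, so the latter form a
chart (`exists_adaptedHomeo`). Replacing `γ` by `γ ∘ α` replaces `a` by `a ∘ α` and keeps `h`, so
`x^k` and `y^σ_J` are invariant (`op_smul_mem_adaptedDomain`). Conversely, if these values agree for
`(a, h)` and `(a', h')`, then `a⁻¹ ∘ a'` fixes `0` and its jet carries one velocity to the other
(`exists_op_smul_eq`). The adapted domains are thus saturated, and on each of them the orbits are
the fibres of a linear projection. The charts therefore descend to the quotient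
(`exists_quotient_manifold`), and the projection is a submersion.

Uniqueness is a general property of surjective submersions: local sections make them quotient maps
through which smoothness can be tested. For the bundle structure, the positive-order part of the jet
of `a` is an element of `L^r_n` that is multiplied by `α` on the right (`exists_frame`). This gives
freeness and, together with the projection, the equivariant trivializations. The group law is
composition of jets; inversion is smooth because `α⁻¹` is the graph function of `t ↦ (α t, t)`.

Second countability passes to the quotient under an open map. The Hausdorff property needs one more
idea: two contact elements at the same point of `X` lie in a common adapted chart domain after a
linear change of chart, because two injective linear maps have a common projection that stays
injective after both (`exists_common_projection`). -/

namespace Velocity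

/-! ### Linearity and translation rules for iterated partial derivatives -/

section JetCalculus

variable {n : ℕ} {F G : Type*} [NormedAddCommGroup F] [NormedSpace ℝ F]
  [NormedAddCommGroup G] [NormedSpace ℝ G]

theorem pd_continuousLinearMap_comp (L : F →L[ℝ] G) (l : List (Fin n))
    {f : EuclideanSpace ℝ (Fin n) → F} {t : EuclideanSpace ℝ (Fin n)} (h : ContDiffAt ℝ ∞ f t) :
    pd l (L ∘ f) t = L (pd l f t) := by
  rw [← List.ofFn_get l, pd_ofFn _ (L.contDiff.contDiffAt.comp t h), pd_ofFn _ h,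
    L.iteratedFDeriv_comp_left h (by exact_mod_cast le_top)]
  rfl

/-- The innermost derivative, the one along `j`, kills the constant. Translating a local
diffeomorphism so that it fixes `0` therefore keeps its coordinates of positive order. -/
theorem pd_add_const {j : Fin n} (l : List (Fin n)) (c : F)
    (f : EuclideanSpace ℝ (Fin n) → F) : pd (l ++ [j]) (fun t => f t + c) = pd (l ++ [j]) f := by
  induction l with
  | nil =>
    funext t
    simp only [List.nil_append, pd]
    rw [fderiv_add_const]
  | cons i l ih =>
    funext t
    simp only [List.cons_append, pd, ih]

/-- Evaluation on tuples of basis vectors is linear and injective on multilinear maps, so it has a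
linear left inverse `Λ`. Compared with `exists_continuous_iteratedFDeriv`, linearity gives
smoothness, and the base point is arbitrary. -/
theorem exists_linear_iteratedFDeriv (F : Type*) [NormedAddCommGroup F] [NormedSpace ℝ F]
    [FiniteDimensional ℝ F] (n k : ℕ) :
    ∃ Λ : ((Fin k → Fin n) → F) →L[ℝ] ContinuousMultilinearMap ℝ
        (fun _ : Fin k => EuclideanSpace ℝ (Fin n)) F,
      ∀ (f : EuclideanSpace ℝ (Fin n) → F) (t : EuclideanSpace ℝ (Fin n)), ContDiffAt ℝ ∞ f t →
        iteratedFDeriv ℝ k f t = Λ fun v => pd (List.ofFn v) f t := by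
  let ev : ContinuousMultilinearMap ℝ (fun _ : Fin k => EuclideanSpace ℝ (Fin n)) F →ₗ[ℝ]
      ((Fin k → Fin n) → F) :=
    { toFun := fun T v => T fun i => EuclideanSpace.single (v i) (1 : ℝ)
      map_add' := fun _ _ => rfl
      map_smul' := fun _ _ => rfl }
  have hinj : LinearMap.ker ev = ⊥ := by
    refine LinearMap.ker_eq_bot.2 fun T T' h => ?_
    apply ContinuousMultilinearMap.toMultilinearMap_injective
    refine Module.Basis.ext_multilinear
      (fun _ => (EuclideanSpace.basisFun (Fin n) ℝ).toBasis) fun v => ?_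
    simpa [ev] using congrFun h v
  obtain ⟨Λ, hΛ⟩ := ev.exists_leftInverse_of_injective hinj
  refine ⟨⟨Λ, Λ.continuous_of_finiteDimensional⟩, fun f t hf => ?_⟩
  have := LinearMap.congr_fun hΛ (iteratedFDeriv ℝ k f t)
  simp only [LinearMap.comp_apply, LinearMap.id_apply] at this
  rw [← this]
  change Λ _ = Λ _
  congr 1
  funext v
  exact (pd_ofFn v hf).symm

end JetCalculus

/-- The `r`-jet of `f` at `t`, as the family of the partial derivatives of its components. -/
noncomputable def jetAt (r : ℕ) {n M : ℕ}
    (f : EuclideanSpace ℝ (Fin n) → EuclideanSpace ℝ (Fin M)) (t : EuclideanSpace ℝ (Fin n)) :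
    JetSpace r n M :=
  fun p => pd (p.2.1.sort (· ≤ ·)) f t p.1

/-! ### Jets of maps between Euclidean spaces and their composition -/

section Jets

variable {r n M K : ℕ}

theorem jetAt_congr {f g : EuclideanSpace ℝ (Fin n) → EuclideanSpace ℝ (Fin M)}
    {t : EuclideanSpace ℝ (Fin n)} (h : f =ᶠ[𝓝 t] g) : jetAt r f t = jetAt r g t := by
  funext p
  simp only [jetAt]
  rw [(pd_congr _ h).self_of_nhds]

/-- Coordinates are defined through the sorted list of `J`. Partial derivatives commute, so any list
`l` that enumerates `J` may be used instead. -/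
theorem jetCoord_jetAt {f : EuclideanSpace ℝ (Fin n) → EuclideanSpace ℝ (Fin M)}
    {U : Set (EuclideanSpace ℝ (Fin n))} (hU : IsOpen U) (hf : ContDiffOn ℝ ∞ f U)
    {t : EuclideanSpace ℝ (Fin n)} (ht : t ∈ U) (A : Fin M) {l : List (Fin n)}
    {J : Multiset (Fin n)} (hJ : J = l) (hl : l.length ≤ r) :
    jetCoord A J (jetAt r f t) = pd l f t A := by
  subst hJ
  have hl' : (l : Multiset (Fin n)).card ≤ r := by simpa using hl
  have hp : ((l : Multiset (Fin n)).sort (· ≤ ·)).Perm l := by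
    rw [← Multiset.coe_eq_coe, Multiset.sort_eq]
  simp only [jetCoord, hl', dif_pos, jetAt]
  rw [pd_perm hp hU hf t ht]

theorem jetAt_continuousLinearMap_comp
    (L : EuclideanSpace ℝ (Fin M) →L[ℝ] EuclideanSpace ℝ (Fin K))
    {f : EuclideanSpace ℝ (Fin n) → EuclideanSpace ℝ (Fin M)}
    {t : EuclideanSpace ℝ (Fin n)} (h : ContDiffAt ℝ ∞ f t) (p : Fin K × MultiIdx n r) :
    jetAt r (L ∘ f) t p = L (pd (p.2.1.sort (· ≤ ·)) f t) p.1 := by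
  simp only [jetAt, pd_continuousLinearMap_comp L _ h]

theorem contDiffAt_jetAt {f : EuclideanSpace ℝ (Fin n) → EuclideanSpace ℝ (Fin M)}
    {t : EuclideanSpace ℝ (Fin n)} (h : ContDiffAt ℝ ∞ f t) : ContDiffAt ℝ ∞ (jetAt r f) t := by
  refine contDiffAt_pi.2 fun p => ?_
  exact (EuclideanSpace.proj (𝕜 := ℝ) p.1 :
    EuclideanSpace ℝ (Fin M) →L[ℝ] ℝ).contDiff.contDiffAt.comp t (contDiffAt_pd _ h)

theorem contDiff_vec (J : Multiset (Fin n)) :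
    ContDiff ℝ ∞ fun c : JetSpace r n M => RegularVelocity.vec c J := by
  unfold RegularVelocity.vec
  split_ifs
  · fun_prop
  · exact contDiff_const

theorem vec_jetAt_of_contDiffOn {f : EuclideanSpace ℝ (Fin n) → EuclideanSpace ℝ (Fin M)}
    {U : Set (EuclideanSpace ℝ (Fin n))} (hU : IsOpen U) (hf : ContDiffOn ℝ ∞ f U)
    {t : EuclideanSpace ℝ (Fin n)} (ht : t ∈ U) {l : List (Fin n)} (hl : l.length ≤ r) :
    RegularVelocity.vec (jetAt r f t) l = pd l f t := by
  ext A
  rw [← jetCoord_jetAt hU hf ht A rfl hl]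
  have hl' : (l : Multiset (Fin n)).card ≤ r := by simpa using hl
  simp only [RegularVelocity.vec, jetCoord, hl', dif_pos]

/-- One `Λ` serves all maps and all base points. This makes the Faà di Bruno formula a formula in
jet coordinates. -/
theorem exists_pd_eq_of_jetAt (r n M k : ℕ) (hk : k ≤ r) :
    ∃ Λ : JetSpace r n M → ContinuousMultilinearMap ℝ
        (fun _ : Fin k => EuclideanSpace ℝ (Fin n)) (EuclideanSpace ℝ (Fin M)),
      ContDiff ℝ ∞ Λ ∧ ∀ (f : EuclideanSpace ℝ (Fin n) → EuclideanSpace ℝ (Fin M))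
        (U : Set (EuclideanSpace ℝ (Fin n))), IsOpen U → ContDiffOn ℝ ∞ f U → ∀ t ∈ U,
        iteratedFDeriv ℝ k f t = Λ (jetAt r f t) := by
  obtain ⟨Λ, hΛ⟩ := exists_linear_iteratedFDeriv (EuclideanSpace ℝ (Fin M)) n k
  refine ⟨fun c => Λ fun v => RegularVelocity.vec c (List.ofFn v : List (Fin n)),
    Λ.contDiff.comp (contDiff_pi.2 fun v => contDiff_vec _), fun f U hU hf t ht => ?_⟩
  rw [hΛ f t (hf.contDiffAt (hU.mem_nhds ht))]
  congr 1
  funext v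
  rw [vec_jetAt_of_contDiffOn hU hf ht (by simpa using hk)]

/-- Composition of jets is smooth (polynomial) in the coordinates. -/
theorem exists_compJet (r n K M : ℕ) :
    ∃ T : JetSpace r K M × JetSpace r n K → JetSpace r n M, ContDiff ℝ ∞ T ∧
      ∀ (f : EuclideanSpace ℝ (Fin n) → EuclideanSpace ℝ (Fin K))
        (g : EuclideanSpace ℝ (Fin K) → EuclideanSpace ℝ (Fin M))
        (U : Set (EuclideanSpace ℝ (Fin n))) (V : Set (EuclideanSpace ℝ (Fin K))),
        IsOpen U → ContDiffOn ℝ ∞ f U → IsOpen V → ContDiffOn ℝ ∞ g V → ∀ t ∈ U, f t ∈ V →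
        T (jetAt r g (f t), jetAt r f t) = jetAt r (g ∘ f) t := by
  choose Λ hΛ hΛ' using fun k : Fin (r + 1) =>
    exists_pd_eq_of_jetAt r n K k (Nat.lt_succ_iff.1 k.2)
  choose Θ hΘ hΘ' using fun k : Fin (r + 1) =>
    exists_pd_eq_of_jetAt r K M k (Nat.lt_succ_iff.1 k.2)
  -- Taylor series rebuilt from the jets, with `0` beyond order `r`. The composition formula in
  -- order at most `r` never reads those terms, since a partition of at most `r` elements has at
  -- most `r` blocks, each of size at most `r`.
  let q : JetSpace r n K → FormalMultilinearSeries ℝ (EuclideanSpace ℝ (Fin n))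
      (EuclideanSpace ℝ (Fin K)) := fun c k => if h : k < r + 1 then Λ ⟨k, h⟩ c else 0
  let u : JetSpace r K M → FormalMultilinearSeries ℝ (EuclideanSpace ℝ (Fin K))
      (EuclideanSpace ℝ (Fin M)) := fun c k => if h : k < r + 1 then Θ ⟨k, h⟩ c else 0
  have hq : ∀ k, ContDiff ℝ ∞ fun c => q c k := by
    intro k
    simp only [q]
    split_ifs with h
    · exact hΛ ⟨k, h⟩
    · exact contDiff_const
  have hu : ∀ k, ContDiff ℝ ∞ fun c => u c k := by
    intro k
    simp only [u]
    split_ifs with h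
    · exact hΘ ⟨k, h⟩
    · exact contDiff_const
  refine ⟨fun c p => ((u c.1).taylorComp (q c.2)
    (p.2.1.sort (· ≤ ·)).length (fun i => EuclideanSpace.single
      ((p.2.1.sort (· ≤ ·)).get i) (1 : ℝ))) p.1, ?_, ?_⟩
  · refine contDiff_pi.2 fun p => ?_
    have hT : ContDiff ℝ ∞ (fun c : JetSpace r K M × JetSpace r n K =>
        (u c.1).taylorComp (q c.2) (p.2.1.sort (· ≤ ·)).length) := by
      refine ContDiff.sum fun P _ => ?_
      -- Each summand of the Faà di Bruno formula is linear in the derivative of the outer map and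
      -- multilinear in those of the inner map.
      have hB := ((P.compAlongOrderedFinpartitionL ℝ (EuclideanSpace ℝ (Fin n))
        (EuclideanSpace ℝ (Fin K))
        (EuclideanSpace ℝ (Fin M))).analyticOnNhd_uncurry_of_multilinear
        (s := Set.univ)).contDiff (n := ∞)
      exact hB.comp (f := fun c : JetSpace r K M × JetSpace r n K =>
        (u c.1 P.length, fun m => q c.2 (P.partSize m)))
        (((hu _).comp contDiff_fst).prodMk (contDiff_pi.2 fun m => (hq _).comp contDiff_snd))
    exact (EuclideanSpace.proj (𝕜 := ℝ) p.1 : EuclideanSpace ℝ (Fin M) →L[ℝ] ℝ).contDiff.comp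
      ((ContinuousMultilinearMap.apply ℝ (fun _ => EuclideanSpace ℝ (Fin n))
      (EuclideanSpace ℝ (Fin M)) (fun i => EuclideanSpace.single
      ((p.2.1.sort (· ≤ ·)).get i) (1 : ℝ))).contDiff.comp hT)
  · intro f g U V hU hf hV hg t ht htV
    have hft := hf.contDiffAt (hU.mem_nhds ht)
    have hgt := hg.contDiffAt (hV.mem_nhds htV)
    funext p
    have hlen : (p.2.1.sort (· ≤ ·)).length ≤ r := by simpa using p.2.2
    simp only [jetAt]
    conv_rhs => rw [← List.ofFn_get (p.2.1.sort (· ≤ ·))]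
    rw [pd_ofFn _ (hgt.comp t hft), iteratedFDeriv_comp hgt hft (by exact_mod_cast le_top)]
    have key : (ftaylorSeries ℝ g (f t)).taylorComp (ftaylorSeries ℝ f t)
          (p.2.1.sort (· ≤ ·)).length = (u (jetAt r g (f t))).taylorComp (q (jetAt r f t))
          (p.2.1.sort (· ≤ ·)).length := by
      simp only [FormalMultilinearSeries.taylorComp]
      refine Finset.sum_congr rfl fun P _ => ?_
      have h1 : P.length < r + 1 := Nat.lt_succ_iff.2 (P.length_le.trans hlen)
      have h2 : ∀ m, P.partSize m < r + 1 := fun m =>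
        Nat.lt_succ_iff.2 ((P.partSize_le m).trans hlen)
      simp only [FormalMultilinearSeries.compAlongOrderedFinpartition, ftaylorSeries, q, u, h1, h2,
        dif_pos]
      rw [hΘ' ⟨_, h1⟩ g V hV hg _ htV]
      congr 1
      funext m
      exact hΛ' ⟨_, h2 m⟩ f U hU hf t ht
    rw [key]

/-- Every point of the jet space is the jet of a smooth map; for `r = 0` its first partial
derivatives can be prescribed. -/
theorem exists_jetAt_eq (c : JetSpace r n M) (w : Fin n → EuclideanSpace ℝ (Fin M)) :
    ∃ f : EuclideanSpace ℝ (Fin n) → EuclideanSpace ℝ (Fin M), ContDiff ℝ ∞ f ∧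
      jetAt r f 0 = c ∧ (r = 0 → ∀ j, pd [j] f 0 = w j) := by
  let C : Multiset (Fin n) → EuclideanSpace ℝ (Fin M) := fun J =>
    if J.card ≤ r then RegularVelocity.vec c J else ∑ j, if J = {j} then w j else 0
  -- Order 1 is prescribed even for `r = 0`; this is the only case in which `C` reads `w` within
  -- that range.
  obtain ⟨f, hf, hfC⟩ := exists_pd_eq (max r 1) C
  refine ⟨f, hf, funext fun p => ?_, fun hr j => ?_⟩
  · have h := p.2.2
    simp only [jetAt]
    rw [hfC _ (by simpa using Or.inl h), Multiset.sort_eq]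
    simp only [C, h, if_true, RegularVelocity.vec, dif_pos]
  · subst hr
    rw [hfC _ (by simp)]
    simp [C]

end Jets

/-! ### The functions `y^σ_I` along jets -/

section InvariantCoordinates

variable {r n m N : ℕ}

/-- `F` depends on the coordinates of order at most `k` only. -/
def DependsOnOrder (k : ℕ) (F : JetSpace r n N → ℝ) : Prop :=
  ∀ c c' : JetSpace r n N, (∀ p : Fin N × MultiIdx n r, p.2.1.card ≤ k → c p = c' p) → F c = F c'

/-- The difference `c' - c` has no components of order at most `k`, so `F` is invariant under
translation by it. No differentiability is needed. -/
theorem DependsOnOrder.fderiv_congr {k : ℕ} {F : JetSpace r n N → ℝ} (hF : DependsOnOrder k F)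
    {c c' : JetSpace r n N} (h : ∀ p : Fin N × MultiIdx n r, p.2.1.card ≤ k → c p = c' p) :
    fderiv ℝ F c = fderiv ℝ F c' := by
  have h1 : (fun x => F (x + (c' - c))) = F := by
    funext x
    refine hF _ _ fun p hp => ?_
    simp [h p hp]
  have h2 := fderiv_comp_add_right (𝕜 := ℝ) (f := F) (x := c) (c' - c)
  rw [h1, add_sub_cancel] at h2
  exact h2

theorem DependsOnOrder.fderiv_apply_eq_zero {k : ℕ} {F : JetSpace r n N → ℝ}
    (hF : DependsOnOrder k F) (c : JetSpace r n N) {d : JetSpace r n N}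
    (h : ∀ p : Fin N × MultiIdx n r, p.2.1.card ≤ k → d p = 0) : fderiv ℝ F c d = 0 := by
  by_cases hd : DifferentiableAt ℝ F c
  -- `F` is constant on the line through `c` in the direction `d`.
  · rw [← hd.lineDeriv_eq_fderiv, lineDeriv]
    have : (fun s : ℝ => F (c + s • d)) = fun _ => F c := by
      funext s
      refine hF _ _ fun p hp => ?_
      simp [h p hp]
    rw [this, deriv_const]
  · rw [fderiv_zero_of_not_differentiableAt hd]
    rfl

theorem DependsOnOrder.fderiv_apply_congr {k : ℕ} {F : JetSpace r n N → ℝ}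
    (hF : DependsOnOrder k F) (c : JetSpace r n N) {d d' : JetSpace r n N}
    (h : ∀ p : Fin N × MultiIdx n r, p.2.1.card ≤ k → d p = d' p) :
    fderiv ℝ F c d = fderiv ℝ F c d' := by
  rw [← sub_eq_zero, ← map_sub]
  exact hF.fderiv_apply_eq_zero c fun p hp => by simp [h p hp]

theorem jetCoord_congr {k : ℕ} {c c' : JetSpace r n N}
    (h : ∀ p : Fin N × MultiIdx n r, p.2.1.card ≤ k → c p = c' p) (A : Fin N)
    {J : Multiset (Fin n)} (hJ : J.card ≤ k) : jetCoord A J c = jetCoord A J c' := by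
  unfold jetCoord
  split_ifs with hr
  · exact h _ hJ
  · rfl

/-- The partial derivatives of `F` have order at most `k`, and only those with respect to `x^A_J`,
`|J| ≤ k`, contribute; each is multiplied by `x^A_{jJ}`. -/
theorem DependsOnOrder.formalDeriv {k : ℕ} {F : JetSpace r n N → ℝ} (hF : DependsOnOrder k F)
    (j : Fin n) : DependsOnOrder (k + 1) (formalDeriv j F) := by
  intro c c' h
  unfold Velocity.formalDeriv
  rw [hF.fderiv_congr fun p hp => h p (hp.trans (Nat.le_succ k))]
  exact hF.fderiv_apply_congr c' fun p hp => jetCoord_congr h p.1 (by simpa using hp)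

/-- This controls the truncation of the formal derivative: as long as `|I| < r`, the missing
coordinates of order `r + 1`, which `jetCoord` replaces by `0`, do not enter `d_j y^σ_I`. -/
theorem dependsOnOrder_invariantCoord (S : Fin n ⊕ Fin m ≃ Fin N) (σ : Fin m)
    (I : List (Fin n)) :
    DependsOnOrder I.length (invariantCoord S σ I : JetSpace r n N → ℝ) := by
  induction I with
  | nil => exact fun c c' h => jetCoord_congr h _ (by simp)
  | cons i I ih =>
    intro c c' h
    have hM : jetMatrix S c = jetMatrix S c' := by
      ext k j
      exact jetCoord_congr h _ (by simp)
    simp only [invariantCoord]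
    rw [hM]
    exact Finset.sum_congr rfl fun j _ => by rw [ih.formalDeriv j c c' h]

theorem contDiff_jetCoord (A : Fin N) (J : Multiset (Fin n)) :
    ContDiff ℝ ∞ (jetCoord A J : JetSpace r n N → ℝ) := by
  unfold jetCoord
  split_ifs
  · fun_prop
  · exact contDiff_const

theorem contDiff_det {E : Type*} [NormedAddCommGroup E] [NormedSpace ℝ E] {k : ℕ}
    {A : E → Matrix (Fin k) (Fin k) ℝ} (hA : ∀ i j, ContDiff ℝ ∞ fun c => A c i j) :
    ContDiff ℝ ∞ fun c => (A c).det := by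
  simp only [Matrix.det_apply]
  exact ContDiff.sum fun τ _ => (contDiff_prod fun i _ => hA _ _).const_smul _

/-- By Cramer's rule the entries of the inverse are determinants divided by the determinant. -/
theorem contDiffAt_matrix_inv {E : Type*} [NormedAddCommGroup E] [NormedSpace ℝ E] {k : ℕ}
    {A : E → Matrix (Fin k) (Fin k) ℝ} (hA : ∀ i j, ContDiff ℝ ∞ fun c => A c i j) {c : E}
    (hc : (A c).det ≠ 0) (i j : Fin k) : ContDiffAt ℝ ∞ (fun c => (A c)⁻¹ i j) c := by
  simp only [Matrix.inv_def, Matrix.smul_apply, smul_eq_mul, Ring.inverse_eq_inv',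
    Matrix.adjugate_apply]
  refine ((contDiff_det hA).contDiffAt.inv hc).mul (ContDiff.contDiffAt (contDiff_det fun a b => ?_))
  by_cases ha : a = j
  · subst ha
    simp only [Matrix.updateRow_self]
    exact contDiff_const
  · simp only [Matrix.updateRow_ne ha]
    exact hA a b

theorem contDiff_jetMatrix_apply (S : Fin n ⊕ Fin m ≃ Fin N) (k j : Fin n) :
    ContDiff ℝ ∞ fun c : JetSpace r n N => jetMatrix S c k j :=
  contDiff_jetCoord _ _

theorem isOpen_det_jetMatrix_ne_zero (S : Fin n ⊕ Fin m ≃ Fin N) :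
    IsOpen {c : JetSpace r n N | (jetMatrix S c).det ≠ 0} :=
  isOpen_ne.preimage (contDiff_det (contDiff_jetMatrix_apply S)).continuous

theorem contDiffOn_invariantCoord (S : Fin n ⊕ Fin m ≃ Fin N) (σ : Fin m) (I : List (Fin n)) :
    ContDiffOn ℝ ∞ (invariantCoord S σ I : JetSpace r n N → ℝ)
      {c | (jetMatrix S c).det ≠ 0} := by
  induction I with
  | nil => exact (contDiff_jetCoord _ _).contDiffOn
  | cons i I ih =>
    simp only [invariantCoord]
    refine ContDiffOn.sum fun j _ => ContDiffOn.mul (fun c hc =>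
      (contDiffAt_matrix_inv (contDiff_jetMatrix_apply S) hc j i).contDiffWithinAt) ?_
    unfold formalDeriv
    refine (ih.fderiv_of_isOpen (isOpen_det_jetMatrix_ne_zero S) (by simp)).clm_apply ?_
    exact contDiffOn_pi.2 fun p => (contDiff_jetCoord _ _).contDiffOn

/-- Differentiating the prolongation `t ↦ j^r_t f` along `j` adds `j` to every multi-index. For `|J|
= r` the result has order `r + 1` and is no longer a coordinate of the `r`-jet. -/
theorem fderiv_jetAt_single {f : EuclideanSpace ℝ (Fin n) → EuclideanSpace ℝ (Fin N)}
    {t : EuclideanSpace ℝ (Fin n)} (hf : ContDiffAt ℝ ∞ f t) (j : Fin n)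
    (p : Fin N × MultiIdx n r) :
    fderiv ℝ (jetAt r f) t (EuclideanSpace.single j (1 : ℝ)) p =
      pd (j :: p.2.1.sort (· ≤ ·)) f t p.1 := by
  have h1 : DifferentiableAt ℝ (jetAt r f) t := (contDiffAt_jetAt hf).differentiableAt (by simp)
  have h2 : DifferentiableAt ℝ (pd (p.2.1.sort (· ≤ ·)) f) t :=
    (contDiffAt_pd _ hf).differentiableAt (by simp)
  have e1 := ((ContinuousLinearMap.proj (R := ℝ) (φ := fun _ : Fin N × MultiIdx n r => ℝ)
    p).hasFDerivAt.comp t h1.hasFDerivAt).fderiv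
  have e2 := ((EuclideanSpace.proj (𝕜 := ℝ) p.1 :
    EuclideanSpace ℝ (Fin N) →L[ℝ] ℝ).hasFDerivAt.comp t h2.hasFDerivAt).fderiv
  have e3 := DFunLike.congr_fun (e1.symm.trans e2) (EuclideanSpace.single j (1 : ℝ))
  exact e3

/-- The formal derivative is the total derivative along jet prolongations. -/
theorem formalDeriv_jetAt {k : ℕ} (hk : k < r) {F : JetSpace r n N → ℝ}
    (hF : DependsOnOrder k F) {f : EuclideanSpace ℝ (Fin n) → EuclideanSpace ℝ (Fin N)}
    {U : Set (EuclideanSpace ℝ (Fin n))} (hU : IsOpen U) (hf : ContDiffOn ℝ ∞ f U)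
    {t : EuclideanSpace ℝ (Fin n)} (ht : t ∈ U) (hd : DifferentiableAt ℝ F (jetAt r f t))
    (j : Fin n) :
    formalDeriv j F (jetAt r f t) =
      fderiv ℝ (fun s => F (jetAt r f s)) t (EuclideanSpace.single j (1 : ℝ)) := by
  have hft := hf.contDiffAt (hU.mem_nhds ht)
  have h1 : DifferentiableAt ℝ (jetAt r f) t := (contDiffAt_jetAt hft).differentiableAt (by simp)
  rw [show (fun s => F (jetAt r f s)) = F ∘ jetAt r f from rfl, fderiv_comp t hd h1]
  -- The formal derivative and the chain rule contract the differential of `F` with two vectors that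
  -- agree on the components of order below `r`. On those of order `r` they may differ, but `F` does
  -- not depend on them because `k < r`.
  refine hF.fderiv_apply_congr _ fun p hp => ?_
  refine Eq.trans (jetCoord_jetAt hU hf ht p.1 ?_ ?_) (fderiv_jetAt_single hft j p).symm
  · rw [← Multiset.cons_coe, Multiset.sort_eq]
  · simp only [List.length_cons, Multiset.length_sort]
    omega

/-- Along the jets of `f`, the functions `y^σ_I` are the partial derivatives of `f^σ` with respect
to the components `f^{i_k}` as independent variables. -/
theorem invariantCoord_jetAt (S : Fin n ⊕ Fin m ≃ Fin N) (σ : Fin m)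
    {a : OpenPartialHomeomorph (EuclideanSpace ℝ (Fin n)) (EuclideanSpace ℝ (Fin n))}
    (ha : ContDiffOn ℝ ∞ a a.source) (ha' : ContDiffOn ℝ ∞ a.symm a.target)
    {f : EuclideanSpace ℝ (Fin n) → EuclideanSpace ℝ (Fin N)} (hf : ContDiffOn ℝ ∞ f a.source)
    (hfa : ∀ t ∈ a.source, ∀ k, f t (S (Sum.inl k)) = a t k)
    (hdet : ∀ t ∈ a.source, (Matrix.of fun k j => pd [j] f t (S (Sum.inl k))).det ≠ 0)
    (I : List (Fin n)) (hI : I.length ≤ r) :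
    ∀ t ∈ a.source, invariantCoord S σ I (jetAt r f t) =
      pd I (fun s => f (a.symm s) (S (Sum.inr σ))) (a t) := by
  induction I with
  | nil =>
    intro t ht
    simp only [invariantCoord, pd]
    rw [a.left_inv ht]
    exact jetCoord_jetAt a.open_source hf ht _ (l := []) rfl (Nat.zero_le _)
  | cons i I ih =>
    intro t ht
    have hIr : I.length < r := by simpa using hI
    have hmat : jetMatrix S (jetAt r f t) =
        Matrix.of fun k j => pd [j] f t (S (Sum.inl k)) := by
      ext k j
      exact jetCoord_jetAt a.open_source hf ht _ rfl (by simp; omega)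
    have hu : IsUnit (jetMatrix S (jetAt r f t)).det := by
      rw [hmat]; exact (hdet t ht).isUnit
    set g : EuclideanSpace ℝ (Fin n) → ℝ := fun s => f (a.symm s) (S (Sum.inr σ)) with hg
    have hgs : ContDiffOn ℝ ∞ g a.target := by
      have h1 : ContDiffOn ℝ ∞ (fun s => f (a.symm s)) a.target :=
        hf.comp ha' a.mapsTo_symm
      exact (EuclideanSpace.proj (𝕜 := ℝ) (S (Sum.inr σ)) :
        EuclideanSpace ℝ (Fin N) →L[ℝ] ℝ).contDiff.comp_contDiffOn h1
    have hgd : DifferentiableAt ℝ (pd I g) (a t) :=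
      (contDiffAt_pd I (hgs.contDiffAt
        (a.open_target.mem_nhds (a.map_source ht)))).differentiableAt (by simp)
    have had : DifferentiableAt ℝ a t :=
      (ha.contDiffAt (a.open_source.mem_nhds ht)).differentiableAt (by simp)
    have hfd : DifferentiableAt ℝ f t :=
      (hf.contDiffAt (a.open_source.mem_nhds ht)).differentiableAt (by simp)
    -- By the induction hypothesis `y^σ_I` along the jets of `f` is `∂_I g ∘ a`. The chain rule
    -- brings in the Jacobian of `a`, which is the matrix `(x^{i_k}_j)`.
    have hD : ∀ j, formalDeriv j (invariantCoord S σ I) (jetAt r f t) =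
        ∑ k, pd (k :: I) g (a t) * jetMatrix S (jetAt r f t) k j := by
      intro j
      rw [formalDeriv_jetAt hIr (dependsOnOrder_invariantCoord S σ I) a.open_source hf ht
        (((contDiffOn_invariantCoord S σ I).contDiffAt
          ((isOpen_det_jetMatrix_ne_zero S).mem_nhds hu.ne_zero)).differentiableAt (by simp))]
      have hev : (fun s => invariantCoord S σ I (jetAt r f s)) =ᶠ[𝓝 t] pd I g ∘ a := by
        filter_upwards [a.open_source.mem_nhds ht] with s hs using ih hIr.le s hs
      rw [hev.fderiv_eq, fderiv_comp t hgd had]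
      have hv : fderiv ℝ a t (EuclideanSpace.single j (1 : ℝ)) =
          ∑ k, jetMatrix S (jetAt r f t) k j • EuclideanSpace.single k (1 : ℝ) := by
        ext k
        have e0 : (fun s => f s (S (Sum.inl k))) =ᶠ[𝓝 t] fun s => a s k := by
          filter_upwards [a.open_source.mem_nhds ht] with s hs using hfa s hs k
        have e1 := ((EuclideanSpace.proj (𝕜 := ℝ) k :
          EuclideanSpace ℝ (Fin n) →L[ℝ] ℝ).hasFDerivAt.comp t had.hasFDerivAt).fderiv
        have e2 := ((EuclideanSpace.proj (𝕜 := ℝ) (S (Sum.inl k)) :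
          EuclideanSpace ℝ (Fin N) →L[ℝ] ℝ).hasFDerivAt.comp t hfd.hasFDerivAt).fderiv
        have e3 := DFunLike.congr_fun (e1.symm.trans ((e0.fderiv_eq (𝕜 := ℝ)).symm.trans e2))
          (EuclideanSpace.single j (1 : ℝ))
        rw [hmat]
        simp only [WithLp.ofLp_sum, Finset.sum_apply, PiLp.smul_apply, smul_eq_mul,
          PiLp.single_apply, mul_ite, mul_one, mul_zero, Finset.sum_ite_eq, Finset.mem_univ,
          if_true]
        exact e3
      rw [ContinuousLinearMap.comp_apply, hv, map_sum]
      refine Finset.sum_congr rfl fun k _ => ?_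
      rw [map_smul, smul_eq_mul, mul_comm]
      rfl
    simp only [invariantCoord, hD, Finset.mul_sum]
    rw [Finset.sum_comm]
    have hinv := Matrix.mul_nonsing_inv _ hu
    -- The product of the Jacobian and `z` is the identity, so only the derivative along `i`
    -- survives.
    rw [Finset.sum_eq_single i]
    · have h1 := congrFun (congrFun hinv i) i
      rw [Matrix.mul_apply, Matrix.one_apply_eq] at h1
      refine Eq.trans ?_ (mul_one (pd (i :: I) g (a t)))
      rw [← h1, Finset.mul_sum]
      exact Finset.sum_congr rfl fun j _ => by ring
    · intro k _ hki
      have h1 := congrFun (congrFun hinv k) i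
      rw [Matrix.mul_apply, Matrix.one_apply_ne hki] at h1
      refine Eq.trans ?_ (mul_zero (pd (k :: I) g (a t)))
      rw [← h1, Finset.mul_sum]
      exact Finset.sum_congr rfl fun j _ => by ring
    · simp

end InvariantCoordinates

/-! ### Graph form and the adapted coordinate change on jet space -/

section AdaptedHomeo

/-- The linear map `v ↦ (v^{e k})_k`. -/
noncomputable def selectL {K N : ℕ} (e : Fin K → Fin N) :
    EuclideanSpace ℝ (Fin N) →L[ℝ] EuclideanSpace ℝ (Fin K) :=
  (EuclideanSpace.equiv (Fin K) ℝ).symm.toContinuousLinearMap ∘L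
    ContinuousLinearMap.pi fun k => EuclideanSpace.proj (e k)

@[simp]
theorem selectL_apply {K N : ℕ} (e : Fin K → Fin N) (v : EuclideanSpace ℝ (Fin N)) (k : Fin K) :
    selectL e v k = v (e k) := rfl

/-- A linear endomorphism is injective iff the determinant of its matrix does not vanish. -/
theorem det_ne_zero_iff_injective {n : ℕ}
    (L : EuclideanSpace ℝ (Fin n) →L[ℝ] EuclideanSpace ℝ (Fin n)) :
    (Matrix.of fun k j : Fin n => L (EuclideanSpace.single j (1 : ℝ)) k).det ≠ 0 ↔
      Function.Injective L := by
  have hmul : ∀ v : Fin n → ℝ, (Matrix.of fun k j : Fin n =>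
      L (EuclideanSpace.single j (1 : ℝ)) k).mulVec v = L (WithLp.toLp 2 v) := by
    intro v
    have hv : WithLp.toLp 2 v = ∑ j, v j • EuclideanSpace.single j (1 : ℝ) := by
      ext i
      simp [Pi.single_apply]
    funext k
    rw [hv, map_sum]
    simp [Matrix.mulVec, dotProduct, mul_comm]
  rw [Ne, ← Matrix.exists_mulVec_eq_zero_iff, not_exists]
  constructor
  · intro h
    rw [injective_iff_map_eq_zero]
    intro v hv
    by_contra hne
    refine h v.ofLp ⟨fun h0 => hne ?_, ?_⟩
    · ext i; simpa using congrFun h0 i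
    · rw [hmul]
      funext k
      simp [hv]
  · rintro h v ⟨hv, h0⟩
    rw [hmul] at h0
    refine hv ?_
    have : L (WithLp.toLp 2 v) = L 0 := by
      rw [map_zero]; ext k; simpa using congrFun h0 k
    have := h this
    funext k
    simpa using congrArg (fun u : EuclideanSpace ℝ (Fin n) => u k) this

variable {n : ℕ}

/-- The inverse function theorem near `0`. -/
theorem exists_openPartialHomeomorph
    {f : EuclideanSpace ℝ (Fin n) → EuclideanSpace ℝ (Fin n)}
    {U : Set (EuclideanSpace ℝ (Fin n))} (hU : IsOpen U) (h0 : 0 ∈ U) (hf : ContDiffOn ℝ ∞ f U)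
    (hinj : Function.Injective (fderiv ℝ f 0)) :
    ∃ a : OpenPartialHomeomorph (EuclideanSpace ℝ (Fin n)) (EuclideanSpace ℝ (Fin n)),
      0 ∈ a.source ∧ a.source ⊆ U ∧ (∀ t, a t = f t) ∧ ContDiffOn ℝ ∞ a a.source ∧
      ContDiffOn ℝ ∞ a.symm a.target ∧ ∀ t ∈ a.source, Function.Injective (fderiv ℝ f t) := by
  have hequiv : ∀ L : EuclideanSpace ℝ (Fin n) →L[ℝ] EuclideanSpace ℝ (Fin n),
      Function.Injective L → ∃ L' : EuclideanSpace ℝ (Fin n) ≃L[ℝ] EuclideanSpace ℝ (Fin n),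
        (L' : EuclideanSpace ℝ (Fin n) →L[ℝ] EuclideanSpace ℝ (Fin n)) = L := fun L hL =>
    ⟨(LinearEquiv.ofInjectiveEndo L.toLinearMap hL).toContinuousLinearEquiv, by ext; rfl⟩
  obtain ⟨L, hL⟩ := hequiv _ hinj
  have hat : ∀ t ∈ U, ContDiffAt ℝ ∞ f t := fun t ht => hf.contDiffAt (hU.mem_nhds ht)
  have hd : ∀ t ∈ U, HasFDerivAt f (fderiv ℝ f t) t := fun t ht =>
    ((hat t ht).differentiableAt (by simp)).hasFDerivAt
  have hd0 : HasFDerivAt f (L : EuclideanSpace ℝ (Fin n) →L[ℝ] EuclideanSpace ℝ (Fin n)) 0 :=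
    hL ▸ hd 0 h0
  -- Restriction to the points where the derivative is invertible makes the inverse smooth on the
  -- whole target, not just near `f 0`.
  let V : Set (EuclideanSpace ℝ (Fin n)) := U ∩ fderiv ℝ f ⁻¹' {L | Function.Injective L}
  have hV : IsOpen V := (hf.continuousOn_fderiv_of_isOpen hU (by simp)).isOpen_inter_preimage hU
    ContinuousLinearMap.isOpen_injective
  let φ := ((hat 0 h0).toOpenPartialHomeomorph f hd0 (by simp)).restrOpen V hV
  have hφ : (φ : EuclideanSpace ℝ (Fin n) → EuclideanSpace ℝ (Fin n)) = f := rfl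
  refine ⟨φ, ⟨(hat 0 h0).mem_toOpenPartialHomeomorph_source hd0 (by simp), h0, hinj⟩,
    fun t ht => ht.2.1, fun _ => rfl, hφ ▸ hf.mono fun t ht => ht.2.1, fun y hy => ?_,
    fun t ht => ht.2.2⟩
  have hy' : φ.symm y ∈ φ.source := φ.map_target hy
  obtain ⟨L', hL'⟩ := hequiv _ (hy'.2.2 : Function.Injective (fderiv ℝ f (φ.symm y)))
  exact (φ.contDiffAt_symm (f₀' := L') hy (hL' ▸ hd _ hy'.2.1) (hat _ hy'.2.1)).contDiffWithinAt

theorem pd_comp_add_right {F : Type*} [NormedAddCommGroup F] [NormedSpace ℝ F]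
    (l : List (Fin n)) (f : EuclideanSpace ℝ (Fin n) → F) (b t : EuclideanSpace ℝ (Fin n)) :
    pd l (fun s => f (s + b)) t = pd l f (t + b) := by
  induction l generalizing t with
  | nil => rfl
  | cons j l ih =>
    have h : pd l (fun s => f (s + b)) = fun s => pd l f (s + b) := funext ih
    simp only [pd, h]
    rw [fderiv_comp_add_right]

variable {r m N K : ℕ}

/-- The coordinates `x^{i_k}_J`. -/
def xPart (S : Fin n ⊕ Fin m ≃ Fin N) (c : JetSpace r n N) : JetSpace r n n :=
  fun p => c (S (Sum.inl p.1), p.2)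

/-- The coordinates with upper index `σ`. -/
def yPart (S : Fin n ⊕ Fin m ≃ Fin N) (c : JetSpace r n N) : JetSpace r n m :=
  fun p => c (S (Sum.inr p.1), p.2)

/-- The point with given parts. -/
def joinJet (S : Fin n ⊕ Fin m ≃ Fin N) (x : JetSpace r n n) (y : JetSpace r n m) :
    JetSpace r n N :=
  fun p => Sum.elim (fun k => x (k, p.2)) (fun σ => y (σ, p.2)) (S.symm p.1)

@[simp]
theorem xPart_joinJet (S : Fin n ⊕ Fin m ≃ Fin N) (x : JetSpace r n n) (y : JetSpace r n m) :
    xPart S (joinJet S x y) = x := by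
  funext p
  simp [xPart, joinJet]

@[simp]
theorem yPart_joinJet (S : Fin n ⊕ Fin m ≃ Fin N) (x : JetSpace r n n) (y : JetSpace r n m) :
    yPart S (joinJet S x y) = y := by
  funext p
  simp [yPart, joinJet]

theorem jetSpace_ext (S : Fin n ⊕ Fin m ≃ Fin N) {c d : JetSpace r n N}
    (hx : xPart S c = xPart S d) (hy : yPart S c = yPart S d) : c = d := by
  funext ⟨A, J⟩
  obtain ⟨B, rfl⟩ := S.surjective A
  rcases B with k | σ
  · exact congrFun hx (k, J)
  · exact congrFun hy (σ, J)

theorem contDiff_xPart (S : Fin n ⊕ Fin m ≃ Fin N) :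
    ContDiff ℝ ∞ (xPart S : JetSpace r n N → JetSpace r n n) := by
  unfold xPart; fun_prop

theorem contDiff_yPart (S : Fin n ⊕ Fin m ≃ Fin N) :
    ContDiff ℝ ∞ (yPart S : JetSpace r n N → JetSpace r n m) := by
  unfold yPart; fun_prop

theorem contDiff_joinJet (S : Fin n ⊕ Fin m ≃ Fin N) :
    ContDiff ℝ ∞ fun q : JetSpace r n n × JetSpace r n m =>
      (joinJet S q.1 q.2 : JetSpace r n N) := by
  refine contDiff_pi.2 fun p => ?_
  unfold joinJet
  rcases S.symm p.1 with k | σ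
  · simp only [Sum.elim_inl]; fun_prop
  · simp only [Sum.elim_inr]; fun_prop

@[simp]
theorem xPart_adaptedCoords (S : Fin n ⊕ Fin m ≃ Fin N) (c : JetSpace r n N) :
    xPart S (adaptedCoords S c) = xPart S c := by
  funext p
  simp [xPart, adaptedCoords]

theorem yPart_adaptedCoords_apply (S : Fin n ⊕ Fin m ≃ Fin N) (c : JetSpace r n N)
    (p : Fin m × MultiIdx n r) :
    yPart S (adaptedCoords S c) p = invariantCoord S p.1 (p.2.1.sort (· ≤ ·)) c := by
  simp [yPart, adaptedCoords]

theorem jetMatrix_congr (S : Fin n ⊕ Fin m ≃ Fin N) {c d : JetSpace r n N}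
    (h : xPart S c = xPart S d) : jetMatrix S c = jetMatrix S d := by
  ext k j
  simp only [jetMatrix, jetCoord, Matrix.of_apply]
  split_ifs with hr
  · exact congrFun h (k, _)
  · rfl

/-- The condition `det (x^{i_k}_j) ≠ 0`, which is void for `r = 0`. -/
def IsAdapted (S : Fin n ⊕ Fin m ≃ Fin N) (c : JetSpace r n N) : Prop :=
  r = 0 ∨ (jetMatrix S c).det ≠ 0

theorem IsAdapted.congr {S : Fin n ⊕ Fin m ≃ Fin N} {c d : JetSpace r n N}
    (hc : IsAdapted S c) (h : xPart S c = xPart S d) : IsAdapted S d := by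
  unfold IsAdapted at *
  rwa [← jetMatrix_congr S h]

theorem isOpen_isAdapted (S : Fin n ⊕ Fin m ≃ Fin N) :
    IsOpen {c : JetSpace r n N | IsAdapted S c} := by
  by_cases hr : r = 0
  · simp only [IsAdapted, hr, true_or]
    exact isOpen_univ
  · simp only [IsAdapted, hr, false_or]
    exact isOpen_det_jetMatrix_ne_zero S

theorem contDiffOn_adaptedCoords (S : Fin n ⊕ Fin m ≃ Fin N) :
    ContDiffOn ℝ ∞ (adaptedCoords S : JetSpace r n N → JetSpace r n N) {c | IsAdapted S c} := by
  refine contDiffOn_pi.2 fun p => ?_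
  unfold adaptedCoords
  rcases S.symm p.1 with k | σ
  · simp only; fun_prop
  · simp only
    by_cases hr : r = 0
    -- For `r = 0` the matrix `(x^{i_k}_j)` is zero and gives no information, but then only `y^σ =
    -- x^σ` occurs.
    · have hp : p.2.1 = 0 := by
        have := p.2.2
        rw [← Multiset.card_eq_zero]; omega
      rw [hp, Multiset.sort_zero]
      exact (contDiff_jetCoord _ _).contDiffOn
    · exact (contDiffOn_invariantCoord S σ _).mono fun c hc => hc.resolve_left hr

theorem jetAt_selectL_comp (e : Fin K → Fin N)
    {f : EuclideanSpace ℝ (Fin n) → EuclideanSpace ℝ (Fin N)} {t : EuclideanSpace ℝ (Fin n)}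
    (h : ContDiffAt ℝ ∞ f t) (p : Fin K × MultiIdx n r) :
    jetAt r (selectL e ∘ f) t p = jetAt r f t (e p.1, p.2) :=
  jetAt_continuousLinearMap_comp _ h p

theorem det_jacobian_iff (S : Fin n ⊕ Fin m ≃ Fin N)
    {f : EuclideanSpace ℝ (Fin n) → EuclideanSpace ℝ (Fin N)} {t : EuclideanSpace ℝ (Fin n)}
    (h : DifferentiableAt ℝ f t) :
    (Matrix.of fun k j : Fin n => pd [j] f t (S (Sum.inl k))).det ≠ 0 ↔
      Function.Injective (fderiv ℝ (selectL (fun k => S (Sum.inl k)) ∘ f) t) := by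
  rw [← det_ne_zero_iff_injective, ((selectL (fun k => S (Sum.inl k))).hasFDerivAt.comp t
    h.hasFDerivAt).fderiv]
  rfl

/-- `f` is, near `0`, the graph of `h` reparametrized by the local diffeomorphism `a`. -/
structure GraphForm (S : Fin n ⊕ Fin m ≃ Fin N)
    (f : EuclideanSpace ℝ (Fin n) → EuclideanSpace ℝ (Fin N))
    (a : OpenPartialHomeomorph (EuclideanSpace ℝ (Fin n)) (EuclideanSpace ℝ (Fin n)))
    (h : EuclideanSpace ℝ (Fin n) → EuclideanSpace ℝ (Fin m)) : Prop where
  zero_mem : 0 ∈ a.source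
  contDiffOn : ContDiffOn ℝ ∞ a a.source
  contDiffOn_symm : ContDiffOn ℝ ∞ a.symm a.target
  contDiffOn_fun : ContDiffOn ℝ ∞ f a.source
  contDiffOn_graph : ContDiffOn ℝ ∞ h a.target
  x_eq : ∀ t ∈ a.source, ∀ k, f t (S (Sum.inl k)) = a t k
  y_eq : ∀ t ∈ a.source, ∀ σ, f t (S (Sum.inr σ)) = h (a t) σ

/-- The inverse function theorem applies to the `x`-part of `f` and yields `a`; the graph function
is the `y`-part of `f ∘ a⁻¹`. -/
theorem exists_graphForm (S : Fin n ⊕ Fin m ≃ Fin N)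
    {f : EuclideanSpace ℝ (Fin n) → EuclideanSpace ℝ (Fin N)}
    {U : Set (EuclideanSpace ℝ (Fin n))} (hU : IsOpen U) (h0 : 0 ∈ U) (hf : ContDiffOn ℝ ∞ f U)
    (hdet : (Matrix.of fun k j : Fin n => pd [j] f 0 (S (Sum.inl k))).det ≠ 0) :
    ∃ a h, GraphForm S f a h ∧ a.source ⊆ U := by
  have hfx : ContDiffOn ℝ ∞ (selectL (fun k => S (Sum.inl k)) ∘ f) U :=
    (selectL _).contDiff.comp_contDiffOn hf
  rw [det_jacobian_iff S ((hf.contDiffAt (hU.mem_nhds h0)).differentiableAt (by simp))] at hdet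
  obtain ⟨a, ha0, haU, haf, has, has', -⟩ := exists_openPartialHomeomorph hU h0 hfx hdet
  refine ⟨a, selectL (fun σ => S (Sum.inr σ)) ∘ f ∘ a.symm,
    ⟨ha0, has, has', hf.mono haU, (selectL _).contDiff.comp_contDiffOn
      ((hf.mono haU).comp has' a.mapsTo_symm), fun t _ k => by rw [haf]; rfl, fun t ht σ => ?_⟩, haU⟩
  simp [a.left_inv ht]

namespace GraphForm

variable {S : Fin n ⊕ Fin m ≃ Fin N}
  {f : EuclideanSpace ℝ (Fin n) → EuclideanSpace ℝ (Fin N)}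
  {a : OpenPartialHomeomorph (EuclideanSpace ℝ (Fin n)) (EuclideanSpace ℝ (Fin n))}
  {h : EuclideanSpace ℝ (Fin n) → EuclideanSpace ℝ (Fin m)}

theorem injective_fderiv (H : GraphForm S f a h) {t : EuclideanSpace ℝ (Fin n)}
    (ht : t ∈ a.source) : Function.Injective (fderiv ℝ a t) := by
  have h1 : fderiv ℝ (a.symm ∘ a) t = ContinuousLinearMap.id ℝ (EuclideanSpace ℝ (Fin n)) := by
    have : a.symm ∘ a =ᶠ[𝓝 t] _root_.id := by
      filter_upwards [a.open_source.mem_nhds ht] with s hs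
      exact a.left_inv hs
    exact (this.fderiv_eq (𝕜 := ℝ)).trans fderiv_id
  rw [fderiv_comp t ((H.contDiffOn_symm.contDiffAt
    (a.open_target.mem_nhds (a.map_source ht))).differentiableAt (by simp))
    ((H.contDiffOn.contDiffAt (a.open_source.mem_nhds ht)).differentiableAt (by simp))] at h1
  have h3 : Function.Injective ((fderiv ℝ a.symm (a t)) ∘ (fderiv ℝ a t)) := by
    rw [← ContinuousLinearMap.coe_comp, h1]
    exact Function.injective_id
  exact Function.Injective.of_comp h3

theorem contDiffAt_fun (H : GraphForm S f a h) {t : EuclideanSpace ℝ (Fin n)}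
    (ht : t ∈ a.source) : ContDiffAt ℝ ∞ f t :=
  H.contDiffOn_fun.contDiffAt (a.open_source.mem_nhds ht)

theorem selectL_eventuallyEq (H : GraphForm S f a h) {t : EuclideanSpace ℝ (Fin n)}
    (ht : t ∈ a.source) : selectL (fun k => S (Sum.inl k)) ∘ f =ᶠ[𝓝 t] a := by
  filter_upwards [a.open_source.mem_nhds ht] with s hs
  ext k
  exact H.x_eq s hs k

theorem selectL_eventuallyEq' (H : GraphForm S f a h) {t : EuclideanSpace ℝ (Fin n)}
    (ht : t ∈ a.source) : selectL (fun σ => S (Sum.inr σ)) ∘ f =ᶠ[𝓝 t] h ∘ a := by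
  filter_upwards [a.open_source.mem_nhds ht] with s hs
  ext σ
  exact H.y_eq s hs σ

theorem det_ne_zero (H : GraphForm S f a h) {t : EuclideanSpace ℝ (Fin n)} (ht : t ∈ a.source) :
    (Matrix.of fun k j : Fin n => pd [j] f t (S (Sum.inl k))).det ≠ 0 := by
  rw [det_jacobian_iff S ((H.contDiffAt_fun ht).differentiableAt (by simp)),
    (H.selectL_eventuallyEq ht).fderiv_eq]
  exact H.injective_fderiv ht

theorem xPart_jetAt (H : GraphForm S f a h) : xPart S (jetAt r f 0) = jetAt r a 0 := by
  rw [← jetAt_congr (H.selectL_eventuallyEq H.zero_mem)]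
  funext p
  rw [jetAt_selectL_comp _ (H.contDiffAt_fun H.zero_mem)]
  rfl

theorem yPart_jetAt (H : GraphForm S f a h) : yPart S (jetAt r f 0) = jetAt r (h ∘ a) 0 := by
  rw [← jetAt_congr (H.selectL_eventuallyEq' H.zero_mem)]
  funext p
  rw [jetAt_selectL_comp _ (H.contDiffAt_fun H.zero_mem)]
  rfl

/-- The `y`-components of `f ∘ a⁻¹` are those of `h`, so `invariantCoord_jetAt` gives derivatives of
`h`. The parametrization `a` enters only through the point `a 0`, whereas the plain coordinates in
`yPart_jetAt` see the whole jet of `a`. This contrast is the source of both invariance and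
invertibility. -/
theorem yPart_adaptedCoords (H : GraphForm S f a h) :
    yPart S (adaptedCoords S (jetAt r f 0)) = jetAt r h (a 0) := by
  funext p
  have hp : (p.2.1.sort (· ≤ ·)).length ≤ r := by simpa using p.2.2
  have ha0 := a.map_source H.zero_mem
  rw [yPart_adaptedCoords_apply, invariantCoord_jetAt S p.1 H.contDiffOn H.contDiffOn_symm
    H.contDiffOn_fun H.x_eq (fun t ht => H.det_ne_zero ht) _ hp 0 H.zero_mem]
  have hev : (fun s => f (a.symm s) (S (Sum.inr p.1))) =ᶠ[𝓝 (a 0)]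
      (EuclideanSpace.proj p.1 : EuclideanSpace ℝ (Fin m) →L[ℝ] ℝ) ∘ h := by
    filter_upwards [a.open_target.mem_nhds ha0] with s hs
    rw [H.y_eq _ (a.map_target hs), a.right_inv hs]
    rfl
  rw [(pd_congr _ hev).self_of_nhds, pd_continuousLinearMap_comp _ _
    (H.contDiffOn_graph.contDiffAt (a.open_target.mem_nhds ha0))]
  rfl

theorem isAdapted (H : GraphForm S f a h) : IsAdapted S (jetAt r f 0) := by
  by_cases hr : r = 0
  · exact Or.inl hr
  · refine Or.inr ?_
    have : jetMatrix S (jetAt r f 0) = Matrix.of fun k j => pd [j] f 0 (S (Sum.inl k)) := by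
      ext k j
      exact jetCoord_jetAt a.open_source H.contDiffOn_fun H.zero_mem _ rfl (by simp; omega)
    rw [this]
    exact H.det_ne_zero H.zero_mem

end GraphForm

/-- Identities on the set of adapted jets can thereby be checked on maps in graph form. For `r ≥ 1`
the Jacobian is part of the jet; for `r = 0` it is free. -/
theorem exists_graphForm_of_isAdapted (S : Fin n ⊕ Fin m ≃ Fin N) {c : JetSpace r n N}
    (hc : IsAdapted S c) : ∃ f a h, GraphForm S f a h ∧ ContDiff ℝ ∞ f ∧ jetAt r f 0 = c := by
  obtain ⟨f, hf, hfc, hfw⟩ := exists_jetAt_eq c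
    -- For `r = 0` this choice of first derivatives makes the Jacobian of the `x`-part the identity
    -- matrix.
    fun j => EuclideanSpace.single (S (Sum.inl j)) (1 : ℝ)
  have hdet : (Matrix.of fun k j : Fin n => pd [j] f 0 (S (Sum.inl k))).det ≠ 0 := by
    by_cases hr : r = 0
    · have : (Matrix.of fun k j : Fin n => pd [j] f 0 (S (Sum.inl k))) = 1 := by
        ext k j
        simp only [Matrix.of_apply, hfw hr, Matrix.one_apply, PiLp.single_apply,
          S.injective.eq_iff, Sum.inl.injEq]
      rw [this, Matrix.det_one]
      exact one_ne_zero
    · have : jetMatrix S c = Matrix.of fun k j => pd [j] f 0 (S (Sum.inl k)) := by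
        rw [← hfc]
        ext k j
        exact jetCoord_jetAt isOpen_univ hf.contDiffOn (Set.mem_univ _) _ rfl (by simp; omega)
      rw [← this]
      exact hc.resolve_left hr
  obtain ⟨a, h, H, -⟩ := exists_graphForm S isOpen_univ (Set.mem_univ _) hf.contDiffOn hdet
  exact ⟨f, a, h, H, hf, hfc⟩

/-- A map with given jet at a given point. -/
theorem exists_jetAt_eq_at (c : JetSpace r n m) (b : EuclideanSpace ℝ (Fin n)) :
    ∃ h : EuclideanSpace ℝ (Fin n) → EuclideanSpace ℝ (Fin m), ContDiff ℝ ∞ h ∧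
      jetAt r h b = c := by
  obtain ⟨h, hh, hc, -⟩ := exists_jetAt_eq c fun _ => 0
  refine ⟨fun s => h (s + -b), hh.comp (contDiff_id.add contDiff_const), ?_⟩
  rw [← hc]
  funext p
  simp only [jetAt]
  rw [pd_comp_add_right, add_neg_cancel]

/-- The map `(a, h ∘ a)`, arranged according to `S`, does it. It serves to vary `h` with `a` fixed,
and also with `h = a⁻¹` for inversion in the differential group. -/
theorem exists_graphForm_of_graph (S : Fin n ⊕ Fin m ≃ Fin N)
    {a : OpenPartialHomeomorph (EuclideanSpace ℝ (Fin n)) (EuclideanSpace ℝ (Fin n))}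
    (h0 : 0 ∈ a.source) (ha : ContDiffOn ℝ ∞ a a.source) (ha' : ContDiffOn ℝ ∞ a.symm a.target)
    {h : EuclideanSpace ℝ (Fin n) → EuclideanSpace ℝ (Fin m)} (hh : ContDiffOn ℝ ∞ h a.target) :
    ∃ f, GraphForm S f a h := by
  refine ⟨fun t => WithLp.toLp 2 fun A => Sum.elim (a t) (h (a t)) (S.symm A),
    h0, ha, ha', ?_, hh, fun t _ k => by simp, fun t _ σ => by simp⟩
  rw [contDiffOn_euclidean]
  intro A
  rcases hA : S.symm A with k | σ
  · simp only [hA, Sum.elim_inl]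
    exact contDiffOn_euclidean.1 ha k
  · simp only [hA, Sum.elim_inr]
    exact contDiffOn_euclidean.1 (hh.comp ha a.mapsTo) σ

/-- The adapted coordinates are a diffeomorphism of the set of adapted jets. -/
theorem exists_adaptedHomeo (r : ℕ) (S : Fin n ⊕ Fin m ≃ Fin N) :
    ∃ Ψ : OpenPartialHomeomorph (JetSpace r n N) (JetSpace r n N),
      Ψ.source = {c | IsAdapted S c} ∧ (∀ c, Ψ c = adaptedCoords S c) ∧
      ContDiffOn ℝ ∞ Ψ Ψ.source ∧ ContDiffOn ℝ ∞ Ψ.symm Ψ.target := by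
  -- In graph form the adapted coordinates are the jets of `a` and `h`, and the plain ones are the
  -- jets of `a` and `h ∘ a`. The inverse of the coordinate change is therefore `(x, y) ↦ (x, T (y,
  -- x))`.
  obtain ⟨T, hT, hTc⟩ := exists_compJet r n n m
  have hleft : ∀ c : JetSpace r n N, IsAdapted S c →
      T (yPart S (adaptedCoords S c), xPart S c) = yPart S c := by
    intro c hc
    obtain ⟨f, a, h, H, -, rfl⟩ := exists_graphForm_of_isAdapted S hc
    rw [H.yPart_adaptedCoords, H.xPart_jetAt, H.yPart_jetAt]
    exact hTc a h a.source a.target a.open_source H.contDiffOn a.open_target H.contDiffOn_graph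
      0 H.zero_mem (a.map_source H.zero_mem)
  have hright : ∀ d : JetSpace r n N, IsAdapted S d →
      adaptedCoords S (joinJet S (xPart S d) (T (yPart S d, xPart S d))) = d := by
    intro d hd
    obtain ⟨f, a, h, H, -, rfl⟩ := exists_graphForm_of_isAdapted S hd
    -- Here `d` plays the role of adapted coordinates, so only `a` is kept from its graph form. The
    -- `y`-part of `d` has to be the jet of a new graph function `g` at `a 0`.
    obtain ⟨g, hg, hgd⟩ := exists_jetAt_eq_at (yPart S (jetAt r f 0)) (a 0)
    obtain ⟨f', H'⟩ := exists_graphForm_of_graph S H.zero_mem H.contDiffOn H.contDiffOn_symm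
      (hg.contDiffOn (s := a.target))
    have hc : joinJet S (xPart S (jetAt r f 0)) (T (yPart S (jetAt r f 0),
        xPart S (jetAt r f 0))) = jetAt r f' 0 := by
      apply jetSpace_ext S
      · rw [xPart_joinJet, H.xPart_jetAt, H'.xPart_jetAt]
      · rw [yPart_joinJet, H'.yPart_jetAt, ← hgd, H.xPart_jetAt]
        exact hTc a g a.source a.target a.open_source H.contDiffOn a.open_target
          H'.contDiffOn_graph 0 H.zero_mem (a.map_source H.zero_mem)
    rw [hc]
    apply jetSpace_ext S
    · rw [xPart_adaptedCoords, H.xPart_jetAt, H'.xPart_jetAt]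
    · rw [H'.yPart_adaptedCoords, hgd]
  have hinv : ContDiff ℝ ∞ fun d : JetSpace r n N =>
      joinJet S (xPart S d) (T (yPart S d, xPart S d)) :=
    (contDiff_joinJet S).comp ((contDiff_xPart S).prodMk
      (hT.comp ((contDiff_yPart S).prodMk (contDiff_xPart S))))
  refine ⟨{ toFun := adaptedCoords S
            invFun := fun d => joinJet S (xPart S d) (T (yPart S d, xPart S d))
            source := {c | IsAdapted S c}
            -- The image is the same set, since adaptedness depends on the `x`-part only and that
            -- part is unchanged.
            target := {c | IsAdapted S c}
            map_source' := fun c hc => IsAdapted.congr hc (xPart_adaptedCoords S c).symm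
            map_target' := fun d hd => IsAdapted.congr hd (xPart_joinJet S _ _).symm
            left_inv' := fun c hc => ?_
            right_inv' := fun d hd => hright d hd
            open_source := isOpen_isAdapted S
            open_target := isOpen_isAdapted S
            continuousOn_toFun := (contDiffOn_adaptedCoords S).continuousOn
            continuousOn_invFun := hinv.continuous.continuousOn }, rfl, fun _ => rfl,
    contDiffOn_adaptedCoords S, hinv.contDiffOn⟩
  apply jetSpace_ext S
  · rw [xPart_joinJet, xPart_adaptedCoords]
  · rw [yPart_joinJet, xPart_adaptedCoords, hleft c hc]

end AdaptedHomeo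

/-! ### Quotient manifolds from saturated charts -/

section QuotientManifold

variable {ET EB F T B ι : Type*} [NormedAddCommGroup ET] [NormedSpace ℝ ET]
  [NormedAddCommGroup EB] [NormedSpace ℝ EB] [NormedAddCommGroup F] [NormedSpace ℝ F]
  [TopologicalSpace T] [TopologicalSpace B]

/-- By `hrel` the first component of `κ ∘ Φ` descends to an injective function on the image.
Saturation makes the image open and the descended function continuous for the quotient topology; it
is open because linear projections are. -/
theorem exists_quotient_chart {π : T → B} (hπ : Topology.IsQuotientMap π)
    (Φ : OpenPartialHomeomorph T ET) (κ : ET ≃L[ℝ] EB × F)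
    (hsat : π ⁻¹' (π '' Φ.source) = Φ.source)
    (hrel : ∀ v ∈ Φ.source, ∀ w ∈ Φ.source, π v = π w ↔ (κ (Φ v)).1 = (κ (Φ w)).1) :
    ∃ χ : OpenPartialHomeomorph B EB, χ.source = π '' Φ.source ∧
      ∀ v ∈ Φ.source, χ (π v) = (κ (Φ v)).1 := by
  classical
  have : Nonempty B := ⟨π (Φ.symm 0)⟩
  let f : B → EB := fun b => if h : ∃ v ∈ Φ.source, π v = b then (κ (Φ h.choose)).1 else 0
  have hf : ∀ v ∈ Φ.source, f (π v) = (κ (Φ v)).1 := by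
    intro v hv
    have h : ∃ w ∈ Φ.source, π w = π v := ⟨v, hv, rfl⟩
    simp only [f, h, dif_pos]
    exact (hrel _ h.choose_spec.1 _ hv).1 h.choose_spec.2
  have hinj : Set.InjOn f (π '' Φ.source) := by
    rintro _ ⟨v, hv, rfl⟩ _ ⟨w, hw, rfl⟩ h
    rw [hf v hv, hf w hw] at h
    exact (hrel v hv w hw).2 h
  have hop : IsOpen (π '' Φ.source) := by
    rw [← hπ.isOpen_preimage, hsat]
    exact Φ.open_source
  have hq : Continuous fun d : ET => (κ d).1 := continuous_fst.comp κ.continuous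
  have hqo : IsOpenMap fun d : ET => (κ d).1 :=
    isOpenMap_fst.comp κ.toHomeomorph.isOpenMap
  refine ⟨OpenPartialHomeomorph.ofContinuousOpenRestrict hinj.toPartialEquiv ?_ ?_ hop, rfl,
    fun v hv => hf v hv⟩
  · change ContinuousOn f (π '' Φ.source)
    rw [continuousOn_open_iff hop]
    intro s hs
    rw [← hπ.isOpen_preimage]
    have : π ⁻¹' (π '' Φ.source ∩ f ⁻¹' s) = Φ.source ∩ (fun v => (κ (Φ v)).1) ⁻¹' s := by
      rw [Set.preimage_inter, hsat]
      ext v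
      constructor
      · rintro ⟨hv, h⟩
        exact ⟨hv, by rw [Set.mem_preimage, Set.mem_preimage, hf v hv] at h; exact h⟩
      · rintro ⟨hv, h⟩
        exact ⟨hv, by rw [Set.mem_preimage, Set.mem_preimage, hf v hv]; exact h⟩
    rw [this]
    exact (hq.comp_continuousOn Φ.continuousOn).isOpen_inter_preimage Φ.open_source hs
  · change IsOpenMap ((π '' Φ.source).domRestrict f)
    intro s hs
    obtain ⟨O, hO, rfl⟩ := isOpen_induced_iff.1 hs
    have : (π '' Φ.source).domRestrict f '' (Subtype.val ⁻¹' O) =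
        (fun d : ET => (κ d).1) '' (Φ '' (Φ.source ∩ π ⁻¹' O)) := by
      ext y
      constructor
      · rintro ⟨⟨_, v, hv, rfl⟩, hO, rfl⟩
        exact ⟨Φ v, ⟨v, ⟨hv, hO⟩, rfl⟩, (hf v hv).symm⟩
      · rintro ⟨_, ⟨v, ⟨hv, hO⟩, rfl⟩, rfl⟩
        exact ⟨⟨π v, v, hv, rfl⟩, hO, hf v hv⟩
    rw [this]
    exact hqo _ (Φ.isOpen_image_of_subset_source
      (Φ.open_source.inter (hO.preimage hπ.continuous)) Set.inter_subset_left)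

/-- A quotient of a manifold is a manifold if there are saturated charts in which the quotient map
is a linear projection. -/
theorem exists_quotient_manifold [ChartedSpace ET T] [IsManifold 𝓘(ℝ, ET) ∞ T] {π : T → B}
    (hπ : Topology.IsQuotientMap π) (Φ : ι → OpenPartialHomeomorph T ET)
    (hΦ : ∀ i, Φ i ∈ IsManifold.maximalAtlas 𝓘(ℝ, ET) ∞ T) (κ : ι → ET ≃L[ℝ] EB × F)
    (hsat : ∀ i, π ⁻¹' (π '' (Φ i).source) = (Φ i).source)
    (hrel : ∀ i, ∀ v ∈ (Φ i).source, ∀ w ∈ (Φ i).source,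
      π v = π w ↔ (κ i (Φ i v)).1 = (κ i (Φ i w)).1)
    (hcov : ∀ v, ∃ i, v ∈ (Φ i).source) :
    ∃ _ : ChartedSpace EB B, IsManifold 𝓘(ℝ, EB) ∞ B ∧
      ∀ i, ∃ χ ∈ IsManifold.maximalAtlas 𝓘(ℝ, EB) ∞ B, χ.source = π '' (Φ i).source ∧
        ∀ v ∈ (Φ i).source, χ (π v) = (κ i (Φ i v)).1 := by
  choose χ hχs hχ using fun i => exists_quotient_chart hπ (Φ i) (κ i) (hsat i) (hrel i)
  have hcovB : ∀ b, ∃ i, b ∈ (χ i).source := by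
    intro b
    obtain ⟨v, rfl⟩ := hπ.surjective b
    obtain ⟨i, hi⟩ := hcov v
    exact ⟨i, by rw [hχs]; exact ⟨v, hi, rfl⟩⟩
  choose idx hidx using hcovB
  let _c : ChartedSpace EB B :=
    { atlas := Set.range χ
      chartAt := fun b => χ (idx b)
      mem_chart_source := hidx
      chart_mem_atlas := fun b => ⟨_, rfl⟩ }
  have hM : IsManifold 𝓘(ℝ, EB) ∞ B := by
    refine isManifold_of_contDiffOn _ _ _ ?_
    rintro _ _ ⟨i, rfl⟩ ⟨j, rfl⟩
    simp only [modelWithCornersSelf_coe, modelWithCornersSelf_coe_symm, Function.id_comp,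
      Function.comp_id, Set.preimage_id, Set.range_id, Set.inter_univ]
    intro y hy
    refine ContDiffAt.contDiffWithinAt ?_
    rw [OpenPartialHomeomorph.trans_source, OpenPartialHomeomorph.symm_source] at hy
    obtain ⟨hy1, hy2⟩ := hy
    have hb := (χ i).map_target hy1
    rw [hχs] at hb
    obtain ⟨v, hv, hvb⟩ := hb
    -- By saturation every representative of a point in the domain of `χ j` lies in the domain of `Φ
    -- j`.
    have hvj : v ∈ (Φ j).source := by
      rw [← hsat j, Set.mem_preimage, hvb, ← hχs]
      exact hy2
    have hyv : y = (κ i (Φ i v)).1 := by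
      rw [← hχ i v hv, hvb, (χ i).right_inv hy1]
    -- An affine section of the projection through `Φ i v`, with the fibre component frozen. Near
    -- `y` the transition map of the quotient is the one upstairs, preceded by `s` and followed by
    -- the projection.
    let s : EB → ET := fun z => (κ i).symm (z, (κ i (Φ i v)).2)
    have hs : ContDiff ℝ ∞ s := (κ i).symm.contDiff.comp (contDiff_id.prodMk contDiff_const)
    have hsy : s y = Φ i v := by
      simp only [s, hyv, Prod.mk.eta, ContinuousLinearEquiv.symm_apply_apply]
    have htr := (contDiffGroupoid ∞ 𝓘(ℝ, ET)).compatible_of_mem_maximalAtlas (hΦ i) (hΦ j)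
    have htr' : ContDiffOn ℝ ∞ (Φ j ∘ (Φ i).symm) ((Φ i).symm ≫ₕ Φ j).source := by
      have := (mem_groupoid_of_pregroupoid.1 htr).1
      simpa [contDiffPregroupoid] using this
    have hmem : s y ∈ ((Φ i).symm ≫ₕ Φ j).source := by
      rw [hsy, OpenPartialHomeomorph.trans_source, OpenPartialHomeomorph.symm_source]
      exact ⟨(Φ i).map_source hv, by rw [Set.mem_preimage, (Φ i).left_inv hv]; exact hvj⟩
    have hcd : ContDiffAt ℝ ∞ (fun z => (κ j ((Φ j ∘ (Φ i).symm) (s z))).1) y :=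
      contDiff_fst.contDiffAt.comp y ((κ j).contDiff.contDiffAt.comp y
        (ContDiffAt.comp (g := Φ j ∘ (Φ i).symm) (f := s) y (htr'.contDiffAt
          (((Φ i).symm ≫ₕ Φ j).open_source.mem_nhds hmem)) hs.contDiffAt))
    refine hcd.congr_of_eventuallyEq ?_
    filter_upwards [hs.continuous.continuousAt.preimage_mem_nhds
      (((Φ i).symm ≫ₕ Φ j).open_source.mem_nhds hmem)] with z hz
    rw [Set.mem_preimage, OpenPartialHomeomorph.trans_source,
      OpenPartialHomeomorph.symm_source] at hz
    have hw : (Φ i).symm (s z) ∈ (Φ i).source := (Φ i).map_target hz.1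
    have hz' : (χ i).symm z = π ((Φ i).symm (s z)) := by
      have h1 := hχ i _ hw
      rw [(Φ i).right_inv hz.1] at h1
      simp only [s, ContinuousLinearEquiv.apply_symm_apply] at h1
      rw [← (χ i).left_inv (x := π ((Φ i).symm (s z))) (by rw [hχs]; exact ⟨_, hw, rfl⟩), h1]
    rw [OpenPartialHomeomorph.coe_trans, Function.comp_apply, hz', hχ j _ hz.2]
    rfl
  exact ⟨_c, hM, fun i => ⟨χ i, IsManifold.subset_maximalAtlas ⟨i, rfl⟩, hχs i, hχ i⟩⟩

end QuotientManifold

/-! ### Local sections of submersions and uniqueness of the quotient structure -/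

section Submersions

variable {ET EB EC T B C : Type*} [NormedAddCommGroup ET] [NormedSpace ℝ ET]
  [NormedAddCommGroup EB] [NormedSpace ℝ EB] [NormedAddCommGroup EC] [NormedSpace ℝ EC]
  [TopologicalSpace T] [ChartedSpace ET T] [TopologicalSpace B] [ChartedSpace EB B]
  [TopologicalSpace C] [ChartedSpace EC C]

/-- In suitable charts a submersion is a linear projection; the section keeps the fibre coordinate
of `x` constant. -/
theorem exists_local_section {π : T → B} (hπ : Manifold.IsSubmersion 𝓘(ℝ, ET) 𝓘(ℝ, EB) ∞ π)
    (x : T) : ∃ s : B → T, s (π x) = x ∧ ContMDiffAt 𝓘(ℝ, EB) 𝓘(ℝ, ET) ∞ s (π x) ∧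
      ∀ᶠ b in 𝓝 (π x), π (s b) = b := by
  have h := hπ.isSubmersionOfComplement_complement x
  have hx := h.mem_domChart_source
  have hπx := h.mem_codChart_source
  let z := (h.equiv (h.domChart x)).2
  let u : EB → ET := fun y => h.equiv.symm (y, z)
  have hu : ContDiff ℝ ∞ u := h.equiv.symm.contDiff.comp (contDiff_id.prodMk contDiff_const)
  have hw : ∀ d ∈ h.domChart.target, h.codChart (π (h.domChart.symm d)) = (h.equiv d).1 := by
    intro d hd
    have := h.writtenInCharts (show d ∈ (h.domChart.extend 𝓘(ℝ, ET)).target by simpa using hd)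
    simpa using this
  have hux : u (h.codChart (π x)) = h.domChart x := by
    have := hw _ (h.domChart.map_source hx)
    rw [h.domChart.left_inv hx] at this
    simp only [u, z, this, Prod.mk.eta, ContinuousLinearEquiv.symm_apply_apply]
  have hcod := contMDiffAt_of_mem_maximalAtlas h.codChart_mem_maximalAtlas hπx
  have hdom := contMDiffAt_symm_of_mem_maximalAtlas h.domChart_mem_maximalAtlas
    (h.domChart.map_source hx)
  refine ⟨fun b => h.domChart.symm (u (h.codChart b)), ?_, ?_, ?_⟩
  · simp only [hux, h.domChart.left_inv hx]
  · rw [← hux] at hdom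
    have h1 : ContMDiffAt 𝓘(ℝ, EB) 𝓘(ℝ, ET) ∞ (u ∘ h.codChart) (π x) :=
      ContMDiffAt.comp (π x) hu.contMDiff.contMDiffAt hcod
    exact ContMDiffAt.comp (g := h.domChart.symm) (f := u ∘ h.codChart) (π x) hdom h1
  · have hc : ContinuousAt (fun b => u (h.codChart b)) (π x) :=
      hu.continuous.continuousAt.comp (h.codChart.continuousAt hπx)
    filter_upwards [hc.preimage_mem_nhds (by
        rw [hux]; exact h.domChart.open_target.mem_nhds (h.domChart.map_source hx)),
      h.codChart.open_source.mem_nhds hπx] with b hb hb'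
    have h1 := hw _ hb
    simp only [u, ContinuousLinearEquiv.apply_symm_apply] at h1
    refine h.codChart.injOn (h.source_subset_preimage_source (h.domChart.map_target hb)) hb' h1

theorem isOpenMap_of_isSubmersion {π : T → B}
    (hπ : Manifold.IsSubmersion 𝓘(ℝ, ET) 𝓘(ℝ, EB) ∞ π) : IsOpenMap π := by
  refine IsOpenMap.of_nhds_le fun x => ?_
  obtain ⟨s, hsx, hsm, hsec⟩ := exists_local_section hπ x
  intro O hO
  have h1 : s ⁻¹' (π ⁻¹' O) ∈ 𝓝 (π x) :=
    hsm.continuousAt.preimage_mem_nhds (by rw [hsx]; exact hO)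
  filter_upwards [h1, hsec] with b hb hb'
  rw [← hb']
  exact hb

theorem isQuotientMap_of_isSubmersion {π : T → B}
    (hπ : Manifold.IsSubmersion 𝓘(ℝ, ET) 𝓘(ℝ, EB) ∞ π) (hs : Function.Surjective π) :
    Topology.IsQuotientMap π :=
  (isOpenMap_of_isSubmersion hπ).isQuotientMap hπ.contMDiff.continuous hs

/-- Locally `f = (f ∘ π) ∘ s` for a smooth section `s`. Applied to the identity between two
structures on the base, this gives their equality. -/
theorem contMDiff_of_comp_isSubmersion {π : T → B}
    (hπ : Manifold.IsSubmersion 𝓘(ℝ, ET) 𝓘(ℝ, EB) ∞ π) (hs : Function.Surjective π) {f : B → C}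
    (hf : ContMDiff 𝓘(ℝ, ET) 𝓘(ℝ, EC) ∞ (f ∘ π)) : ContMDiff 𝓘(ℝ, EB) 𝓘(ℝ, EC) ∞ f := by
  intro b
  obtain ⟨x, rfl⟩ := hs b
  obtain ⟨s, hsx, hsm, hsec⟩ := exists_local_section hπ x
  have h1 : ContMDiffAt 𝓘(ℝ, EB) 𝓘(ℝ, EC) ∞ ((f ∘ π) ∘ s) (π x) :=
    ContMDiffAt.comp (π x) (hf _) hsm
  refine h1.congr_of_eventuallyEq ?_
  filter_upwards [hsec] with b hb
  simp [hb]

/-- At most one smooth structure on `B` makes a surjective map `T → B` a submersion. -/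
theorem sameSmoothStructure_of_isSubmersion {E E' M : Type*} [NormedAddCommGroup E]
    [NormedSpace ℝ E] [NormedAddCommGroup E'] [NormedSpace ℝ E'] {π : T → M}
    (hs : Function.Surjective π) (t : TopologicalSpace M) (c : ChartedSpace E M)
    (t' : TopologicalSpace M) (c' : ChartedSpace E' M)
    (h : @Manifold.IsSubmersion ℝ E ET E ET _ _ _ _ _ _ _ 𝓘(ℝ, ET) 𝓘(ℝ, E) T M _ _ t c ∞ π)
    (h' : @Manifold.IsSubmersion ℝ E' ET E' ET _ _ _ _ _ _ _ 𝓘(ℝ, ET) 𝓘(ℝ, E') T M _ _ t' c' ∞ π) :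
    SameSmoothStructure t c t' c' := by
  refine ⟨?_, ?_, ?_⟩
  -- Both topologies are the quotient topology of `π`.
  · exact (@Topology.IsCoinducing.eq_coinduced _ _ _ t _ <| @Topology.IsQuotientMap.isCoinducing _ _ _ t _
      (@isQuotientMap_of_isSubmersion ET E T M _ _ _ _ _ _ t c π h hs)).trans
      (@Topology.IsCoinducing.eq_coinduced _ _ _ t' _ <| @Topology.IsQuotientMap.isCoinducing _ _ _ t' _
        (@isQuotientMap_of_isSubmersion ET E' T M _ _ _ _ _ _ t' c' π h' hs)).symm
  · exact @contMDiff_of_comp_isSubmersion ET E E' T M M _ _ _ _ _ _ _ _ t c t' c' π h hs id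
      (@Manifold.IsSubmersion.contMDiff _ _ _ _ _ _ _ _ _ _ _ _ _ _ _ _ _ _ t' c' _ _ h')
  · exact @contMDiff_of_comp_isSubmersion ET E' E T M M _ _ _ _ _ _ _ _ t' c' t c π h' hs id
      (@Manifold.IsSubmersion.contMDiff _ _ _ _ _ _ _ _ _ _ _ _ _ _ _ _ _ _ t c _ _ h)

end Submersions

/-! ### The manifold of regular velocities and its adapted charts -/

section VelocityManifold

variable {r n m N : ℕ} {X : Type*} [TopologicalSpace X] [ChartedSpace (EuclideanSpace ℝ (Fin N)) X]

/-- A map into a chart domain that is an immersion at `0` in the chart comes from an immersion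
germ. -/
theorem exists_immersionGerm (ψ : SmoothChart N X)
    {f : EuclideanSpace ℝ (Fin n) → EuclideanSpace ℝ (Fin N)}
    {U : Set (EuclideanSpace ℝ (Fin n))} (hU : IsOpen U) (h0 : 0 ∈ U) (hf : ContDiffOn ℝ ∞ f U)
    (hf0 : f 0 ∈ ψ.1.target) (hinj : Function.Injective (fderiv ℝ f 0)) :
    ∃ γ : ImmersionGerm n N X, γ.toFun 0 ∈ ψ.1.source ∧ ψ.1 ∘ γ.toFun =ᶠ[𝓝 0] f := by
  let V : Set (EuclideanSpace ℝ (Fin n)) :=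
    (U ∩ f ⁻¹' ψ.1.target) ∩ (U ∩ fderiv ℝ f ⁻¹' {L | Function.Injective L})
  have hV : IsOpen V := (hf.continuousOn.isOpen_inter_preimage hU ψ.1.open_target).inter
    ((hf.continuousOn_fderiv_of_isOpen hU (by simp)).isOpen_inter_preimage hU
      ContinuousLinearMap.isOpen_injective)
  have h0V : (0 : EuclideanSpace ℝ (Fin n)) ∈ V := ⟨⟨h0, hf0⟩, h0, hinj⟩
  have hs : ContMDiffOn (𝓡 n) (𝓡 N) ∞ (ψ.1.symm ∘ f) V :=
    (contMDiffOn_symm_of_mem_maximalAtlas ψ.2).comp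
      (hf.contMDiffOn.mono fun t ht => ht.1.1) fun t ht => ht.1.2
  refine ⟨⟨ψ.1.symm ∘ f, V, hV, h0V, hs, fun t ht => ?_⟩, ψ.1.map_target hf0, ?_⟩
  · have h1 : MDifferentiableAt (𝓡 n) (𝓡 N) (ψ.1.symm ∘ f) t :=
      (hs.contMDiffAt (hV.mem_nhds ht)).mdifferentiableAt (by simp)
    have h2 : MDifferentiableAt (𝓡 N) (𝓡 N) ψ.1 ((ψ.1.symm ∘ f) t) :=
      ((contMDiffOn_of_mem_maximalAtlas ψ.2).contMDiffAt
        (ψ.1.open_source.mem_nhds (ψ.1.map_target ht.1.2))).mdifferentiableAt (by simp)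
    have h4 : mfderiv (𝓡 n) (𝓡 N) (ψ.1 ∘ (ψ.1.symm ∘ f)) t = mfderiv (𝓡 n) (𝓡 N) f t := by
      apply Filter.EventuallyEq.mfderiv_eq
      filter_upwards [hV.mem_nhds ht] with s hs
      exact ψ.1.right_inv hs.1.2
    rw [mfderiv_comp (I' := 𝓡 N) t h2 h1] at h4
    have h6 : Function.Injective (mfderiv (𝓡 n) (𝓡 N) f t) := by
      rw [mfderiv_eq_fderiv]; exact ht.2.2
    rw [← h4] at h6
    exact Function.Injective.of_comp h6
  · filter_upwards [hV.mem_nhds h0V] with s hs using ψ.1.right_inv hs.1.2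

theorem contDiffOn_transition (ψ ψ' : SmoothChart N X) :
    ContDiffOn ℝ ∞ (ψ'.1 ∘ ψ.1.symm) (ψ.1.symm ≫ₕ ψ'.1).source := by
  intro y hy
  rw [OpenPartialHomeomorph.trans_source, OpenPartialHomeomorph.symm_source] at hy
  have := transition_contDiffAt ψ ψ' (ψ.1.map_target hy.1) hy.2
  rw [ψ.1.right_inv hy.1] at this
  exact this.contDiffWithinAt

variable [IsManifold (𝓡 N) ∞ X]

namespace RegularVelocity

theorem coords_mk_eq_jetAt (ψ : SmoothChart N X) (γ : ImmersionGerm n N X)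
    (h : γ.toFun 0 ∈ ψ.1.source) :
    coords ψ (mk γ : RegularVelocity r n N X) = jetAt r (ψ.1 ∘ γ.toFun) 0 :=
  funext fun p => coords_mk ψ γ h p

theorem vec_coords_zero (ψ : SmoothChart N X) (v : RegularVelocity r n N X)
    (h : v.target ∈ ψ.1.source) : vec (coords ψ v) 0 = ψ.1 v.target := by
  obtain ⟨γ, rfl⟩ := exists_rep v
  exact vec_coords ψ γ h [] (Nat.zero_le _)

/-- The coordinate changes between associated charts are smooth. -/
theorem exists_contDiffAt_transition (r n : ℕ) (ψ ψ' : SmoothChart N X) :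
    ∃ T : JetSpace r n N → JetSpace r n N, ∀ v : RegularVelocity r n N X,
      v.target ∈ ψ.1.source → v.target ∈ ψ'.1.source →
        ContDiffAt ℝ ∞ T (coords ψ v) ∧ coords ψ' v = T (coords ψ v) := by
  obtain ⟨T, hT, hTc⟩ := exists_compJet r n N N
  -- Composition with the jet of the transition map, taken at the base point `vec c 0`, which is
  -- itself part of `c`.
  refine ⟨fun c => T (jetAt r (ψ'.1 ∘ ψ.1.symm) (vec c 0), c), fun v hv hv' => ⟨?_, ?_⟩⟩
  · have h1 : ContDiffAt ℝ ∞ (ψ'.1 ∘ ψ.1.symm) (vec (coords ψ v) 0) := by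
      rw [vec_coords_zero ψ v hv]
      exact transition_contDiffAt ψ ψ' hv hv'
    exact hT.contDiffAt.comp _ ((ContDiffAt.comp (f := fun c : JetSpace r n N => vec c 0) _
      (contDiffAt_jetAt h1) (contDiff_vec 0).contDiffAt).prodMk contDiffAt_id)
  · beta_reduce
    rw [vec_coords_zero ψ v hv]
    obtain ⟨γ, rfl⟩ := exists_rep v
    obtain ⟨U, hU, h0, -, hs, -⟩ := γ.exists_contDiffOn ψ hv
    rw [coords_mk_eq_jetAt ψ γ hv, coords_mk_eq_jetAt ψ' γ hv',
      jetAt_congr (transition_eventuallyEq γ ψ ψ' hv)]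
    refine (hTc (ψ.1 ∘ γ.toFun) (ψ'.1 ∘ ψ.1.symm) U (ψ.1.symm ≫ₕ ψ'.1).source hU hs
      (ψ.1.symm ≫ₕ ψ'.1).open_source (contDiffOn_transition ψ ψ') 0 h0 ?_).symm
    rw [OpenPartialHomeomorph.trans_source, OpenPartialHomeomorph.symm_source]
    refine ⟨ψ.1.map_source hv, ?_⟩
    change ψ.1.symm (ψ.1 (γ.toFun 0)) ∈ ψ'.1.source
    have e : ψ.1.symm (ψ.1 (γ.toFun 0)) = γ.toFun 0 := ψ.1.left_inv hv
    rw [e]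
    exact hv'

theorem exists_eq_coords_of_mem_atlas
    {e : OpenPartialHomeomorph (RegularVelocity r n N X) (JetSpace r n N)}
    (he : e ∈ atlas (JetSpace r n N) (RegularVelocity r n N X)) :
    ∃ ψ : SmoothChart N X, e.source = {v | v.target ∈ ψ.1.source} ∧
      Set.EqOn e (coords ψ) e.source := by
  obtain ⟨_, ⟨e', rfl⟩, h⟩ := he
  obtain ⟨_, ⟨he', rfl⟩, h⟩ := h
  rw [Set.mem_singleton_iff] at h
  subst h
  exact he'

instance : IsManifold 𝓘(ℝ, JetSpace r n N) ∞ (RegularVelocity r n N X) := by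
  refine isManifold_of_contDiffOn _ _ _ ?_
  intro e e' he he'
  obtain ⟨ψ, hs, hψ⟩ := exists_eq_coords_of_mem_atlas he
  obtain ⟨ψ', hs', hψ'⟩ := exists_eq_coords_of_mem_atlas he'
  simp only [modelWithCornersSelf_coe, modelWithCornersSelf_coe_symm, Function.id_comp,
    Function.comp_id, Set.preimage_id, Set.range_id, Set.inter_univ]
  obtain ⟨T, hT⟩ := exists_contDiffAt_transition r n ψ ψ'
  have key : ∀ c ∈ (e.symm ≫ₕ e').source, ContDiffAt ℝ ∞ T c ∧ (e.symm ≫ₕ e') c = T c := by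
    intro c hc
    rw [OpenPartialHomeomorph.trans_source, OpenPartialHomeomorph.symm_source] at hc
    have h1 := e.map_target hc.1
    have h2 := hT (e.symm c) (by rw [hs] at h1; exact h1) (by
      have := hc.2
      rw [Set.mem_preimage, hs'] at this
      exact this)
    rw [← hψ h1, e.right_inv hc.1, ← hψ' hc.2] at h2
    exact h2
  intro c hc
  refine ((key c hc).1.congr_of_eventuallyEq ?_).contDiffWithinAt
  filter_upwards [(e.symm ≫ₕ e').open_source.mem_nhds hc] with d hd using (key d hd).2

/-- The associated chart of a chart of `X`. -/
theorem exists_associatedChart [Nonempty (RegularVelocity r n N X)] (ψ : SmoothChart N X) :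
    ∃ e ∈ atlas (JetSpace r n N) (RegularVelocity r n N X),
      e.source = {v | v.target ∈ ψ.1.source} ∧ ∀ v, e v = coords ψ v := by
  have he : (coords_injOn (r := r) (n := n) ψ).toPartialEquiv ∈ (core r n N X).atlas :=
    ⟨ψ, rfl, fun _ _ => rfl⟩
  exact ⟨(core r n N X).openPartialHomeomorph _ he,
    Set.mem_iUnion.2 ⟨_, Set.mem_iUnion.2 ⟨he, rfl⟩⟩, rfl, fun _ => rfl⟩

theorem isOpen_target_preimage (ψ : SmoothChart N X) :
    IsOpen {v : RegularVelocity r n N X | v.target ∈ ψ.1.source} := by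
  rcases isEmpty_or_nonempty (RegularVelocity r n N X) with h | h
  · convert isOpen_empty
    exact Set.eq_empty_of_forall_notMem fun v => h.elim v
  · obtain ⟨e, -, hs, -⟩ := exists_associatedChart (r := r) (n := n) ψ
    rw [← hs]
    exact e.open_source

theorem contMDiffAt_coords (ψ : SmoothChart N X) {v : RegularVelocity r n N X}
    (hv : v.target ∈ ψ.1.source) :
    ContMDiffAt 𝓘(ℝ, JetSpace r n N) 𝓘(ℝ, JetSpace r n N) ∞ (coords ψ) v := by
  have : Nonempty (RegularVelocity r n N X) := ⟨v⟩
  obtain ⟨e, he, hs, hψ⟩ := exists_associatedChart (r := r) (n := n) ψ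
  rw [← funext hψ]
  exact contMDiffAt_of_mem_maximalAtlas (IsManifold.subset_maximalAtlas he) (by rw [hs]; exact hv)

theorem contMDiffAt_of_coords {E H M : Type*} [NormedAddCommGroup E] [NormedSpace ℝ E]
    [TopologicalSpace H] [TopologicalSpace M] [ChartedSpace H M] {I : ModelWithCorners ℝ E H}
    (ψ : SmoothChart N X) {f : M → RegularVelocity r n N X} {x : M}
    (hf : ∀ᶠ y in 𝓝 x, (f y).target ∈ ψ.1.source)
    (h : ContMDiffAt I 𝓘(ℝ, JetSpace r n N) ∞ (fun y => coords ψ (f y)) x) :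
    ContMDiffAt I 𝓘(ℝ, JetSpace r n N) ∞ f x := by
  have : Nonempty (RegularVelocity r n N X) := ⟨f x⟩
  obtain ⟨e, he, hs, hψ⟩ := exists_associatedChart (r := r) (n := n) ψ
  have hx : f x ∈ e.source := by rw [hs]; exact hf.self_of_nhds
  have h1 := contMDiffAt_symm_of_mem_maximalAtlas (I := 𝓘(ℝ, JetSpace r n N)) (n := ∞)
    (IsManifold.subset_maximalAtlas he) (e.map_source hx)
  rw [hψ] at h1
  refine (ContMDiffAt.comp x h1 h).congr_of_eventuallyEq ?_
  filter_upwards [hf] with y hy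
  rw [Function.comp_apply, ← hψ, e.left_inv (by rw [hs]; exact hy)]

/-- Near `v` the target is read off from the coordinates of order zero in a chart. -/
theorem continuous_target : Continuous (target : RegularVelocity r n N X → X) := by
  rw [continuous_iff_continuousAt]
  intro v
  let ψ : SmoothChart N X := ⟨_, IsManifold.chart_mem_maximalAtlas v.target⟩
  have hv : v.target ∈ ψ.1.source := mem_chart_source _ _
  have h1 : ContinuousAt (fun w : RegularVelocity r n N X => ψ.1.symm (vec (coords ψ w) 0)) v := by
    refine ContinuousAt.comp (f := fun w : RegularVelocity r n N X => vec (coords ψ w) 0) ?_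
      ((continuous_vec 0).continuousAt.comp (contMDiffAt_coords ψ hv).continuousAt)
    rw [vec_coords_zero ψ v hv]
    exact ψ.1.continuousAt_symm (ψ.1.map_source hv)
  refine h1.congr ?_
  filter_upwards [(isOpen_target_preimage ψ).mem_nhds hv] with w hw
  rw [vec_coords_zero ψ w hw, ψ.1.left_inv hw]

/-- Countably many chart domains cover `X`. The associated domains are open, cover the velocities,
and are homeomorphic to subsets of a finite-dimensional space. -/
instance [SecondCountableTopology X] : SecondCountableTopology (RegularVelocity r n N X) := by
  obtain ⟨s, hs, hsu⟩ := TopologicalSpace.countable_cover_nhds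
    (fun x : X => chart_source_mem_nhds (EuclideanSpace ℝ (Fin N)) x)
  have hcov : ∀ x : X, ∃ O : Set (RegularVelocity r n N X), O =
      {v | v.target ∈ (chartAt (EuclideanSpace ℝ (Fin N)) x).source} ∧ IsOpen O ∧
      SecondCountableTopology O := by
    intro x
    let ψ : SmoothChart N X := ⟨_, IsManifold.chart_mem_maximalAtlas x⟩
    refine ⟨_, rfl, isOpen_target_preimage ψ, ?_⟩
    rcases isEmpty_or_nonempty (RegularVelocity r n N X) with h | h
    · infer_instance
    · obtain ⟨e, -, hs, -⟩ := exists_associatedChart (r := r) (n := n) ψ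
      change SecondCountableTopology {v : RegularVelocity r n N X | v.target ∈ ψ.1.source}
      rw [← hs]
      exact e.secondCountableTopology_source
  choose O hO hOo hO2 using hcov
  have : Countable s := hs
  refine TopologicalSpace.secondCountableTopology_of_countable_cover
    (U := fun x : s => O x.1) (fun x => hOo x.1) ?_
  refine Set.eq_univ_of_forall fun v => ?_
  have hv : v.target ∈ ⋃ x ∈ s, (chartAt (EuclideanSpace ℝ (Fin N)) x).source := by
    rw [hsu]; trivial
  simp only [Set.mem_iUnion] at hv ⊢
  obtain ⟨x, hx, h⟩ := hv
  exact ⟨⟨x, hx⟩, by rw [hO]; exact h⟩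

end RegularVelocity

open RegularVelocity

theorem GraphForm.injective_fderiv_fun {S : Fin n ⊕ Fin m ≃ Fin N}
    {f : EuclideanSpace ℝ (Fin n) → EuclideanSpace ℝ (Fin N)}
    {a : OpenPartialHomeomorph (EuclideanSpace ℝ (Fin n)) (EuclideanSpace ℝ (Fin n))}
    {h : EuclideanSpace ℝ (Fin n) → EuclideanSpace ℝ (Fin m)} (H : GraphForm S f a h)
    {t : EuclideanSpace ℝ (Fin n)} (ht : t ∈ a.source) : Function.Injective (fderiv ℝ f t) := by
  have h1 := H.injective_fderiv ht
  rw [← (H.selectL_eventuallyEq ht).fderiv_eq, ((selectL _).hasFDerivAt.comp t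
    ((H.contDiffAt_fun ht).differentiableAt (by simp)).hasFDerivAt).fderiv,
    ContinuousLinearMap.coe_comp] at h1
  exact Function.Injective.of_comp h1

theorem exists_rep_graphForm (ψ : SmoothChart N X) (S : Fin n ⊕ Fin m ≃ Fin N)
    {v : RegularVelocity r n N X} (hv : v ∈ adaptedDomain r ψ S) :
    ∃ γ a h, mk γ = v ∧ γ.toFun 0 ∈ ψ.1.source ∧ GraphForm S (ψ.1 ∘ γ.toFun) a h ∧
      Set.MapsTo γ.toFun a.source ψ.1.source := by
  obtain ⟨γ, rfl, hγ, hdet⟩ := hv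
  obtain ⟨U, hU, h0, hm, hs, -⟩ := γ.exists_contDiffOn ψ hγ
  obtain ⟨a, h, H, haU⟩ := exists_graphForm S hU h0 hs hdet
  exact ⟨γ, a, h, rfl, hγ, H, hm.mono_left haU⟩

/-- The condition on some representative becomes a condition on the jet. For `r = 0` nothing remains
beyond the target, because the first derivatives of a representative can be changed at will; the
converse therefore constructs a new representative. -/
theorem mem_adaptedDomain_iff (ψ : SmoothChart N X) (S : Fin n ⊕ Fin m ≃ Fin N)
    (v : RegularVelocity r n N X) :
    v ∈ adaptedDomain r ψ S ↔ v.target ∈ ψ.1.source ∧ IsAdapted S (coords ψ v) := by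
  constructor
  · intro hv
    obtain ⟨γ, a, h, rfl, hγ, H, -⟩ := exists_rep_graphForm ψ S hv
    exact ⟨hγ, by rw [coords_mk_eq_jetAt ψ γ hγ]; exact H.isAdapted⟩
  · rintro ⟨hv, ha⟩
    obtain ⟨f, a, h, H, hf, hfv⟩ := exists_graphForm_of_isAdapted S ha
    have hf0 : f 0 = ψ.1 v.target := by
      rw [← vec_coords_zero ψ v hv, ← hfv]
      exact (vec_jetAt_of_contDiffOn isOpen_univ hf.contDiffOn (Set.mem_univ 0)
        (l := []) (Nat.zero_le _)).symm
    obtain ⟨γ, hγ, hγf⟩ := exists_immersionGerm ψ isOpen_univ (Set.mem_univ _) hf.contDiffOn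
      (by rw [hf0]; exact ψ.1.map_source hv) (H.injective_fderiv_fun H.zero_mem)
    refine ⟨γ, coords_injOn ψ hγ hv ?_, hγ, ?_⟩
    · rw [coords_mk_eq_jetAt ψ γ hγ, jetAt_congr hγf, hfv]
    · have : (Matrix.of fun k j : Fin n => pd [j] (ψ.1 ∘ γ.toFun) 0 (S (Sum.inl k))) =
          Matrix.of fun k j : Fin n => pd [j] f 0 (S (Sum.inl k)) := by
        ext k j
        simp only [Matrix.of_apply, (pd_congr [j] hγf).self_of_nhds]
      rw [this]
      exact H.det_ne_zero H.zero_mem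

/-- The chart `Φ` with the coordinates `(x^k_J, y^σ_J)`. -/
theorem exists_adaptedChart [Nonempty (RegularVelocity r n N X)] (ψ : SmoothChart N X)
    (S : Fin n ⊕ Fin m ≃ Fin N) :
    ∃ Φ ∈ IsManifold.maximalAtlas 𝓘(ℝ, JetSpace r n N) ∞ (RegularVelocity r n N X),
      Φ.source = adaptedDomain r ψ S ∧ ∀ v, Φ v = adaptedCoords S (coords ψ v) := by
  obtain ⟨e, he, hes, hec⟩ := exists_associatedChart (r := r) (n := n) ψ
  obtain ⟨Ψ, hs, hΨ, h1, h2⟩ := exists_adaptedHomeo r S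
  have he' := IsManifold.subset_maximalAtlas (I := 𝓘(ℝ, JetSpace r n N)) (n := ∞) he
  refine ⟨e ≫ₕ Ψ, ?_, ?_, fun v => ?_⟩
  · rw [IsManifold.mem_maximalAtlas_iff_contMDiffOn]
    constructor
    · rw [OpenPartialHomeomorph.trans_source]
      exact h1.contMDiffOn.comp ((contMDiffOn_of_mem_maximalAtlas he').mono
        Set.inter_subset_left) Set.inter_subset_right
    · rw [OpenPartialHomeomorph.trans_target]
      exact (contMDiffOn_symm_of_mem_maximalAtlas he').comp (h2.contMDiffOn.mono
        Set.inter_subset_left) Set.inter_subset_right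
  · ext v
    rw [OpenPartialHomeomorph.trans_source, mem_adaptedDomain_iff, hes, hs]
    simp only [Set.mem_inter_iff, Set.mem_ofPred_eq, Set.mem_preimage, hec]
  · rw [OpenPartialHomeomorph.coe_trans, Function.comp_apply, hΨ, hec]

end VelocityManifold

/-! ### The differential group as a Lie group -/

section DifferentialGroupManifold

variable {r n : ℕ}

namespace DifferentialGroup

/-- The family `(a^i_J)` extended by `a^i = 0`. -/
def extend (c : CoordSpace r n) : JetSpace r n n := fun p =>
  if h : 1 ≤ p.2.1.card then c (p.1, ⟨p.2.1, h, p.2.2⟩) else 0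

/-- The coordinates of positive order. -/
def restrict (c : JetSpace r n n) : CoordSpace r n := fun p => c (p.1, ⟨p.2.1, p.2.2.2⟩)

theorem contDiff_extend : ContDiff ℝ ∞ (extend : CoordSpace r n → JetSpace r n n) := by
  refine contDiff_pi.2 fun p => ?_
  unfold extend
  split_ifs
  · fun_prop
  · exact contDiff_const

theorem contDiff_restrict : ContDiff ℝ ∞ (restrict : JetSpace r n n → CoordSpace r n) := by
  unfold restrict
  fun_prop

theorem coords_mk_eq_restrict (α : DiffGerm n) :
    coords (mk α : DifferentialGroup r n) = restrict (jetAt r α.toHomeo 0) := rfl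

theorem extend_coords_mk (α : DiffGerm n) :
    extend (coords (mk α : DifferentialGroup r n)) = jetAt r α.toHomeo 0 := by
  funext p
  unfold extend
  split_ifs with h
  · rfl
  · have hp : p.2.1 = 0 := by
      rw [← Multiset.card_eq_zero]; omega
    simp only [jetAt, hp, Multiset.sort_zero, pd, α.map_zero]
    rfl

theorem exists_eq_coords_of_mem_atlas
    {e : OpenPartialHomeomorph (DifferentialGroup r n) (CoordSpace r n)}
    (he : e ∈ atlas (CoordSpace r n) (DifferentialGroup r n)) :
    e.source = Set.univ ∧ ∀ a, e a = coords a := by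
  obtain ⟨_, ⟨e', rfl⟩, h⟩ := he
  obtain ⟨_, ⟨he', rfl⟩, h⟩ := h
  rw [Set.mem_singleton_iff] at h
  subst h
  exact he'

instance : IsManifold 𝓘(ℝ, CoordSpace r n) ∞ (DifferentialGroup r n) := by
  refine isManifold_of_contDiffOn _ _ _ ?_
  intro e e' he he'
  obtain ⟨-, hc⟩ := exists_eq_coords_of_mem_atlas he
  obtain ⟨-, hc'⟩ := exists_eq_coords_of_mem_atlas he'
  simp only [modelWithCornersSelf_coe, modelWithCornersSelf_coe_symm, Function.id_comp,
    Function.comp_id, Set.preimage_id, Set.range_id, Set.inter_univ]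
  refine contDiffOn_id.congr fun c hc1 => ?_
  rw [OpenPartialHomeomorph.trans_source, OpenPartialHomeomorph.symm_source] at hc1
  rw [OpenPartialHomeomorph.coe_trans, Function.comp_apply, hc', ← hc, e.right_inv hc1.1, id]

/-- The global chart. -/
theorem exists_coordChart (r n : ℕ) :
    ∃ e ∈ IsManifold.maximalAtlas 𝓘(ℝ, CoordSpace r n) ∞ (DifferentialGroup r n),
      e.source = Set.univ ∧ ∀ a, e a = coords a :=
  ⟨_, IsManifold.chart_mem_maximalAtlas 1,
    exists_eq_coords_of_mem_atlas (chart_mem_atlas (CoordSpace r n) (1 : DifferentialGroup r n))⟩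

theorem contMDiff_coords :
    ContMDiff 𝓘(ℝ, CoordSpace r n) 𝓘(ℝ, CoordSpace r n) ∞
      (coords : DifferentialGroup r n → CoordSpace r n) := by
  obtain ⟨e, he, hs, hc⟩ := exists_coordChart r n
  rw [← funext hc]
  exact fun a => contMDiffAt_of_mem_maximalAtlas he (by rw [hs]; trivial)

theorem contMDiff_of_coords {E H M : Type*} [NormedAddCommGroup E] [NormedSpace ℝ E]
    [TopologicalSpace H] [TopologicalSpace M] [ChartedSpace H M] {I : ModelWithCorners ℝ E H}
    {f : M → DifferentialGroup r n}
    (h : ContMDiff I 𝓘(ℝ, CoordSpace r n) ∞ fun y => coords (f y)) :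
    ContMDiff I 𝓘(ℝ, CoordSpace r n) ∞ f := by
  obtain ⟨e, he, hs, hc⟩ := exists_coordChart r n
  intro x
  have hx : ∀ y, f y ∈ e.source := fun y => by rw [hs]; trivial
  have h1 := contMDiffAt_symm_of_mem_maximalAtlas he (e.map_source (hx x))
  rw [hc] at h1
  refine (ContMDiffAt.comp x h1 (h x)).congr_of_eventuallyEq (Filter.Eventually.of_forall ?_)
  intro y
  rw [Function.comp_apply, ← hc, e.left_inv (hx y)]

theorem exists_coords_mul (r n : ℕ) : ∃ T : CoordSpace r n × CoordSpace r n → CoordSpace r n,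
    ContDiff ℝ ∞ T ∧ ∀ a b : DifferentialGroup r n, coords (a * b) = T (coords a, coords b) := by
  obtain ⟨T, hT, hTc⟩ := exists_compJet r n n n
  refine ⟨fun q => restrict (T (extend q.1, extend q.2)), contDiff_restrict.comp (hT.comp
    ((contDiff_extend.comp contDiff_fst).prodMk (contDiff_extend.comp contDiff_snd))), ?_⟩
  intro a b
  obtain ⟨α, rfl⟩ := exists_rep a
  obtain ⟨β, rfl⟩ := exists_rep b
  have h := hTc β.toHomeo α.toHomeo β.toHomeo.source α.toHomeo.source β.toHomeo.open_source
    ((DiffGerm.mem_contDiffGroupoid_iff _).1 β.smooth).1 α.toHomeo.open_source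
    ((DiffGerm.mem_contDiffGroupoid_iff _).1 α.smooth).1 0 β.zero_mem
    (by rw [β.map_zero]; exact α.zero_mem)
  rw [β.map_zero] at h
  beta_reduce
  rw [extend_coords_mk, extend_coords_mk, h, mk_mul_mk]
  rfl

/-- The coordinates of the inverse are adapted coordinates of the jet of `t ↦ (α(t), t)`. -/
theorem exists_coords_inv (r n : ℕ) : ∃ T : CoordSpace r n → CoordSpace r n,
    ∀ a : DifferentialGroup r n, ContDiffAt ℝ ∞ T (coords a) ∧ coords a⁻¹ = T (coords a) := by
  let S : Fin n ⊕ Fin n ≃ Fin (n + n) := finSumFinEquiv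
  -- At the coordinates of `α` this is the jet of `t ↦ (α t, t)`, the graph of `α⁻¹` reparametrized
  -- by `α`. Its functions `y_J` are thus the derivatives of `α⁻¹` at `α 0 = 0`.
  let u : CoordSpace r n → JetSpace r n (n + n) := fun c => joinJet S (extend c) (jetAt r id 0)
  have hu : ContDiff ℝ ∞ u := (contDiff_joinJet S).comp (contDiff_extend.prodMk
    (contDiff_const (c := (jetAt r id 0 : JetSpace r n n))))
  refine ⟨fun c => restrict (yPart S (adaptedCoords S (u c))), fun a => ?_⟩
  obtain ⟨α, rfl⟩ := exists_rep a
  obtain ⟨hα, hα'⟩ := (DiffGerm.mem_contDiffGroupoid_iff _).1 α.smooth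
  -- The second `hα'` chooses `α⁻¹` itself as the graph function.
  obtain ⟨f, H⟩ := exists_graphForm_of_graph S α.zero_mem hα hα' hα'
  have hf : u (coords (mk α)) = jetAt r f 0 := by
    apply jetSpace_ext S
    · rw [xPart_joinJet, H.xPart_jetAt, extend_coords_mk]
    · rw [yPart_joinJet, H.yPart_jetAt]
      refine (jetAt_congr ?_).symm
      filter_upwards [α.toHomeo.open_source.mem_nhds α.zero_mem] with t ht
      exact α.toHomeo.left_inv ht
  constructor
  · have h1 : ContDiffAt ℝ ∞ (adaptedCoords S) (u (coords (mk α : DifferentialGroup r n))) :=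
      (contDiffOn_adaptedCoords S).contDiffAt
        ((isOpen_isAdapted S).mem_nhds (by rw [hf]; exact H.isAdapted))
    exact (contDiff_restrict.comp (contDiff_yPart S)).contDiffAt.comp _
      (h1.comp _ hu.contDiffAt)
  · beta_reduce
    rw [hf, H.yPart_adaptedCoords, α.map_zero]
    rfl

instance : LieGroup 𝓘(ℝ, CoordSpace r n) ∞ (DifferentialGroup r n) where
  contMDiff_mul := by
    obtain ⟨T, hT, hTc⟩ := exists_coords_mul r n
    refine contMDiff_of_coords ?_
    simp only [hTc]
    exact hT.contMDiff.comp
      ((contMDiff_coords.comp contMDiff_fst).prodMk_space (contMDiff_coords.comp contMDiff_snd))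
  contMDiff_inv := by
    obtain ⟨T, hT⟩ := exists_coords_inv r n
    refine contMDiff_of_coords ?_
    simp only [fun a => (hT a).2]
    intro a
    exact ContMDiffAt.comp a (hT a).1.contMDiffAt (contMDiff_coords a)

end DifferentialGroup

end DifferentialGroupManifold

/-! ### Smoothness of the action and its orbits in adapted coordinates -/

section ActionSmooth

variable {r n m N : ℕ} {X : Type*} [TopologicalSpace X] [ChartedSpace (EuclideanSpace ℝ (Fin N)) X]
  [IsManifold (𝓡 N) ∞ X]

open RegularVelocity

theorem op_smul_mk (γ : ImmersionGerm n N X) (α : DiffGerm n) :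
    MulOpposite.op (DifferentialGroup.mk α : DifferentialGroup r n) •
      (mk γ : RegularVelocity r n N X) = mk (γ.comp α) := rfl

theorem target_op_smul (v : RegularVelocity r n N X) (a : DifferentialGroup r n) :
    (MulOpposite.op a • v).target = v.target := by
  obtain ⟨γ, rfl⟩ := exists_rep v
  obtain ⟨α, rfl⟩ := DifferentialGroup.exists_rep a
  change γ.toFun (α.toHomeo 0) = γ.toFun 0
  rw [α.map_zero]

/-- The action keeps the target, so one chart of `X` serves both sides, and there the action is
composition of jets. -/
theorem exists_coords_op_smul (r n : ℕ) (ψ : SmoothChart N X) :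
    ∃ T : JetSpace r n N × DifferentialGroup.CoordSpace r n → JetSpace r n N, ContDiff ℝ ∞ T ∧
      ∀ (v : RegularVelocity r n N X) (a : DifferentialGroup r n), v.target ∈ ψ.1.source →
        coords ψ (MulOpposite.op a • v) = T (coords ψ v, a.coords) := by
  obtain ⟨T, hT, hTc⟩ := exists_compJet r n n N
  refine ⟨fun q => T (q.1, DifferentialGroup.extend q.2), hT.comp (contDiff_fst.prodMk
    (DifferentialGroup.contDiff_extend.comp contDiff_snd)), fun v a hv => ?_⟩
  have hva : (MulOpposite.op a • v).target ∈ ψ.1.source := by rwa [target_op_smul]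
  obtain ⟨γ, rfl⟩ := exists_rep v
  obtain ⟨α, rfl⟩ := DifferentialGroup.exists_rep a
  obtain ⟨U, hU, h0, -, hs, -⟩ := γ.exists_contDiffOn ψ hv
  rw [op_smul_mk] at hva ⊢
  have h := hTc α.toHomeo (ψ.1 ∘ γ.toFun) α.toHomeo.source U α.toHomeo.open_source
    ((DiffGerm.mem_contDiffGroupoid_iff _).1 α.smooth).1 hU hs 0 α.zero_mem
    (by rw [α.map_zero]; exact h0)
  rw [α.map_zero] at h
  beta_reduce
  rw [coords_mk_eq_jetAt ψ γ hv, coords_mk_eq_jetAt ψ _ hva, DifferentialGroup.extend_coords_mk, h]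
  rfl

theorem contMDiff_op_smul :
    ContMDiff (𝓘(ℝ, JetSpace r n N).prod 𝓘(ℝ, DifferentialGroup.CoordSpace r n))
      𝓘(ℝ, JetSpace r n N) ∞
      fun p : RegularVelocity r n N X × DifferentialGroup r n => MulOpposite.op p.2 • p.1 := by
  rintro ⟨v, a⟩
  let ψ : SmoothChart N X := ⟨_, IsManifold.chart_mem_maximalAtlas v.target⟩
  have hv : v.target ∈ ψ.1.source := mem_chart_source _ _
  have hev : ∀ᶠ p : RegularVelocity r n N X × DifferentialGroup r n in 𝓝 (v, a),
      p.1.target ∈ ψ.1.source :=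
    ((isOpen_target_preimage ψ).preimage continuous_fst).mem_nhds hv
  obtain ⟨T, hT, hTc⟩ := exists_coords_op_smul r n ψ
  refine contMDiffAt_of_coords ψ ?_ ?_
  · filter_upwards [hev] with p hp
    rwa [target_op_smul]
  · have h1 : ContMDiffAt (𝓘(ℝ, JetSpace r n N).prod 𝓘(ℝ, DifferentialGroup.CoordSpace r n))
        𝓘(ℝ, JetSpace r n N) ∞ (fun p : RegularVelocity r n N X × DifferentialGroup r n =>
          T (coords ψ p.1, p.2.coords)) (v, a) :=
      ContMDiffAt.comp (v, a) (g := T)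
        (f := fun p : RegularVelocity r n N X × DifferentialGroup r n =>
          (coords ψ p.1, p.2.coords)) hT.contMDiff.contMDiffAt
        ((ContMDiffAt.comp (v, a) (contMDiffAt_coords ψ hv) contMDiffAt_fst).prodMk_space
          (ContMDiffAt.comp (v, a) DifferentialGroup.contMDiff_coords.contMDiffAt
            contMDiffAt_snd))
    refine h1.congr_of_eventuallyEq ?_
    filter_upwards [hev] with p hp
    exact hTc _ _ hp

/-- If `f` is in graph form then so is `f ∘ α`, with the same graph. -/
theorem GraphForm.comp {S : Fin n ⊕ Fin m ≃ Fin N}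
    {f : EuclideanSpace ℝ (Fin n) → EuclideanSpace ℝ (Fin N)}
    {a : OpenPartialHomeomorph (EuclideanSpace ℝ (Fin n)) (EuclideanSpace ℝ (Fin n))}
    {h : EuclideanSpace ℝ (Fin n) → EuclideanSpace ℝ (Fin m)} (H : GraphForm S f a h)
    (α : DiffGerm n) : GraphForm S (f ∘ α.toHomeo) (α.toHomeo ≫ₕ a) h := by
  obtain ⟨hα, hα'⟩ := (DiffGerm.mem_contDiffGroupoid_iff _).1 α.smooth
  refine ⟨?_, ?_, ?_, ?_, ?_, ?_, ?_⟩
  · rw [OpenPartialHomeomorph.trans_source]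
    exact ⟨α.zero_mem, by rw [Set.mem_preimage, α.map_zero]; exact H.zero_mem⟩
  · rw [OpenPartialHomeomorph.trans_source]
    exact H.contDiffOn.comp (hα.mono Set.inter_subset_left) Set.inter_subset_right
  · rw [OpenPartialHomeomorph.trans_target]
    exact hα'.comp (H.contDiffOn_symm.mono Set.inter_subset_left) Set.inter_subset_right
  · rw [OpenPartialHomeomorph.trans_source]
    exact H.contDiffOn_fun.comp (hα.mono Set.inter_subset_left) Set.inter_subset_right
  · rw [OpenPartialHomeomorph.trans_target]
    exact H.contDiffOn_graph.mono Set.inter_subset_left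
  · intro t ht k
    rw [OpenPartialHomeomorph.trans_source] at ht
    exact H.x_eq _ ht.2 k
  · intro t ht σ
    rw [OpenPartialHomeomorph.trans_source] at ht
    exact H.y_eq _ ht.2 σ

/-- The adapted domains are invariant, and so are the functions `x^k`, `y^σ_J`. -/
theorem op_smul_mem_adaptedDomain (ψ : SmoothChart N X) (S : Fin n ⊕ Fin m ≃ Fin N)
    {v : RegularVelocity r n N X} (hv : v ∈ adaptedDomain r ψ S) (a : DifferentialGroup r n) :
    MulOpposite.op a • v ∈ adaptedDomain r ψ S ∧
      coordProj S (adaptedCoords S (coords ψ (MulOpposite.op a • v))) =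
        coordProj S (adaptedCoords S (coords ψ v)) := by
  obtain ⟨γ, b, h, rfl, hγ, H, -⟩ := exists_rep_graphForm ψ S hv
  obtain ⟨α, rfl⟩ := DifferentialGroup.exists_rep a
  have H' : GraphForm S (ψ.1 ∘ (γ.comp α).toFun) _ h := H.comp α
  have hγα : (γ.comp α).toFun 0 ∈ ψ.1.source := by
    change γ.toFun (α.toHomeo 0) ∈ _
    rwa [α.map_zero]
  have h0 : (α.toHomeo ≫ₕ b) 0 = b 0 := by
    rw [OpenPartialHomeomorph.coe_trans, Function.comp_apply, α.map_zero]
  rw [op_smul_mk]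
  refine ⟨(mem_adaptedDomain_iff ψ S _).2 ⟨hγα, ?_⟩, ?_⟩
  · rw [coords_mk_eq_jetAt ψ _ hγα]
    exact H'.isAdapted
  · rw [coords_mk_eq_jetAt ψ _ hγα, coords_mk_eq_jetAt ψ γ hγ]
    refine Prod.ext (funext fun k => ?_) ?_
    · change xPart S (adaptedCoords S _) (k, ⟨0, Nat.zero_le r⟩) =
        xPart S (adaptedCoords S _) (k, ⟨0, Nat.zero_le r⟩)
      rw [xPart_adaptedCoords, xPart_adaptedCoords, H.xPart_jetAt, H'.xPart_jetAt]
      simp only [jetAt, Multiset.sort_zero, pd, h0]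
    · change yPart S (adaptedCoords S _) = yPart S (adaptedCoords S _)
      rw [H.yPart_adaptedCoords, H'.yPart_adaptedCoords, h0]

/-- Velocities with the same coordinates `x^k`, `y^σ_J` lie in one orbit. -/
theorem exists_op_smul_eq (ψ : SmoothChart N X) (S : Fin n ⊕ Fin m ≃ Fin N)
    {v w : RegularVelocity r n N X} (hv : v ∈ adaptedDomain r ψ S) (hw : w ∈ adaptedDomain r ψ S)
    (hvw : coordProj S (adaptedCoords S (coords ψ v)) =
      coordProj S (adaptedCoords S (coords ψ w))) :
    ∃ a : DifferentialGroup r n, w = MulOpposite.op a • v := by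
  obtain ⟨γ, b, h, rfl, hγ, H, -⟩ := exists_rep_graphForm ψ S hv
  obtain ⟨δ, b', h', rfl, hδ, H', -⟩ := exists_rep_graphForm ψ S hw
  rw [coords_mk_eq_jetAt ψ γ hγ, coords_mk_eq_jetAt ψ δ hδ] at hvw
  have h0 : b 0 = b' 0 := by
    ext k
    have h1 : xPart S (adaptedCoords S (jetAt r (ψ.1 ∘ γ.toFun) 0)) (k, ⟨0, Nat.zero_le r⟩) =
        xPart S (adaptedCoords S (jetAt r (ψ.1 ∘ δ.toFun) 0)) (k, ⟨0, Nat.zero_le r⟩) :=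
      congrFun (congrArg Prod.fst hvw) k
    rw [xPart_adaptedCoords, xPart_adaptedCoords, H.xPart_jetAt, H'.xPart_jetAt] at h1
    simpa only [jetAt, Multiset.sort_zero, pd] using h1
  have hy : jetAt r h (b 0) = jetAt r h' (b' 0) := by
    rw [← H.yPart_adaptedCoords, ← H'.yPart_adaptedCoords]
    exact congrArg Prod.snd hvw
  -- The reparametrization `b⁻¹ ∘ b'` fixes `0` because `b 0 = b' 0`. After it, `γ ∘ α` is the graph
  -- of `h` parametrized by `b'`, so its `x`-part is that of `δ`.
  let α : DiffGerm n :=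
    { toHomeo := b' ≫ₕ b.symm
      smooth := (contDiffGroupoid ∞ (𝓡 n)).trans
        ((DiffGerm.mem_contDiffGroupoid_iff _).2 ⟨H'.contDiffOn, H'.contDiffOn_symm⟩)
        ((DiffGerm.mem_contDiffGroupoid_iff _).2 ⟨H.contDiffOn_symm, by
          rw [OpenPartialHomeomorph.symm_symm]; exact H.contDiffOn⟩)
      zero_mem := by
        rw [OpenPartialHomeomorph.trans_source]
        refine ⟨H'.zero_mem, ?_⟩
        rw [Set.mem_preimage, ← h0]
        exact b.map_source H.zero_mem
      map_zero := by
        rw [OpenPartialHomeomorph.coe_trans, Function.comp_apply, ← h0, b.left_inv H.zero_mem] }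
  have hα0 : (0 : EuclideanSpace ℝ (Fin n)) ∈ (b' ≫ₕ b.symm).source := α.zero_mem
  have H'' : GraphForm S (ψ.1 ∘ (γ.comp α).toFun) _ h := H.comp α
  have hγα : (γ.comp α).toFun 0 ∈ ψ.1.source := by
    change γ.toFun (α.toHomeo 0) ∈ _
    rwa [α.map_zero]
  have hev : (α.toHomeo ≫ₕ b : EuclideanSpace ℝ (Fin n) → _) =ᶠ[𝓝 0] b' := by
    filter_upwards [(b' ≫ₕ b.symm).open_source.mem_nhds hα0] with t ht
    rw [OpenPartialHomeomorph.trans_source] at ht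
    exact b.right_inv ht.2
  refine ⟨DifferentialGroup.mk α, coords_injOn ψ hδ hγα ?_⟩
  rw [op_smul_mk, coords_mk_eq_jetAt ψ δ hδ, coords_mk_eq_jetAt ψ _ hγα]
  obtain ⟨T, -, hTc⟩ := exists_compJet r n n m
  apply jetSpace_ext S
  · rw [H'.xPart_jetAt, H''.xPart_jetAt, jetAt_congr hev]
  · rw [H'.yPart_jetAt, H''.yPart_jetAt]
    -- The `y`-parts are the jets of `h' ∘ b'` and `h ∘ b'`, which depend only on the jet of `b'`
    -- and the equal jets of `h'` and `h` at `b' 0`.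
    rw [← hTc b' h' b'.source b'.target b'.open_source H'.contDiffOn b'.open_target
      H'.contDiffOn_graph 0 H'.zero_mem (b'.map_source H'.zero_mem), ← hy]
    have e : h ∘ (α.toHomeo ≫ₕ b) =ᶠ[𝓝 0] h ∘ b' := hev.fun_comp h
    rw [jetAt_congr e, h0]
    exact hTc b' h b'.source b.target b'.open_source H'.contDiffOn b.open_target
      H.contDiffOn_graph 0 H'.zero_mem (by rw [← h0]; exact b.map_source H.zero_mem)

end ActionSmooth

/-! ### Minors and projections of injective linear maps -/

section LinearAlgebra

variable {n m N : ℕ}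

/-- An injective linear map has a nonvanishing maximal minor, with increasing row indices. -/
theorem exists_minor_ne_zero (hN : N = n + m)
    {L : EuclideanSpace ℝ (Fin n) →L[ℝ] EuclideanSpace ℝ (Fin N)} (hL : Function.Injective L) :
    ∃ S : Fin n ⊕ Fin m ≃ Fin N, StrictMono (fun k => S (Sum.inl k)) ∧
      (Matrix.of fun k j : Fin n => L (EuclideanSpace.single j (1 : ℝ)) (S (Sum.inl k))).det ≠ 0 := by
  classical
  let M : Matrix (Fin N) (Fin n) ℝ :=
    Matrix.of fun A j => L (EuclideanSpace.single j (1 : ℝ)) A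
  have hcol : LinearIndependent ℝ M.transpose.row := by
    have h1 := ((EuclideanSpace.basisFun (Fin n) ℝ).toBasis.linearIndependent.map'
      L.toLinearMap (LinearMap.ker_eq_bot.2 hL)).map'
      (EuclideanSpace.equiv (Fin N) ℝ).toLinearEquiv.toLinearMap (LinearEquiv.ker _)
    refine (?_ : _ = M.transpose.row) ▸ h1
    funext j
    ext A
    simp [M, Matrix.row]
  -- The columns are independent, and row rank equals column rank. Hence a maximal independent
  -- family of rows has `n` members; `s` is the set of their indices, to be listed in increasing
  -- order.
  have hrank : Module.finrank ℝ (Submodule.span ℝ (Set.range M.row)) = n := by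
    rw [← Matrix.rank_eq_finrank_span_row, ← Matrix.rank_transpose, hcol.rank_matrix,
      Fintype.card_fin]
  obtain ⟨κ, a, ha, hspan, hli⟩ := exists_linearIndependent' ℝ M.row
  have : Finite κ := hli.finite
  have := Fintype.ofFinite κ
  have hκ : Fintype.card κ = n := by
    rw [← finrank_span_eq_card hli, hspan, hrank]
  let s : Finset (Fin N) := Finset.univ.image a
  have hs : s.card = n := by
    rw [Finset.card_image_of_injective _ ha, Finset.card_univ, hκ]
  have hs' : sᶜ.card = m := by
    rw [Finset.card_compl, hs, Fintype.card_fin]; omega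
  let S := finSumEquivOfFinset hs hs'
  have hS : ∀ k, S (Sum.inl k) = s.orderEmbOfFin hs k := fun k => rfl
  have hmem : ∀ k, ∃ x, a x = S (Sum.inl k) := by
    intro k
    have := s.orderEmbOfFin_mem hs k
    rw [← hS] at this
    simpa [s] using this
  choose e he using hmem
  refine ⟨S, (s.orderEmbOfFin hs).strictMono, ?_⟩
  have he' : Function.Injective e := by
    intro k k' hkk
    have : S (Sum.inl k) = S (Sum.inl k') := by rw [← he, ← he, hkk]
    simpa using this
  have h1 := hli.comp e he'
  have h2 : (M.row ∘ a) ∘ e =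
      (Matrix.of fun k j : Fin n => L (EuclideanSpace.single j (1 : ℝ)) (S (Sum.inl k))).row := by
    funext k
    simp only [Function.comp_apply, he]
    rfl
  rw [h2, Matrix.linearIndependent_rows_iff_isUnit, Matrix.isUnit_iff_isUnit_det] at h1
  exact h1.ne_zero

/-- Two injective linear maps have a common left quotient of complementary dimension. -/
theorem exists_common_projection
    {A B : EuclideanSpace ℝ (Fin n) →ₗ[ℝ] EuclideanSpace ℝ (Fin N)}
    (hA : Function.Injective A) (hB : Function.Injective B) :
    ∃ p : EuclideanSpace ℝ (Fin N) →ₗ[ℝ] EuclideanSpace ℝ (Fin n),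
      Function.Injective (p ∘ₗ A) ∧ Function.Injective (p ∘ₗ B) := by
  obtain ⟨p, hp⟩ := A.exists_leftInverse_of_injective (LinearMap.ker_eq_bot.2 hA)
  obtain ⟨q, hq⟩ := B.exists_leftInverse_of_injective (LinearMap.ker_eq_bot.2 hB)
  have hfin : ∀ f : Module.End ℝ (EuclideanSpace ℝ (Fin n)), {μ | f.HasEigenvalue μ}.Finite :=
    fun f => Module.End.finite_hasEigenvalue f
  -- The witness is `p + s • q`. After `A` it is `1 + s • (q ∘ A)`, after `B` it is `p ∘ B + s • 1`.
  -- These are injective unless `-s⁻¹` is an eigenvalue of `q ∘ A` or `-s` one of `p ∘ B`, which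
  -- excludes finitely many `s`.
  obtain ⟨s, hs⟩ := (((hfin (q ∘ₗ A)).image fun μ => -μ⁻¹).union
    (((hfin (p ∘ₗ B)).image fun μ => -μ).union (Set.finite_singleton 0))).exists_notMem
  simp only [Set.mem_union, Set.mem_image, Set.mem_singleton_iff, not_or, not_exists, not_and] at hs
  obtain ⟨h1, h2, h3⟩ := hs
  refine ⟨p + s • q, ?_, ?_⟩
  · rw [injective_iff_map_eq_zero]
    intro v hv
    by_contra hne
    refine h1 (-s⁻¹) ?_ (by rw [inv_neg, inv_inv, neg_neg])
    refine Module.End.hasEigenvalue_of_hasEigenvector (x := v)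
      ⟨Module.End.mem_eigenspace_iff.2 ?_, hne⟩
    have e : v + s • q (A v) = 0 := by
      have := LinearMap.congr_fun hp v
      simp only [LinearMap.comp_apply, LinearMap.id_apply] at this
      rw [← hv]
      simp [this]
    have e' : s • q (A v) = -v := by rw [eq_neg_iff_add_eq_zero, add_comm]; exact e
    rw [LinearMap.comp_apply, neg_smul, ← smul_neg, ← e', smul_smul, inv_mul_cancel₀ h3, one_smul]
  · rw [injective_iff_map_eq_zero]
    intro v hv
    by_contra hne
    refine h2 (-s) ?_ (neg_neg s)
    refine Module.End.hasEigenvalue_of_hasEigenvector (x := v)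
      ⟨Module.End.mem_eigenspace_iff.2 ?_, hne⟩
    have e : p (B v) + s • v = 0 := by
      have := LinearMap.congr_fun hq v
      simp only [LinearMap.comp_apply, LinearMap.id_apply] at this
      rw [← hv]
      simp [this]
    rw [LinearMap.comp_apply, neg_smul, eq_neg_iff_add_eq_zero]
    exact e

/-- Complete `p` to an isomorphism by a projection onto its kernel, identified with `ℝᵐ`. As a
change of chart, `g` turns `p` into the projection to the coordinates `x^{i_k}`. -/
theorem exists_equiv_selectL_eq (S : Fin n ⊕ Fin m ≃ Fin N)
    {p : EuclideanSpace ℝ (Fin N) →ₗ[ℝ] EuclideanSpace ℝ (Fin n)} (hp : Function.Surjective p) :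
    ∃ g : EuclideanSpace ℝ (Fin N) ≃L[ℝ] EuclideanSpace ℝ (Fin N),
      ∀ v, selectL (fun k => S (Sum.inl k)) (g v) = p v := by
  have hcard : N = n + m := by simpa using (Fintype.card_congr S).symm
  have hdim : Module.finrank ℝ (LinearMap.ker p) =
      Module.finrank ℝ (EuclideanSpace ℝ (Fin m)) := by
    have := p.finrank_range_add_finrank_ker
    rw [LinearMap.range_eq_top.2 hp, finrank_top] at this
    simp only [finrank_euclideanSpace, Fintype.card_fin] at this ⊢
    omega
  let e := LinearEquiv.ofFinrankEq _ _ hdim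
  obtain ⟨P, hP⟩ := (LinearMap.ker p).subtype.exists_leftInverse_of_injective
    (Submodule.ker_subtype _)
  let q : EuclideanSpace ℝ (Fin N) →ₗ[ℝ] EuclideanSpace ℝ (Fin m) := e.toLinearMap ∘ₗ P
  let G : EuclideanSpace ℝ (Fin N) →ₗ[ℝ] EuclideanSpace ℝ (Fin N) :=
    { toFun := fun v => WithLp.toLp 2 fun A => Sum.elim (p v) (q v) (S.symm A)
      map_add' := fun v w => by
        ext A
        simp only [map_add, PiLp.add_apply]
        rcases S.symm A with k | σ <;> rfl
      map_smul' := fun s v => by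
        ext A
        simp only [map_smul, PiLp.smul_apply]
        rcases S.symm A with k | σ <;> rfl }
  have hGx : ∀ v k, G v (S (Sum.inl k)) = p v k := fun v k => by simp [G]
  have hGy : ∀ v σ, G v (S (Sum.inr σ)) = q v σ := fun v σ => by simp [G]
  have hG : Function.Injective G := by
    rw [injective_iff_map_eq_zero]
    intro v hv
    have h1 : p v = 0 := by
      ext k
      rw [← hGx, hv]
      rfl
    have h2 : q v = 0 := by
      ext σ
      rw [← hGy, hv]
      rfl
    have h3 : P v = 0 := by
      apply e.injective
      rw [map_zero]
      exact h2
    have h4 := LinearMap.congr_fun hP ⟨v, h1⟩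
    simp only [LinearMap.comp_apply, Submodule.subtype_apply, LinearMap.id_apply, h3] at h4
    exact (congrArg Subtype.val h4).symm
  refine ⟨(LinearEquiv.ofInjectiveEndo G hG).toContinuousLinearEquiv, fun v => ?_⟩
  ext k
  exact hGx v k

end LinearAlgebra

/-! ### Adapted domains through given velocities -/

section Covering

variable {r n m N : ℕ} {X : Type*} [TopologicalSpace X] [ChartedSpace (EuclideanSpace ℝ (Fin N)) X]
  [IsManifold (𝓡 N) ∞ X]

open RegularVelocity

theorem exists_strictMono_mem_adaptedDomain (hN : N = n + m) (v : RegularVelocity r n N X) :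
    ∃ (ψ : SmoothChart N X) (S : Fin n ⊕ Fin m ≃ Fin N),
      StrictMono (fun k => S (Sum.inl k)) ∧ v ∈ adaptedDomain r ψ S := by
  obtain ⟨γ, rfl⟩ := exists_rep v
  let ψ : SmoothChart N X := ⟨_, IsManifold.chart_mem_maximalAtlas (γ.toFun 0)⟩
  have hγ : γ.toFun 0 ∈ ψ.1.source := mem_chart_source _ _
  obtain ⟨U, hU, h0, -, -, hi⟩ := γ.exists_contDiffOn ψ hγ
  obtain ⟨S, hS, hdet⟩ := exists_minor_ne_zero hN (hi 0 h0)
  exact ⟨ψ, S, hS, γ, rfl, hγ, hdet⟩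

/-- Two velocities with the same target lie in a common adapted domain. -/
theorem exists_common_adaptedDomain (S : Fin n ⊕ Fin m ≃ Fin N) {v w : RegularVelocity r n N X}
    (hvw : v.target = w.target) :
    ∃ ψ : SmoothChart N X, v ∈ adaptedDomain r ψ S ∧ w ∈ adaptedDomain r ψ S := by
  obtain ⟨γ, rfl⟩ := exists_rep v
  obtain ⟨δ, rfl⟩ := exists_rep w
  let ψ : SmoothChart N X := ⟨_, IsManifold.chart_mem_maximalAtlas (γ.toFun 0)⟩
  have hγ : γ.toFun 0 ∈ ψ.1.source := mem_chart_source _ _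
  have hδ : δ.toFun 0 ∈ ψ.1.source := by
    rw [show δ.toFun 0 = γ.toFun 0 from hvw.symm]; exact hγ
  have hinj : ∀ ε : ImmersionGerm n N X, ε.toFun 0 ∈ ψ.1.source →
      Function.Injective (fderiv ℝ (ψ.1 ∘ ε.toFun) 0) := by
    intro ε hε
    obtain ⟨U, hU, h0, -, -, hi⟩ := ε.exists_contDiffOn ψ hε
    exact hi 0 h0
  obtain ⟨p, hp, hp'⟩ := exists_common_projection
    (A := (fderiv ℝ (ψ.1 ∘ γ.toFun) 0).toLinearMap)
    (B := (fderiv ℝ (ψ.1 ∘ δ.toFun) 0).toLinearMap) (hinj γ hγ) (hinj δ hδ)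
  have hsurj : Function.Surjective p := by
    have h1 := LinearMap.injective_iff_surjective.1 hp
    rw [LinearMap.coe_comp] at h1
    exact h1.of_comp
  obtain ⟨g, hg⟩ := exists_equiv_selectL_eq S hsurj
  have hg1 : ContMDiff (𝓡 N) (𝓡 N) ∞ g := g.contDiff.contMDiff
  have hg2 : ContMDiff (𝓡 N) (𝓡 N) ∞ g.symm := g.symm.contDiff.contMDiff
  -- The `x`-part of this chart is `p ∘ ψ`, and `p` is injective on both tangent images. The
  -- determinant condition thus holds for both velocities, with the given splitting.
  let ψ' : SmoothChart N X := ⟨ψ.1 ≫ₕ g.toHomeomorph.toOpenPartialHomeomorph, by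
    rw [IsManifold.mem_maximalAtlas_iff_contMDiffOn]
    refine ⟨?_, ?_⟩
    · refine hg1.comp_contMDiffOn ((contMDiffOn_of_mem_maximalAtlas ψ.2).mono ?_)
      rw [OpenPartialHomeomorph.trans_source]
      exact Set.inter_subset_left
    · refine (contMDiffOn_symm_of_mem_maximalAtlas ψ.2).comp hg2.contMDiffOn ?_
      rw [OpenPartialHomeomorph.trans_target]
      exact Set.inter_subset_right⟩
  have key : ∀ ε : ImmersionGerm n N X, ε.toFun 0 ∈ ψ.1.source →
      Function.Injective (p ∘ₗ (fderiv ℝ (ψ.1 ∘ ε.toFun) 0).toLinearMap) →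
      mk ε ∈ adaptedDomain r ψ' S := by
    intro ε hε hi
    have hd := ((ε.contDiffAt ψ hε).differentiableAt (by simp)).hasFDerivAt
    have hd' : HasFDerivAt (ψ'.1 ∘ ε.toFun) _ 0 := g.hasFDerivAt.comp 0 hd
    refine ⟨ε, rfl, ?_, ?_⟩
    · change ε.toFun 0 ∈ (ψ.1 ≫ₕ g.toHomeomorph.toOpenPartialHomeomorph).source
      rw [OpenPartialHomeomorph.trans_source]
      exact ⟨hε, trivial⟩
    · rw [det_jacobian_iff S hd'.differentiableAt,
        ((selectL fun k => S (Sum.inl k)).hasFDerivAt.comp 0 hd').fderiv]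
      intro x y hxy
      refine hi ?_
      simpa [hg] using hxy
  exact ⟨ψ', key γ hγ hp, key δ hδ hp'⟩

/-- A chart forces `X` to have a point, and `S` supplies an injective linear map `ℝⁿ → ℝᴺ`; a
translate of it through that point, read in a chart there, is an immersion. -/
theorem nonempty_regularVelocity (r : ℕ) (ψ : SmoothChart N X) (S : Fin n ⊕ Fin m ≃ Fin N) :
    Nonempty (RegularVelocity r n N X) := by
  obtain ⟨f, H⟩ := exists_graphForm_of_graph S
    (a := OpenPartialHomeomorph.refl (EuclideanSpace ℝ (Fin n))) (h := fun _ => 0)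
    (Set.mem_univ 0) contDiffOn_id contDiffOn_id contDiffOn_const
  -- The inverse chart is a total function, so this is a point of `X`, though perhaps not one of the
  -- domain of `ψ`.
  let x : X := ψ.1.symm 0
  let ψ' : SmoothChart N X := ⟨_, IsManifold.chart_mem_maximalAtlas x⟩
  let b := ψ'.1 x - f 0
  have hinj : Function.Injective (fderiv ℝ (fun t => f t + b) 0) := by
    rw [fderiv_add_const]
    exact H.injective_fderiv_fun H.zero_mem
  obtain ⟨γ, -, -⟩ := exists_immersionGerm ψ' (f := fun t => f t + b) isOpen_univ
    (Set.mem_univ 0) (H.contDiffOn_fun.add contDiffOn_const)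
    (by simpa [b] using ψ'.1.map_source (mem_chart_source _ x)) hinj
  exact ⟨mk γ⟩

end Covering

/-! ### Equivariant frames and freeness of the action -/

section Frames

variable {r n m N : ℕ} {X : Type*} [TopologicalSpace X] [ChartedSpace (EuclideanSpace ℝ (Fin N)) X]
  [IsManifold (𝓡 N) ∞ X]

open RegularVelocity

theorem restrict_jetAt_add_const (f : EuclideanSpace ℝ (Fin n) → EuclideanSpace ℝ (Fin n))
    (c t : EuclideanSpace ℝ (Fin n)) :
    DifferentialGroup.restrict (jetAt r (fun s => f s + c) t) =
      DifferentialGroup.restrict (jetAt r f t) := by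
  funext p
  simp only [DifferentialGroup.restrict, jetAt]
  rcases (p.2.1.sort (· ≤ ·)).eq_nil_or_concat' with h | ⟨l, j, h⟩
  · have h1 := p.2.2.1
    rw [← Multiset.length_sort (· ≤ ·), h] at h1
    simp at h1
  · rw [h, pd_add_const]

/-- The equivariant map `v ↦ (x^k_J)_{1 ≤ |J| ≤ r}` from the adapted domain to the differential
group. -/
theorem exists_frame (ψ : SmoothChart N X) (S : Fin n ⊕ Fin m ≃ Fin N)
    {v : RegularVelocity r n N X} (hv : v ∈ adaptedDomain r ψ S) :
    ∃ l : DifferentialGroup r n, ∀ a : DifferentialGroup r n, (l * a).coords =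
      DifferentialGroup.restrict (xPart S (coords ψ (MulOpposite.op a • v))) := by
  obtain ⟨γ, b, h, rfl, hγ, H, -⟩ := exists_rep_graphForm ψ S hv
  let τ : OpenPartialHomeomorph (EuclideanSpace ℝ (Fin n)) (EuclideanSpace ℝ (Fin n)) :=
    (Homeomorph.addRight (-b 0)).toOpenPartialHomeomorph
  -- The diffeomorphism `b` of the graph form, translated so as to fix `0`; its jet is the group
  -- element `l`.
  let δ : DiffGerm n :=
    { toHomeo := b ≫ₕ τ
      smooth := (contDiffGroupoid ∞ (𝓡 n)).trans
        ((DiffGerm.mem_contDiffGroupoid_iff _).2 ⟨H.contDiffOn, H.contDiffOn_symm⟩)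
        ((DiffGerm.mem_contDiffGroupoid_iff _).2
          ⟨(contDiff_id.add contDiff_const).contDiffOn,
            (contDiff_id.add contDiff_const).contDiffOn⟩)
      zero_mem := by
        rw [OpenPartialHomeomorph.trans_source]
        exact ⟨H.zero_mem, trivial⟩
      map_zero := add_neg_cancel (b 0) }
  refine ⟨DifferentialGroup.mk δ, fun a => ?_⟩
  obtain ⟨α, rfl⟩ := DifferentialGroup.exists_rep a
  have H' : GraphForm S (ψ.1 ∘ (γ.comp α).toFun) _ h := H.comp α
  have hγα : (γ.comp α).toFun 0 ∈ ψ.1.source := by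
    change γ.toFun (α.toHomeo 0) ∈ _
    rwa [α.map_zero]
  rw [op_smul_mk, coords_mk_eq_jetAt ψ _ hγα, H'.xPart_jetAt, DifferentialGroup.mk_mul_mk,
    DifferentialGroup.coords_mk_eq_restrict]
  -- The `x`-part of `γ ∘ α` is `b ∘ α`, which differs from `δ ∘ α` by a constant.
  exact restrict_jetAt_add_const _ (-b 0) 0

/-- If `a` fixes `v`, then `l * a` and `l * 1` have the same coordinates, and `l` cancels. -/
theorem op_smul_eq_self (hN : N = n + m) (v : RegularVelocity r n N X)
    (a : DifferentialGroup r n) (h : MulOpposite.op a • v = v) : a = 1 := by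
  obtain ⟨ψ, S, -, hv⟩ := exists_strictMono_mem_adaptedDomain hN v
  obtain ⟨l, hl⟩ := exists_frame ψ S hv
  have h1 := hl a
  have h2 := hl 1
  rw [h] at h1
  rw [MulOpposite.op_one, one_smul, ← h1] at h2
  exact (mul_left_cancel (DifferentialGroup.coords_injective h2)).symm

end Frames

/-! ### Manifold structure of the contact elements and the principal bundle -/

section Main

variable {r n m N : ℕ} {X : Type*} [TopologicalSpace X] [ChartedSpace (EuclideanSpace ℝ (Fin N)) X]
  [IsManifold (𝓡 N) ∞ X]

open RegularVelocity

/-- The splitting of the jet space into the coordinates `(x^k, y^σ_J)` and the coordinates `x^k_J`,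
`1 ≤ |J|`. -/
theorem exists_splitting (r : ℕ) (S : Fin n ⊕ Fin m ≃ Fin N) :
    ∃ κ : JetSpace r n N ≃L[ℝ] ContactSpace r n m × DifferentialGroup.CoordSpace r n,
      ∀ c, κ c = (coordProj S c, DifferentialGroup.restrict (xPart S c)) := by
  let x (q : ContactSpace r n m × DifferentialGroup.CoordSpace r n) : JetSpace r n n := fun p =>
    if h : 1 ≤ p.2.1.card then q.2 (p.1, ⟨p.2.1, h, p.2.2⟩) else q.1.1 p.1
  let κ : JetSpace r n N ≃ₗ[ℝ] ContactSpace r n m × DifferentialGroup.CoordSpace r n :=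
    { toFun := fun c => (coordProj S c, DifferentialGroup.restrict (xPart S c))
      map_add' := fun _ _ => rfl
      map_smul' := fun _ _ => rfl
      invFun := fun q => joinJet S (x q) q.1.2
      left_inv := by
        intro c
        apply jetSpace_ext S
        · rw [xPart_joinJet]
          funext p
          change dite _ _ _ = _
          split_ifs with h
          · rfl
          · have hp : p.2 = ⟨0, Nat.zero_le r⟩ := by
              apply Subtype.ext
              change p.2.1 = 0
              rw [← Multiset.card_eq_zero]
              omega
            change c (S (Sum.inl p.1), ⟨0, Nat.zero_le r⟩) = c (S (Sum.inl p.1), p.2)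
            rw [hp]
        · rw [yPart_joinJet]
          rfl
      right_inv := by
        intro q
        refine Prod.ext (Prod.ext ?_ ?_) ?_
        · funext k
          exact (congrFun (xPart_joinJet S (x q) q.1.2) (k, ⟨0, Nat.zero_le r⟩)).trans
            (dif_neg (by simp))
        · exact yPart_joinJet S (x q) q.1.2
        · funext p
          exact (congrFun (xPart_joinJet S (x q) q.1.2) (p.1, ⟨p.2.1, p.2.2.2⟩)).trans
            (dif_pos p.2.2.1) }
  exact ⟨κ.toContinuousLinearEquiv, fun c => rfl⟩

theorem proj_surjective : Function.Surjective (proj : RegularVelocity r n N X → _) :=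
  fun b => Quotient.exists_rep b

theorem proj_eq_proj_iff {v w : RegularVelocity r n N X} :
    proj v = proj w ↔ ∃ a : DifferentialGroup r n, w = MulOpposite.op a • v := by
  constructor
  · intro h
    obtain ⟨a, ha⟩ := Quotient.exact h.symm
    exact ⟨a.unop, ha.symm⟩
  · rintro ⟨a, rfl⟩
    exact (Quotient.sound (s := MulAction.orbitRel _ _) ⟨MulOpposite.op a, rfl⟩).symm

theorem proj_preimage_image_adaptedDomain (ψ : SmoothChart N X) (S : Fin n ⊕ Fin m ≃ Fin N) :
    proj ⁻¹' (proj '' adaptedDomain r ψ S) = adaptedDomain r ψ S := by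
  refine Set.Subset.antisymm ?_ (Set.subset_preimage_image _ _)
  rintro w ⟨v, hv, hvw⟩
  obtain ⟨a, rfl⟩ := proj_eq_proj_iff.1 hvw
  exact (op_smul_mem_adaptedDomain ψ S hv a).1

theorem proj_eq_proj_iff_coordProj (ψ : SmoothChart N X) (S : Fin n ⊕ Fin m ≃ Fin N)
    {v w : RegularVelocity r n N X} (hv : v ∈ adaptedDomain r ψ S)
    (hw : w ∈ adaptedDomain r ψ S) :
    proj v = proj w ↔ coordProj S (adaptedCoords S (coords ψ v)) =
      coordProj S (adaptedCoords S (coords ψ w)) := by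
  rw [proj_eq_proj_iff]
  constructor
  · rintro ⟨a, rfl⟩
    exact (op_smul_mem_adaptedDomain ψ S hv a).2.symm
  · exact exists_op_smul_eq ψ S hv hw

/-- A compatible pair of charts: adapted coordinates on the velocities, and the induced
coordinates on the contact elements. -/
structure IsChartPair [TopologicalSpace (ContactElement r n N X)]
    [ChartedSpace (ContactSpace r n m) (ContactElement r n N X)]
    (ψ : SmoothChart N X) (S : Fin n ⊕ Fin m ≃ Fin N)
    (Φ : OpenPartialHomeomorph (RegularVelocity r n N X) (JetSpace r n N))
    (χ : OpenPartialHomeomorph (ContactElement r n N X) (ContactSpace r n m)) : Prop where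
  mem_maximalAtlas : Φ ∈ IsManifold.maximalAtlas 𝓘(ℝ, JetSpace r n N) ∞ (RegularVelocity r n N X)
  mem_maximalAtlas' :
    χ ∈ IsManifold.maximalAtlas 𝓘(ℝ, ContactSpace r n m) ∞ (ContactElement r n N X)
  source_eq : Φ.source = adaptedDomain r ψ S
  apply_eq : ∀ v, Φ v = adaptedCoords S (coords ψ v)
  source_eq' : χ.source = proj '' adaptedDomain r ψ S
  apply_proj : ∀ v ∈ adaptedDomain r ψ S, χ (proj v) = coordProj S (Φ v)

/-- The quotient topology, with the charts induced from all pairs `(ψ, S)`. The chart pairs are all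
that the later arguments use of the construction. -/
theorem exists_contactElement_manifold (r n m : ℕ) {N : ℕ} (hN : N = n + m) (X : Type*)
    [TopologicalSpace X] [ChartedSpace (EuclideanSpace ℝ (Fin N)) X] [IsManifold (𝓡 N) ∞ X] :
    ∃ (_ : TopologicalSpace (ContactElement r n N X))
      (_ : ChartedSpace (ContactSpace r n m) (ContactElement r n N X)),
      IsManifold 𝓘(ℝ, ContactSpace r n m) ∞ (ContactElement r n N X) ∧
      ∀ (ψ : SmoothChart N X) (S : Fin n ⊕ Fin m ≃ Fin N), ∃ Φ χ, IsChartPair (r := r) ψ S Φ χ := by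
  let t : TopologicalSpace (ContactElement r n N X) :=
    TopologicalSpace.coinduced (proj : RegularVelocity r n N X → _) inferInstance
  have hπ : Topology.IsQuotientMap (proj : RegularVelocity r n N X → ContactElement r n N X) :=
    ⟨⟨rfl⟩, proj_surjective⟩
  choose Φ hΦ hs hc using fun i : SmoothChart N X × (Fin n ⊕ Fin m ≃ Fin N) =>
    have := nonempty_regularVelocity r i.1 i.2
    exists_adaptedChart (r := r) i.1 i.2
  choose κ hκ using fun i : SmoothChart N X × (Fin n ⊕ Fin m ≃ Fin N) => exists_splitting r i.2
  obtain ⟨c, hM, hχ⟩ := exists_quotient_manifold hπ Φ hΦ κ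
    (fun i => by rw [hs]; exact proj_preimage_image_adaptedDomain _ _)
    (fun i v hv w hw => by
      rw [hs] at hv hw
      rw [proj_eq_proj_iff_coordProj i.1 i.2 hv hw, hκ, hκ, hc, hc])
    (fun v => by
      obtain ⟨ψ, S, -, hv⟩ := exists_strictMono_mem_adaptedDomain (m := m) hN v
      exact ⟨(ψ, S), by rw [hs]; exact hv⟩)
  refine ⟨t, c, hM, fun ψ S => ?_⟩
  obtain ⟨χ, hχm, hχs, hχc⟩ := hχ (ψ, S)
  rw [hs] at hχs hχc
  exact ⟨Φ (ψ, S), χ, hΦ _, hχm, hs _, hc _, hχs, fun v hv => by rw [hχc v hv, hκ]⟩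

section Structure

variable [TopologicalSpace (ContactElement r n N X)]
  [ChartedSpace (ContactSpace r n m) (ContactElement r n N X)]
  {ψ : SmoothChart N X} {S : Fin n ⊕ Fin m ≃ Fin N}
  {Φ : OpenPartialHomeomorph (RegularVelocity r n N X) (JetSpace r n N)}
  {χ : OpenPartialHomeomorph (ContactElement r n N X) (ContactSpace r n m)}

/-- In a chart pair the projection is the first component of the linear splitting `κ`. -/
theorem isSubmersion_proj (hN : N = n + m)
    (H : ∀ (ψ : SmoothChart N X) (S : Fin n ⊕ Fin m ≃ Fin N), ∃ Φ χ, IsChartPair (r := r) ψ S Φ χ) :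
    Manifold.IsSubmersion 𝓘(ℝ, JetSpace r n N) 𝓘(ℝ, ContactSpace r n m) ∞
      (proj : RegularVelocity r n N X → ContactElement r n N X) := by
  refine ⟨DifferentialGroup.CoordSpace r n, inferInstance, inferInstance, fun v => ?_⟩
  obtain ⟨ψ, S, -, hv⟩ := exists_strictMono_mem_adaptedDomain (m := m) hN v
  obtain ⟨Φ, χ, h⟩ := H ψ S
  obtain ⟨κ, hκ⟩ := exists_splitting r S
  refine Manifold.IsSubmersionAtOfComplement.mk_of_charts κ Φ χ (by rw [h.source_eq]; exact hv)
    (by rw [h.source_eq']; exact ⟨v, hv, rfl⟩) h.mem_maximalAtlas h.mem_maximalAtlas' ?_ ?_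
  · rw [h.source_eq, h.source_eq']
    exact Set.subset_preimage_image _ _
  · intro d hd
    have hd' : d ∈ Φ.target := by simpa using hd
    have hw := Φ.map_target hd'
    rw [h.source_eq] at hw
    simp only [OpenPartialHomeomorph.extend_coe, modelWithCornersSelf_coe, Function.id_comp,
      OpenPartialHomeomorph.extend_coe_symm, modelWithCornersSelf_coe_symm, Function.comp_id,
      Function.comp_apply]
    rw [h.apply_proj _ hw, Φ.right_inv hd', hκ]

/-- The equivariant local trivialization over the domain of an adapted chart. -/
theorem IsChartPair.exists_trivialization [IsManifold 𝓘(ℝ, ContactSpace r n m) ∞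
    (ContactElement r n N X)] (h : IsChartPair ψ S Φ χ) :
    ∃ e : Bundle.Trivialization (DifferentialGroup r n)
        (proj : RegularVelocity r n N X → ContactElement r n N X),
      e.baseSet = proj '' adaptedDomain r ψ S ∧
      ContMDiffOn 𝓘(ℝ, JetSpace r n N)
        (𝓘(ℝ, ContactSpace r n m).prod 𝓘(ℝ, DifferentialGroup.CoordSpace r n)) ∞ e e.source ∧
      ContMDiffOn (𝓘(ℝ, ContactSpace r n m).prod 𝓘(ℝ, DifferentialGroup.CoordSpace r n))
        𝓘(ℝ, JetSpace r n N) ∞ e.toOpenPartialHomeomorph.symm e.target ∧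
      ∀ v ∈ e.source, ∀ a : DifferentialGroup r n,
        (e (MulOpposite.op a • v)).2 = (e v).2 * a := by
  obtain ⟨κ, hκ⟩ := exists_splitting r S
  obtain ⟨g, hgm, hgs, hgc⟩ := DifferentialGroup.exists_coordChart r n
  -- The coordinates `(x^k, y^σ_J)` are read as a point of the base and the `x^k_J`, `|J| ≥ 1`, as a
  -- group element. As a composite of charts it is smooth in both directions.
  let e₀ : OpenPartialHomeomorph (RegularVelocity r n N X)
      (ContactElement r n N X × DifferentialGroup r n) :=
    (Φ ≫ₕ κ.toHomeomorph.toOpenPartialHomeomorph) ≫ₕ (χ.symm.prod g.symm)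
  have hinv : ∀ v ∈ adaptedDomain r ψ S, proj v ∈ χ.source := fun v hv => by
    rw [h.source_eq']; exact ⟨v, hv, rfl⟩
  have hframe : ∀ v ∈ adaptedDomain r ψ S, ∃ l : DifferentialGroup r n,
      ∀ a : DifferentialGroup r n, DifferentialGroup.restrict
        (xPart S (Φ (MulOpposite.op a • v))) = g (l * a) := by
    intro v hv
    obtain ⟨l, hl⟩ := exists_frame ψ S hv
    exact ⟨l, fun a => by rw [h.apply_eq, xPart_adaptedCoords, hgc, hl]⟩
  have hg : ∀ l, l ∈ g.source := fun l => by rw [hgs]; trivial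
  have hsource : e₀.source = adaptedDomain r ψ S := by
    ext v
    simp only [e₀, OpenPartialHomeomorph.trans_source, Set.mem_inter_iff, Set.mem_preimage,
      h.source_eq, OpenPartialHomeomorph.prod_source, OpenPartialHomeomorph.symm_source,
      Set.mem_prod, OpenPartialHomeomorph.coe_trans, Function.comp_apply,
      Homeomorph.toOpenPartialHomeomorph_source, Set.mem_univ, and_true,
      Homeomorph.toOpenPartialHomeomorph_apply, ContinuousLinearEquiv.coe_toHomeomorph, hκ]
    refine ⟨fun hv => hv.1, fun hv => ⟨hv, ?_, ?_⟩⟩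
    · rw [← h.apply_proj v hv]
      exact χ.map_source (hinv v hv)
    · obtain ⟨l, hl⟩ := hframe v hv
      have := hl 1
      rw [MulOpposite.op_one, one_smul] at this
      rw [this]
      exact g.map_source (hg _)
  have happly : ∀ v, e₀ v = (χ.symm (coordProj S (Φ v)),
      g.symm (DifferentialGroup.restrict (xPart S (Φ v)))) := by
    intro v
    change (χ.symm (κ (Φ v)).1, g.symm (κ (Φ v)).2) = _
    rw [hκ]
  -- The values along the whole orbit of `v`. From this come the first component, the equivariance
  -- and, with `a` running over the group, the target.
  have hval : ∀ v ∈ adaptedDomain r ψ S, ∃ l : DifferentialGroup r n,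
      ∀ a : DifferentialGroup r n, e₀ (MulOpposite.op a • v) = (proj v, l * a) := by
    intro v hv
    obtain ⟨l, hl⟩ := hframe v hv
    refine ⟨l, fun a => ?_⟩
    have hva := (op_smul_mem_adaptedDomain ψ S hv a).1
    rw [happly, hl a, ← h.apply_proj _ hva, χ.left_inv (hinv _ hva), g.left_inv (hg _)]
    rw [← (proj_eq_proj_iff (v := v)).2 ⟨a, rfl⟩]
  have hfst : ∀ v ∈ adaptedDomain r ψ S, (e₀ v).1 = proj v := by
    intro v hv
    obtain ⟨l, hl⟩ := hval v hv
    have := hl 1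
    rw [MulOpposite.op_one, one_smul] at this
    rw [this]
  have htarget : e₀.target = (proj '' adaptedDomain r ψ S) ×ˢ Set.univ := by
    ext ⟨b, a⟩
    constructor
    · intro hb
      have hv := e₀.map_target hb
      rw [hsource] at hv
      refine ⟨⟨_, hv, ?_⟩, trivial⟩
      rw [← hfst _ hv, e₀.right_inv hb]
    · rintro ⟨⟨v, hv, rfl⟩, -⟩
      obtain ⟨l, hl⟩ := hval v hv
      -- Since `v` has group component `l`, its translate by `l⁻¹ * a` has group component `a`.
      have h1 := hl (l⁻¹ * a)
      rw [mul_inv_cancel_left] at h1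
      change (proj v, a) ∈ e₀.target
      rw [← h1]
      exact e₀.map_source (by rw [hsource]; exact (op_smul_mem_adaptedDomain ψ S hv _).1)
  refine ⟨{ toOpenPartialHomeomorph := e₀
            baseSet := proj '' adaptedDomain r ψ S
            open_baseSet := by rw [← h.source_eq']; exact χ.open_source
            source_eq := by rw [hsource, proj_preimage_image_adaptedDomain]
            target_eq := htarget
            proj_toFun := fun v hv => hfst v (by rwa [hsource] at hv) }, rfl, ?_, ?_, ?_⟩
  · change ContMDiffOn _ _ _ e₀ e₀.source
    intro v hv
    have hv' := hv
    rw [hsource] at hv'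
    have h1 : ContMDiffAt 𝓘(ℝ, JetSpace r n N) _ ∞ Φ v :=
      contMDiffAt_of_mem_maximalAtlas h.mem_maximalAtlas (by rw [h.source_eq]; exact hv')
    have h2 : ContMDiffAt 𝓘(ℝ, JetSpace r n N) 𝓘(ℝ, ContactSpace r n m) ∞
        (fun w => (κ (Φ w)).1) v :=
      ContMDiffAt.comp (g := fun d => (κ d).1) (f := Φ) v (contDiff_fst.comp κ.contDiff).contMDiff.contMDiffAt h1
    have h3 : ContMDiffAt 𝓘(ℝ, JetSpace r n N) 𝓘(ℝ, DifferentialGroup.CoordSpace r n) ∞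
        (fun w => (κ (Φ w)).2) v :=
      ContMDiffAt.comp (g := fun d => (κ d).2) (f := Φ) v (contDiff_snd.comp κ.contDiff).contMDiff.contMDiffAt h1
    have hv2 := hv.2
    rw [Set.mem_preimage, OpenPartialHomeomorph.prod_source] at hv2
    exact ((ContMDiffAt.comp v (contMDiffAt_symm_of_mem_maximalAtlas h.mem_maximalAtlas' hv2.1)
      h2).prodMk (ContMDiffAt.comp v (contMDiffAt_symm_of_mem_maximalAtlas hgm hv2.2)
      h3)).contMDiffWithinAt
  · change ContMDiffOn _ _ _ e₀.symm e₀.target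
    rintro ⟨b, a⟩ hb
    have hb' := hb
    rw [htarget, ← h.source_eq'] at hb'
    have h1 : ContMDiffAt (𝓘(ℝ, ContactSpace r n m).prod 𝓘(ℝ, DifferentialGroup.CoordSpace r n))
        𝓘(ℝ, ContactSpace r n m × DifferentialGroup.CoordSpace r n) ∞
        (fun q : ContactElement r n N X × DifferentialGroup r n => (χ q.1, g q.2)) (b, a) :=
      (ContMDiffAt.comp (b, a) (contMDiffAt_of_mem_maximalAtlas h.mem_maximalAtlas' hb'.1)
        contMDiffAt_fst).prodMk_space
      (ContMDiffAt.comp (b, a) (contMDiffAt_of_mem_maximalAtlas hgm (hg a)) contMDiffAt_snd)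
    have h2 : ContMDiffAt (𝓘(ℝ, ContactSpace r n m).prod 𝓘(ℝ, DifferentialGroup.CoordSpace r n))
        𝓘(ℝ, JetSpace r n N) ∞ (fun q : ContactElement r n N X × DifferentialGroup r n =>
          κ.symm (χ q.1, g q.2)) (b, a) :=
      ContMDiffAt.comp (b, a) κ.symm.contDiff.contMDiff.contMDiffAt h1
    have h3 : κ.symm (χ b, g a) ∈ Φ.target := by
      have := hb.2
      rw [Set.mem_preimage, OpenPartialHomeomorph.trans_target] at this
      exact this.2
    exact (ContMDiffAt.comp (b, a) (contMDiffAt_symm_of_mem_maximalAtlas h.mem_maximalAtlas h3)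
      h2).contMDiffWithinAt
  · intro v hv a
    change (e₀ _).2 = (e₀ v).2 * a
    change v ∈ e₀.source at hv
    rw [hsource] at hv
    obtain ⟨l, hl⟩ := hval v hv
    have := hl 1
    rw [MulOpposite.op_one, one_smul, mul_one] at this
    rw [hl, this]

theorem isRightPrincipalBundle_proj [IsManifold 𝓘(ℝ, ContactSpace r n m) ∞
    (ContactElement r n N X)] (hN : N = n + m)
    (H : ∀ (ψ : SmoothChart N X) (S : Fin n ⊕ Fin m ≃ Fin N), ∃ Φ χ, IsChartPair (r := r) ψ S Φ χ) :
    IsRightPrincipalBundle (EG := DifferentialGroup.CoordSpace r n) (ET := JetSpace r n N)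
      (EB := ContactSpace r n m) (G := DifferentialGroup r n)
      (proj : RegularVelocity r n N X → ContactElement r n N X) where
  lieGroup := inferInstance
  isManifold_total := inferInstance
  isManifold_base := inferInstance
  surjective := proj_surjective
  contMDiff_proj := (isSubmersion_proj hN H).contMDiff
  contMDiff_action := contMDiff_op_smul
  free := op_smul_eq_self hN
  fibre_eq_orbit := fun _ _ => proj_eq_proj_iff
  locallyTrivial := by
    intro b
    obtain ⟨v, rfl⟩ := proj_surjective b
    obtain ⟨ψ, S, -, hv⟩ := exists_strictMono_mem_adaptedDomain (m := m) hN v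
    obtain ⟨Φ, χ, h⟩ := H ψ S
    obtain ⟨e, he, h1, h2, h3⟩ := h.exists_trivialization
    exact ⟨e, by rw [he]; exact ⟨v, hv, rfl⟩, h1, h2, h3⟩

/-- The target descends to a continuous map to `X`, which separates contact elements at different
points. Two at the same point lie in the domain of one adapted chart, and injectivity of that chart
separates them. -/
theorem t2Space_contactElement [T2Space X] (hN : N = n + m)
    (H : ∀ (ψ : SmoothChart N X) (S : Fin n ⊕ Fin m ≃ Fin N), ∃ Φ χ, IsChartPair (r := r) ψ S Φ χ) :
    T2Space (ContactElement r n N X) := by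
  have hπ := isQuotientMap_of_isSubmersion (isSubmersion_proj hN H) proj_surjective
  let τ : ContactElement r n N X → X := fun b => (Function.surjInv proj_surjective b).target
  have hτ : ∀ v : RegularVelocity r n N X, τ (proj v) = v.target := by
    intro v
    obtain ⟨a, ha⟩ := proj_eq_proj_iff.1 (Function.surjInv_eq proj_surjective (proj v)).symm
    change (Function.surjInv proj_surjective (proj v)).target = _
    rw [ha, target_op_smul]
  have hτc : Continuous τ := by
    rw [hπ.continuous_iff, show τ ∘ proj = target from funext hτ]
    exact continuous_target
  refine ⟨fun x y hxy => ?_⟩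
  by_cases hτxy : τ x = τ y
  · obtain ⟨v, rfl⟩ := proj_surjective x
    obtain ⟨w, rfl⟩ := proj_surjective y
    rw [hτ, hτ] at hτxy
    -- Any splitting will do; the chart is adjusted to it in the next step.
    obtain ⟨-, S, -, -⟩ := exists_strictMono_mem_adaptedDomain (m := m) hN v
    obtain ⟨ψ, hv, hw⟩ := exists_common_adaptedDomain S hτxy
    obtain ⟨Φ, χ, h⟩ := H ψ S
    have hv' : proj v ∈ χ.source := by rw [h.source_eq']; exact ⟨v, hv, rfl⟩
    have hw' : proj w ∈ χ.source := by rw [h.source_eq']; exact ⟨w, hw, rfl⟩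
    obtain ⟨O, O', hO, hO', hvO, hwO', hd⟩ :=
      t2_separation fun e => hxy (χ.injOn hv' hw' e)
    refine ⟨_, _, χ.isOpen_inter_preimage hO, χ.isOpen_inter_preimage hO', ⟨hv', hvO⟩,
      ⟨hw', hwO'⟩, ?_⟩
    exact ((hd.preimage χ).mono Set.inter_subset_right Set.inter_subset_right)
  · exact separated_by_continuous hτc hτxy

theorem secondCountableTopology_contactElement [SecondCountableTopology X] (hN : N = n + m)
    (H : ∀ (ψ : SmoothChart N X) (S : Fin n ⊕ Fin m ≃ Fin N), ∃ Φ χ, IsChartPair (r := r) ψ S Φ χ) :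
    SecondCountableTopology (ContactElement r n N X) :=
  (isQuotientMap_of_isSubmersion (isSubmersion_proj hN H) proj_surjective).secondCountableTopology
    (isOpenMap_of_isSubmersion (isSubmersion_proj hN H))

end Structure

end Main

end Velocity

open Velocity
theorem mainTheorem2 (r n m N : ℕ) (hn : 1 ≤ n) (hN : N = n + m) (X : Type*) [TopologicalSpace X]
    [T2Space X] [SecondCountableTopology X] [ChartedSpace (EuclideanSpace ℝ (Fin N)) X]
    [IsManifold (𝓡 N) ∞ X] :
    ∃ (t : TopologicalSpace (ContactElement r n N X))
      (c : ChartedSpace (ContactSpace r n m) (ContactElement r n N X)),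
      -- `P^r_n X` is a smooth manifold and the projection is a submersion
      (T2Space (ContactElement r n N X) ∧
        SecondCountableTopology (ContactElement r n N X) ∧
        IsManifold 𝓘(ℝ, ContactSpace r n m) ∞ (ContactElement r n N X) ∧
        Manifold.IsSubmersion 𝓘(ℝ, JetSpace r n N) 𝓘(ℝ, ContactSpace r n m) ∞
          (proj : RegularVelocity r n N X → ContactElement r n N X)) ∧
      -- the smooth structure is unique
      (∀ (E : Type) [NormedAddCommGroup E] [NormedSpace ℝ E]
        (t' : TopologicalSpace (ContactElement r n N X))
        (c' : ChartedSpace E (ContactElement r n N X)),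
        IsManifold 𝓘(ℝ, E) ∞ (ContactElement r n N X) →
        Manifold.IsSubmersion 𝓘(ℝ, JetSpace r n N) 𝓘(ℝ, E) ∞
          (proj : RegularVelocity r n N X → ContactElement r n N X) →
        SameSmoothStructure t c t' c') ∧
      -- `Imm T^r_n X` is a right principal `L^r_n`-bundle over `P^r_n X`
      IsRightPrincipalBundle (EG := DifferentialGroup.CoordSpace r n) (ET := JetSpace r n N)
        (EB := ContactSpace r n m) (G := DifferentialGroup r n)
        (proj : RegularVelocity r n N X → ContactElement r n N X) ∧
      -- the adapted charts on `Imm T^r_n X` and `P^r_n X`, and the projection in these charts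
      (∀ (ψ : SmoothChart N X) (S : Fin n ⊕ Fin m ≃ Fin N),
        proj ⁻¹' (proj '' adaptedDomain r ψ S) = adaptedDomain r ψ S ∧
        ∃ Φ ∈ IsManifold.maximalAtlas 𝓘(ℝ, JetSpace r n N) ∞ (RegularVelocity r n N X),
        ∃ χ ∈ IsManifold.maximalAtlas 𝓘(ℝ, ContactSpace r n m) ∞ (ContactElement r n N X),
          Φ.source = adaptedDomain r ψ S ∧
          (∀ v ∈ adaptedDomain r ψ S, Φ v = adaptedCoords S (v.coords ψ)) ∧
          χ.source = proj '' adaptedDomain r ψ S ∧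
          ∀ v ∈ adaptedDomain r ψ S, χ (proj v) = coordProj S (Φ v)) ∧
      -- these chart domains cover, already with increasing index tuples `i_1 < ⋯ < i_n`
      ∀ v : RegularVelocity r n N X, ∃ (ψ : SmoothChart N X) (S : Fin n ⊕ Fin m ≃ Fin N),
        StrictMono (fun k => S (Sum.inl k)) ∧ v ∈ adaptedDomain r ψ S := by
  obtain ⟨t, c, hM, H⟩ := exists_contactElement_manifold r n m hN X
  have hs := isSubmersion_proj hN H
  refine ⟨t, c, ⟨t2Space_contactElement hN H, secondCountableTopology_contactElement hN H, hM,
    hs⟩, fun E _ _ t' c' _ h' => ?_, isRightPrincipalBundle_proj hN H,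
    fun ψ S => ⟨proj_preimage_image_adaptedDomain ψ S, ?_⟩, fun v =>
      exists_strictMono_mem_adaptedDomain hN v⟩
  · exact sameSmoothStructure_of_isSubmersion proj_surjective t c t' c' hs h'
  · obtain ⟨Φ, χ, h⟩ := H ψ S
    exact ⟨Φ, h.mem_maximalAtlas, χ, h.mem_maximalAtlas', h.source_eq, fun v _ => h.apply_eq v,
      h.source_eq', h.apply_proj⟩
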